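/- **Setting.** Let $\mathcal C$ be a semisimple abelian balanced rigid braided tensor category over $\mathbb C$ (finite-dimensional Hom spaces, every object a finite direct sum of simple objects, bilinear tensor product, simple unit $\mathbf 1$, universal twist $\theta$). Let $A$ be a rigid commutative associative unital algebra in $\mathcal C$ with $\theta_A=\mathrm{id}$; rigid means that $\dim\mathrm{Hom}(\mathbf 1,A)=1$, the pairing $A\otimes A\to A\to\mathbf 1$ (multiplication followed by the projection splitting the unit $\mathbf 1\to A$) is non-degenerate, and $\dim A\neq0$. Let a finite group $G$ act faithfully on $A$ by algebra automorphisms $\pi_g$ with $A^G=\mathbf 1$. Let $\mathrm{Rep}\,A$ be the category of left $A$-modules in $\mathcal C$; for $X\in\mathrm{Rep}\,A$ and $g\in G$ let $X^g$ be the object $X$ with action $\mu_X\circ(\pi_g\otimes\mathrm{id})$. Let $\mathcal D$ be the category of pairs $(X,\varphi_X)$, where $X\in\mathrm{Rep}\,A$ and $\varphi_X(g)\colon X\to X$, $g\in G$, are morphisms of $\mathcal C$ with $\varphi_X(g)\circ\mu_X=\mu_X\circ(\pi_g\otimes\varphi_X(g))$, $\varphi_X(g)\varphi_X(h)=\varphi_X(gh)$,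 $\varphi_X(1)=\mathrm{id}$; morphisms are the $A$-module morphisms commuting with all $\varphi(g)$. Let $S$ be the set of isomorphism classes of simple $A$-modules, with the $G$-action $g[X]=[X^{g^{-1}}]$. Choose a representative $X_s$ of each $s\in S$ and $A$-module isomorphisms $\varphi_s(g)\colon X_s^{g^{-1}}\to X_{gs}$ for all $g\in G$, $s\in S$. For a $G$-orbit $\mathcal O\subset S$ let $\mathcal F[\mathcal O]$ be the algebra of functions $\mathcal O\to\mathbb C$ and $\mathcal F^*[\mathcal O]$ the group of non-vanishing ones, with $(g\cdot f)(s)=f(g^{-1}s)$. For a 2-cocycle $\alpha$ of $G$ with values in $\mathcal F^*[\mathcal O]$ let $\mathcal A_\alpha(G,\mathcal O)=\bigoplus_{g\in G}\mathcal F[\mathcal O]\,g$ with product $(fg)(f'g')=f\,(g\cdot f')\,\alpha(g,g')\,gg'$. $\mathrm{Rep}$ of an algebra is its category of finite-dimensional modules, and a direct sum of categories consists of families with only finitely many non-zero members. For a finite-dimensional vector space $V$ and $X\in\mathrm{Rep}\,A$, $V\boxtimes X\in\mathrm{Rep}\,A$ is the object with $\mathrm{Hom}_A(V\boxtimes X,Z)=\mathrm{Hom}_{\mathbb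 C}(V,\mathrm{Hom}_A(X,Z))$. **Theorem.** The category $\mathcal D$ is abelian. There is a unique 2-cocycle $\alpha$ of $G$ with values in $\mathcal F^*[S]$ such that $\varphi_{hs}(g)\,\varphi_s(h)=\alpha(g,h)(ghs)\,\varphi_s(gh)$ for all $g,h\in G$, $s\in S$. Its restrictions to the orbits are again denoted $\alpha$, and for $s\in S$ with stabilizer $G_s$ let $\alpha_s(g,h)=\alpha(g,h)(s)$, $g,h\in G_s$. Then: 1. There is an equivalence of ($\mathbb C$-linear) abelian categories $$\mathcal D\simeq\bigoplus_{\mathcal O}\mathrm{Rep}\,\mathcal A_{\alpha^{-1}}(G,\mathcal O),$$ where $\mathcal O$ runs over the $G$-orbits in $S$. It is given by $X\mapsto\big(\bigoplus_{s\in\mathcal O}\mathrm{Hom}_A(X_s,X)\big)_{\mathcal O}$, where $\mathcal F[\mathcal O]$ acts by multiplication on the components and $g\in G$ maps $a\in\mathrm{Hom}_A(X_s,X)$ to $\varphi_X(g)\circ a\circ\varphi_s(g)^{-1}\in\mathrm{Hom}_A(X_{gs},X)$. Its inverse is given by $(V_{\mathcal O})_{\mathcal O}\mapsto\bigoplus_{\mathcal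 O}V_{\mathcal O}\boxtimes_{\mathcal F[\mathcal O]}X_{\mathcal O}=\bigoplus_{s\in S}V_s\boxtimes X_s$, naturally in $(V_{\mathcal O})$, where $X_{\mathcal O}=\bigoplus_{s\in\mathcal O}X_s$ and $V_{\mathcal O}=\bigoplus_{s\in\mathcal O}V_s$ is the decomposition given by the action of $\mathcal F[\mathcal O]$, with $\varphi(g)=\bigoplus_s\varphi_{V_s}(g)\otimes\varphi_s(g)$, $\varphi_{V_s}(g)\colon V_s\to V_{gs}$ being the action of $1\cdot g\in\mathcal A_{\alpha^{-1}}(G,\mathcal O)$. 2. For every set $R\subset S$ of representatives of the $G$-orbits there is an equivalence of ($\mathbb C$-linear) abelian categories $$\mathcal D\simeq\bigoplus_{s\in R}\mathrm{Rep}\,\mathbb C^{\alpha_s^{-1}}[G_s],\qquad X\mapsto\big(\mathrm{Hom}_A(X_s,X)\big)_{s\in R},$$ where $\mathbb C^{\alpha_s^{-1}}[G_s]$ is the twisted group algebra, with basis $G_s$ and product $g\cdot h=\alpha_s(g,h)^{-1}gh$, and $g\in G_s$ acts on $\mathrm{Hom}_A(X_s,X)$ by $a\mapsto\varphi_X(g)\circ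 a\circ\varphi_s(g)^{-1}$. -/

import Mathlib

open CategoryTheory MonoidalCategory Limits

universe v u w

noncomputable section

namespace Orbifold

/-! ### Semisimple balanced rigid braided categories -/

/-- A balancing (universal twist) on a rigid braided category: a natural automorphism `θ` of the
identity functor with `θ_{X ⊗ Y} = c_{Y,X} c_{X,Y} (θ_X ⊗ θ_Y)`, `θ_𝟙 = id`, `θ_{X*} = (θ_X)*`. -/
class BalancedRigid (C : Type u) [Category.{v} C] [MonoidalCategory C] [BraidedCategory C]
    [RigidCategory C] where
  twist : 𝟭 C ≅ 𝟭 C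
  twist_tensor : ∀ X Y : C, twist.hom.app (X ⊗ Y) =
    (twist.hom.app X ⊗ₘ twist.hom.app Y) ≫ (β_ X Y).hom ≫ (β_ Y X).hom
  twist_unit : twist.hom.app (𝟙_ C) = 𝟙 (𝟙_ C)
  twist_dual : ∀ X : C, twist.hom.app (Xᘁ) = rightAdjointMate (twist.hom.app X)

attribute [local instance] Abelian.hasFiniteBiproducts in
/-- A semisimple abelian category over `ℂ`: spaces of morphisms are finite dimensional and every
object is a finite direct sum of simple objects. -/
structure IsSemisimpleCat (C : Type u) [Category.{v} C] [Abelian C] [Linear ℂ C] : Prop where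
  finiteDimensional_hom : ∀ X Y : C, FiniteDimensional ℂ (X ⟶ Y)
  exists_iso_sum : ∀ X : C, ∃ (n : ℕ) (f : Fin n → C),
    (∀ i, Simple (f i)) ∧ Nonempty (X ≅ ⨁ f)

section QuantumDim

variable {C : Type u} [Category.{v} C] [MonoidalCategory C] [BraidedCategory C]
  [RigidCategory C] [BalancedRigid C]

/-- The universal twist `θ_X : X ⟶ X`. -/
def theta (X : C) : X ⟶ X := (BalancedRigid.twist (C := C)).hom.app X

/-- The quantum dimension of `X`, as an endomorphism of the unit object:
`𝟙 ⟶ X ⊗ X* ⟶ X ⊗ X* ⟶ X* ⊗ X ⟶ 𝟙` (coevaluation, twist on `X`, braiding, evaluation). -/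
def qdim (X : C) : 𝟙_ C ⟶ 𝟙_ C :=
  η_ X (Xᘁ) ≫ theta X ▷ (Xᘁ) ≫ (β_ X (Xᘁ)).hom ≫ ε_ X (Xᘁ)

end QuantumDim

/-- Rigidity of an algebra `A` in `C`: `Hom(𝟙, A)` is one dimensional, the pairing
`A ⊗ A ⟶ A ⟶ 𝟙` (multiplication followed by the projection `ε` onto the unit, `ε ∘ ι_A = id`) is
non-degenerate, and the dimension of `A` is nonzero. -/
structure IsRigidAlgebra {C : Type u} [Category.{v} C] [Abelian C] [Linear ℂ C]
    [MonoidalCategory C] [BraidedCategory C] [RigidCategory C] [BalancedRigid C]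
    (A : Mon C) : Prop where
  finrank_unit : Module.finrank ℂ (𝟙_ C ⟶ A.X) = 1
  nondegenerate : ∃ e : A.X ⟶ 𝟙_ C, (MonObj.one : 𝟙_ C ⟶ A.X) ≫ e = 𝟙 (𝟙_ C) ∧
    ∃ p : ExactPairing A.X A.X, p.evaluation' = MonObj.mul ≫ e
  qdim_ne_zero : qdim A.X ≠ 0

/-- The invariants `A^G` of a group acting on the algebra `A` are the unit object: every morphism
to `A` fixed by all `π g` factors uniquely through the unit `𝟙 ⟶ A`. -/
def InvariantsEqUnit {C : Type u} [Category.{v} C] [MonoidalCategory C] {G : Type w} [Group G]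
    {A : Mon C} (π : G →* Aut A) : Prop :=
  ∀ (Z : C) (f : Z ⟶ A.X), (∀ g, f ≫ (π g).hom.hom = f) → ∃! h : Z ⟶ 𝟙_ C, h ≫ MonObj.one = f

/-! ### The linear category `Rep A` of modules over an algebra -/

section ModLinear

variable {C : Type u} [Category.{v} C] [MonoidalCategory C] {A : C} [MonObj A]

/-- The action morphism `A ⊗ M ⟶ M` of an `A`-module. -/
abbrev act (M : Mod C A) : A ⊗ M.X ⟶ M.X := ModObj.smul (M := A) (X := M.X)

lemma act_hom {M N : Mod C A} (f : M ⟶ N) : act M ≫ f.hom = A ◁ f.hom ≫ act N :=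
  IsModHom.smul_hom (A := A) (f := f.hom)

/-- Constructor for morphisms of `A`-modules. -/
def mkHom {M N : Mod C A} (f : M.X ⟶ N.X)
    (h : act M ≫ f = A ◁ f ≫ act N) : M ⟶ N :=
  Mod.Hom.mk' f h

@[simp]
lemma mkHom_hom {M N : Mod C A} (f : M.X ⟶ N.X)
    (h : act M ≫ f = A ◁ f ≫ act N) :
    (mkHom f h).hom = f := rfl

lemma hom_injective {M N : Mod C A} :
    Function.Injective (fun f : M ⟶ N => (f.hom : M.X ⟶ N.X)) :=
  fun _ _ h => Mod.hom_ext _ _ h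

variable [Preadditive C] [MonoidalPreadditive C]

instance {M N : Mod C A} : Zero (M ⟶ N) := ⟨mkHom 0 (by simp)⟩
instance {M N : Mod C A} : Add (M ⟶ N) :=
  ⟨fun f g => mkHom (f.hom + g.hom) (by simp)⟩
instance {M N : Mod C A} : Neg (M ⟶ N) :=
  ⟨fun f => mkHom (-f.hom) (by
    have : A ◁ (-f.hom) = -(A ◁ f.hom) := (tensorLeft A).map_neg
    rw [this, Preadditive.comp_neg, act_hom, Preadditive.neg_comp])⟩
instance {M N : Mod C A} : Sub (M ⟶ N) :=
  ⟨fun f g => mkHom (f.hom - g.hom) (by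
    have : A ◁ (f.hom - g.hom) = A ◁ f.hom - A ◁ g.hom := (tensorLeft A).map_sub
    rw [this, Preadditive.comp_sub, act_hom, act_hom, Preadditive.sub_comp])⟩
instance {M N : Mod C A} : SMul ℕ (M ⟶ N) :=
  ⟨fun n f => mkHom (n • f.hom) (by
    have : A ◁ (n • f.hom) = n • (A ◁ f.hom) := (tensorLeft A).map_nsmul
    rw [this, Preadditive.comp_nsmul, act_hom, Preadditive.nsmul_comp])⟩
instance {M N : Mod C A} : SMul ℤ (M ⟶ N) :=
  ⟨fun n f => mkHom (n • f.hom) (by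
    have : A ◁ (n • f.hom) = n • (A ◁ f.hom) := (tensorLeft A).map_zsmul
    rw [this, Preadditive.comp_zsmul, act_hom, Preadditive.zsmul_comp])⟩

instance {M N : Mod C A} : AddCommGroup (M ⟶ N) :=
  Function.Injective.addCommGroup _ hom_injective rfl (fun _ _ => rfl) (fun _ => rfl)
    (fun _ _ => rfl) (fun _ _ => rfl) (fun _ _ => rfl)

@[simp] lemma add_hom {M N : Mod C A} (f g : M ⟶ N) : (f + g).hom = f.hom + g.hom := rfl
@[simp] lemma zero_hom {M N : Mod C A} : (0 : M ⟶ N).hom = 0 := rfl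

instance : Preadditive (Mod C A) where
  add_comp _ _ _ _ _ _ := by ext; simp
  comp_add _ _ _ _ _ _ := by ext; simp

/-- The underlying `C`-morphism, as an additive map. -/
def homAddHom (M N : Mod C A) : (M ⟶ N) →+ (M.X ⟶ N.X) where
  toFun f := f.hom
  map_zero' := rfl
  map_add' _ _ := rfl

variable [Linear ℂ C] [MonoidalLinear ℂ C]

instance {M N : Mod C A} : SMul ℂ (M ⟶ N) :=
  ⟨fun c f => mkHom (c • f.hom) (by simp)⟩

@[simp] lemma smul_hom {M N : Mod C A} (c : ℂ) (f : M ⟶ N) : (c • f).hom = c • f.hom := rfl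

instance {M N : Mod C A} : Module ℂ (M ⟶ N) :=
  Function.Injective.module ℂ (homAddHom M N) hom_injective (fun _ _ => rfl)

instance : Linear ℂ (Mod C A) where
  smul_comp _ _ _ _ _ _ := by ext; simp
  comp_smul _ _ _ _ _ _ := by ext; simp

end ModLinear

/-! ### The action of `G` on `Rep A` and the category `D` -/

section Action

variable {C : Type u} [Category.{v} C] [MonoidalCategory C] {G : Type w} [Group G] {A : Mon C}

/-- The module `M^g`: the same object of `C`, with action `A ⊗ M ⟶ A ⊗ M ⟶ M` twisted by `π g`. -/
def twistBy (π : G →* Aut A) (g : G) : Mod C A.X ⥤ Mod C A.X := Mod.comap (π g).hom.hom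

lemma twistBy_smul (π : G →* Aut A) (g : G) (M : Mod C A.X) :
    act ((twistBy π g).obj M) = (π g).hom.hom ▷ M.X ≫ act M := rfl

/-- The functor `Π_g : M ↦ M^{g⁻¹}`. -/
def piFun (π : G →* Aut A) (g : G) : Mod C A.X ⥤ Mod C A.X := twistBy π g⁻¹

lemma aut_mul_hom (π : G →* Aut A) (g h : G) :
    (π (g * h)).hom.hom = (π h).hom.hom ≫ (π g).hom.hom := by
  rw [map_mul]; rfl

lemma aut_one_hom (π : G →* Aut A) : (π 1).hom.hom = 𝟙 A.X := by
  rw [map_one]; rfl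

/-- Isomorphisms of modules from isomorphisms of the underlying objects. -/
def mkIso {A : C} [MonObj A] {M N : Mod C A} (e : M.X ≅ N.X)
    (h : act M ≫ e.hom = A ◁ e.hom ≫ act N) : M ≅ N where
  hom := mkHom e.hom h
  inv := mkHom e.inv (by
    rw [← cancel_mono e.hom, Category.assoc, Category.assoc, Iso.inv_hom_id, h,
      ← whiskerLeft_comp_assoc]
    simp)
  hom_inv_id := by ext; simp
  inv_hom_id := by ext; simp

/-- `Π_g Π_h = Π_{gh}`, given by the identity of the underlying object. -/
def piComp (π : G →* Aut A) (g h : G) : piFun π h ⋙ piFun π g ≅ piFun π (g * h) :=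
  NatIso.ofComponents (fun M => mkIso (Iso.refl M.X) (by
    change ((π g⁻¹).hom.hom ▷ M.X ≫ (π h⁻¹).hom.hom ▷ M.X ≫ act M) ≫ 𝟙 M.X =
      A.X ◁ 𝟙 M.X ≫ (π (g * h)⁻¹).hom.hom ▷ M.X ≫ act M
    rw [mul_inv_rev, aut_mul_hom, comp_whiskerRight]
    simp))
    (fun {M N} f => by
      ext
      change f.hom ≫ 𝟙 N.X = 𝟙 M.X ≫ f.hom
      simp)

/-- `Π_1 = id`, given by the identity of the underlying object. -/
def piOne (π : G →* Aut A) : piFun π 1 ≅ 𝟭 (Mod C A.X) :=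
  NatIso.ofComponents (fun M => mkIso (Iso.refl M.X) (by
    change ((π 1⁻¹).hom.hom ▷ M.X ≫ act M) ≫ 𝟙 M.X = A.X ◁ 𝟙 M.X ≫ act M
    rw [inv_one, aut_one_hom]
    simp))
    (fun {M N} f => by
      ext
      change f.hom ≫ 𝟙 N.X = 𝟙 M.X ≫ f.hom
      simp)

/-- `Π_g` is an equivalence with inverse `Π_{g⁻¹}`. -/
def piEquiv (π : G →* Aut A) (g : G) : Mod C A.X ≌ Mod C A.X :=
  CategoryTheory.Equivalence.mk (piFun π g) (piFun π g⁻¹)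
    ((piOne π).symm ≪≫ eqToIso (by rw [inv_mul_cancel]) ≪≫ (piComp π g⁻¹ g).symm)
    (piComp π g g⁻¹ ≪≫ eqToIso (by rw [mul_inv_cancel]) ≪≫ piOne π)

variable [Preadditive C] [MonoidalPreadditive C]

lemma simple_piFun (π : G →* Aut A) (g : G) (M : Mod C A.X) (hM : Simple M) :
    Simple ((piFun π g).obj M) := by
  have : (piFun π g).IsEquivalence := (piEquiv π g).isEquivalence_functor
  exact simple_obj (piFun π g) M

/-- The set `S` of isomorphism classes of simple `A`-modules. (The action `π`, on which this set
does not depend, is recorded so that `G` acts on it.) -/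
def SimpleClass (_π : G →* Aut A) : Type (max u v) :=
  {c : Quotient (isIsomorphicSetoid (Mod C A.X)) //
    ∃ M : Mod C A.X, Simple M ∧ Quotient.mk (isIsomorphicSetoid (Mod C A.X)) M = c}

/-- The map induced by `Π_g` on isomorphism classes of modules. -/
def piClass (π : G →* Aut A) (g : G) :
    Quotient (isIsomorphicSetoid (Mod C A.X)) → Quotient (isIsomorphicSetoid (Mod C A.X)) :=
  Quotient.map' (piFun π g).obj (fun _ _ ⟨e⟩ => ⟨(piFun π g).mapIso e⟩)

/-- `G` acts on `S` by `g [M] = [M^{g⁻¹}]`. -/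
instance (π : G →* Aut A) : MulAction G (SimpleClass π) where
  smul g s := ⟨piClass π g s.1, by
    obtain ⟨M, hM, h⟩ := s.2
    exact ⟨(piFun π g).obj M, simple_piFun π g M hM, by rw [← h]; rfl⟩⟩
  one_smul s := by
    obtain ⟨_, M, hM, rfl⟩ := s
    exact Subtype.ext (Quotient.sound ⟨(piOne π).app M⟩)
  mul_smul g h s := by
    obtain ⟨_, M, hM, rfl⟩ := s
    exact Subtype.ext (Quotient.sound ⟨((piComp π g h).app M).symm⟩)

end Action

/-- An object of `D`: an `A`-module `M` with `C`-endomorphisms `φ g`, `g ∈ G`, of the underlying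
object such that `φ g ∘ μ_M = μ_M ∘ (π g ⊗ φ g)`, `φ (g h) = φ g ∘ φ h` and `φ 1 = id`. -/
structure EquivMod {C : Type u} [Category.{v} C] [MonoidalCategory C] {G : Type w} [Group G]
    {A : Mon C} (π : G →* Aut A) where
  M : Mod C A.X
  φ : G → (M.X ⟶ M.X)
  act_φ : ∀ g, act M ≫ φ g = ((π g).hom.hom ⊗ₘ φ g) ≫ act M
  φ_mul : ∀ g h, φ (g * h) = φ h ≫ φ g
  φ_one : φ 1 = 𝟙 M.X

namespace EquivMod

variable {C : Type u} [Category.{v} C] [MonoidalCategory C] {G : Type w} [Group G] {A : Mon C}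
  {π : G →* Aut A}

/-- Morphisms in `D` are morphisms of `A`-modules commuting with all `φ g`. -/
@[ext]
structure Hom (X Y : EquivMod π) where
  hom : X.M ⟶ Y.M
  comm : ∀ g, X.φ g ≫ hom.hom = hom.hom ≫ Y.φ g

instance : Category (EquivMod π) where
  Hom X Y := Hom X Y
  id X := ⟨𝟙 X.M, fun g => by simp⟩
  comp f g := ⟨f.hom ≫ g.hom, fun k => by
    rw [Mod.comp_hom', ← Category.assoc, f.comm, Category.assoc, g.comm, Category.assoc]⟩

@[ext]
lemma hom_ext {X Y : EquivMod π} (f g : X ⟶ Y) (h : f.hom = g.hom) : f = g := Hom.ext h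

@[simp] lemma id_hom (X : EquivMod π) : (𝟙 X : X ⟶ X).hom = 𝟙 X.M := rfl
@[simp] lemma comp_hom {X Y Z : EquivMod π} (f : X ⟶ Y) (g : Y ⟶ Z) :
    (f ≫ g).hom = f.hom ≫ g.hom := rfl

lemma hom_injective {X Y : EquivMod π} :
    Function.Injective (fun f : X ⟶ Y => (f.hom : X.M ⟶ Y.M)) :=
  fun _ _ h => hom_ext _ _ h

/-- `φ g`, as a morphism of `A`-modules `M^{g⁻¹} ⟶ M`. -/
def φHom (X : EquivMod π) (g : G) : (piFun π g).obj X.M ⟶ X.M :=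
  mkHom (X.φ g) (by
    change ((π g⁻¹).hom.hom ▷ X.M.X ≫ act X.M) ≫ X.φ g = A.X ◁ X.φ g ≫ act X.M
    rw [Category.assoc, X.act_φ, MonoidalCategory.tensorHom_def, Category.assoc, ← comp_whiskerRight_assoc,
      ← aut_mul_hom, mul_inv_cancel, aut_one_hom]
    simp)

section Linear

variable [Preadditive C] [MonoidalPreadditive C]

instance {X Y : EquivMod π} : Zero (X ⟶ Y) := ⟨⟨0, fun g => by simp⟩⟩
instance {X Y : EquivMod π} : Add (X ⟶ Y) :=
  ⟨fun f g => ⟨f.hom + g.hom, fun k => by simp [f.comm, g.comm]⟩⟩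
instance {X Y : EquivMod π} : Neg (X ⟶ Y) :=
  ⟨fun f => ⟨-f.hom, fun k => by
    change X.φ k ≫ (-f.hom.hom) = (-f.hom.hom) ≫ Y.φ k
    simp [f.comm]⟩⟩
instance {X Y : EquivMod π} : Sub (X ⟶ Y) :=
  ⟨fun f g => ⟨f.hom - g.hom, fun k => by
    change X.φ k ≫ (f.hom.hom - g.hom.hom) = (f.hom.hom - g.hom.hom) ≫ Y.φ k
    simp [f.comm, g.comm]⟩⟩
instance {X Y : EquivMod π} : SMul ℕ (X ⟶ Y) :=
  ⟨fun n f => ⟨n • f.hom, fun k => by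
    change X.φ k ≫ (n • f.hom.hom) = (n • f.hom.hom) ≫ Y.φ k
    simp [f.comm]⟩⟩
instance {X Y : EquivMod π} : SMul ℤ (X ⟶ Y) :=
  ⟨fun n f => ⟨n • f.hom, fun k => by
    change X.φ k ≫ (n • f.hom.hom) = (n • f.hom.hom) ≫ Y.φ k
    simp [f.comm]⟩⟩

instance {X Y : EquivMod π} : AddCommGroup (X ⟶ Y) :=
  Function.Injective.addCommGroup _ hom_injective rfl (fun _ _ => rfl) (fun _ => rfl)
    (fun _ _ => rfl) (fun _ _ => rfl) (fun _ _ => rfl)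

@[simp] lemma add_hom {X Y : EquivMod π} (f g : X ⟶ Y) : (f + g).hom = f.hom + g.hom := rfl

instance : Preadditive (EquivMod π) where
  add_comp _ _ _ _ _ _ := by ext; simp
  comp_add _ _ _ _ _ _ := by ext; simp

/-- The underlying morphism of modules, as an additive map. -/
def homAddHom (X Y : EquivMod π) : (X ⟶ Y) →+ (X.M ⟶ Y.M) where
  toFun f := f.hom
  map_zero' := rfl
  map_add' _ _ := rfl

variable [Linear ℂ C] [MonoidalLinear ℂ C]

instance {X Y : EquivMod π} : SMul ℂ (X ⟶ Y) :=
  ⟨fun c f => ⟨c • f.hom, fun k => by simp [f.comm]⟩⟩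

@[simp] lemma smul_hom {X Y : EquivMod π} (c : ℂ) (f : X ⟶ Y) : (c • f).hom = c • f.hom := rfl

instance {X Y : EquivMod π} : Module ℂ (X ⟶ Y) :=
  Function.Injective.module ℂ (homAddHom X Y) hom_injective (fun _ _ => rfl)

instance : Linear ℂ (EquivMod π) where
  smul_comp _ _ _ _ _ _ := by ext; simp
  comp_smul _ _ _ _ _ _ := by ext; simp

end Linear

end EquivMod

/-! ### Cocycles and twisted algebras -/

/-- A 2-cocycle of `G` with values in the group `F*[T]` of non-vanishing functions on the `G`-set
`T`, on which `G` acts by `(g · f) t = f (g⁻¹ t)`. -/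
@[ext]
structure Cocycle (G : Type*) (T : Type*) [Group G] [MulAction G T] where
  toFun : G → G → T → ℂˣ
  cocycle : ∀ g h k t,
    toFun h k (g⁻¹ • t) * toFun g (h * k) t = toFun g h t * toFun (g * h) k t

/-- A 2-cocycle of `H` with values in `ℂˣ`, with trivial action. -/
@[ext]
structure ScalarCocycle (H : Type*) [Group H] where
  toFun : H → H → ℂˣ
  cocycle : ∀ g h k, toFun h k * toFun g (h * k) = toFun g h * toFun (g * h) k

namespace Cocycle

variable {G : Type*} {T : Type*} [Group G] [MulAction G T] (α : Cocycle G T)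

/-- The inverse cocycle `α⁻¹`. -/
def inv : Cocycle G T where
  toFun g h t := (α.toFun g h t)⁻¹
  cocycle g h k t := by rw [← mul_inv, ← mul_inv, α.cocycle]

/-- The restriction of `α` to an orbit. -/
def onOrbit (o : MulAction.orbitRel.Quotient G T) : Cocycle G o.orbit where
  toFun g h t := α.toFun g h t
  cocycle g h k t := α.cocycle g h k t

/-- The cocycle `α_s` of the stabilizer of `s`, `α_s(g, h) = α(g, h)(s)`. -/
def atPoint (s : T) : ScalarCocycle (MulAction.stabilizer G s) where
  toFun g h := α.toFun g h s
  cocycle g h k := by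
    have := α.cocycle (g : G) h k s
    rwa [show (g : G)⁻¹ • s = s from (g⁻¹).2] at this

lemma one_left (k : G) (t : T) : α.toFun 1 k t = α.toFun 1 1 t := by
  have := α.cocycle 1 1 k t
  simp only [inv_one, one_smul, one_mul] at this
  exact mul_right_cancel this

lemma one_right (g : G) (t : T) : α.toFun g 1 t = α.toFun 1 1 (g⁻¹ • t) := by
  have := α.cocycle g 1 1 t
  simp only [mul_one] at this
  exact (mul_right_cancel this).symm

end Cocycle

namespace ScalarCocycle

variable {H : Type*} [Group H] (α : ScalarCocycle H)

/-- The inverse cocycle. -/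
def inv : ScalarCocycle H where
  toFun g h := (α.toFun g h)⁻¹
  cocycle g h k := by rw [← mul_inv, ← mul_inv, α.cocycle]

lemma one_left (k : H) : α.toFun 1 k = α.toFun 1 1 := by
  have := α.cocycle 1 1 k
  simp only [one_mul] at this
  exact mul_right_cancel this

lemma one_right (g : H) : α.toFun g 1 = α.toFun 1 1 := by
  have := α.cocycle g 1 1
  simp only [mul_one] at this
  exact (mul_right_cancel this).symm

end ScalarCocycle

section TwistedAlgebra

attribute [local instance] Fintype.ofFinite

variable {G : Type*} {T : Type*} [Group G] [MulAction G T]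

/-- The twisted algebra `A_α(G, T) = ⨁_{g ∈ G} F[T] g`, where `F[T]` is the algebra of functions
`T → ℂ`, with product `(f g) (f' g') = f · (g · f') · α(g, g') g g'`. The element `∑_g a_g g` has
coefficients `g ↦ a_g`. -/
@[ext]
structure TwistedAlg (α : Cocycle G T) where
  coeff : G → T → ℂ

namespace TwistedAlg

variable {α : Cocycle G T}

lemma coeff_injective : Function.Injective (coeff (α := α)) := fun _ _ h => TwistedAlg.ext h

instance : Zero (TwistedAlg α) := ⟨⟨0⟩⟩
instance : Add (TwistedAlg α) := ⟨fun a b => ⟨a.coeff + b.coeff⟩⟩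
instance : Neg (TwistedAlg α) := ⟨fun a => ⟨-a.coeff⟩⟩
instance : Sub (TwistedAlg α) := ⟨fun a b => ⟨a.coeff - b.coeff⟩⟩
instance : SMul ℕ (TwistedAlg α) := ⟨fun n a => ⟨n • a.coeff⟩⟩
instance : SMul ℤ (TwistedAlg α) := ⟨fun n a => ⟨n • a.coeff⟩⟩
instance : SMul ℂ (TwistedAlg α) := ⟨fun c a => ⟨c • a.coeff⟩⟩

instance : AddCommGroup (TwistedAlg α) :=
  coeff_injective.addCommGroup _ rfl (fun _ _ => rfl) (fun _ => rfl) (fun _ _ => rfl)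
    (fun _ _ => rfl) (fun _ _ => rfl)

instance : Module ℂ (TwistedAlg α) :=
  coeff_injective.module ℂ
    ({ toFun := coeff, map_zero' := rfl, map_add' := fun _ _ => rfl } :
      TwistedAlg α →+ (G → T → ℂ)) (fun _ _ => rfl)

@[simp] lemma add_coeff (a b : TwistedAlg α) (g : G) (t : T) :
    (a + b).coeff g t = a.coeff g t + b.coeff g t := rfl
@[simp] lemma zero_coeff (g : G) (t : T) : (0 : TwistedAlg α).coeff g t = 0 := rfl
@[simp] lemma smul_coeff (c : ℂ) (a : TwistedAlg α) (g : G) (t : T) :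
    (c • a).coeff g t = c * a.coeff g t := rfl

open scoped Classical in
/-- The element `u_g = 1 · g`. -/
def u (α : Cocycle G T) (g : G) : TwistedAlg α := ⟨fun k _ => if k = g then 1 else 0⟩

open scoped Classical in
/-- The embedding `F[T] ⊆ A_α(G, T)`. (As `α` need not be normalized, the unit of the algebra is
`α(1,1)⁻¹ · 1`.) -/
def ofFun (α : Cocycle G T) (f : T → ℂ) : TwistedAlg α :=
  ⟨fun k t => if k = 1 then f t * ((α.toFun 1 1 t)⁻¹ : ℂˣ) else 0⟩

open scoped Classical in
/-- The delta function `δ_s ∈ F[T] ⊆ A_α(G, T)`. -/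
def delta (α : Cocycle G T) (s : T) : TwistedAlg α := ofFun α (fun t => if t = s then 1 else 0)

instance : One (TwistedAlg α) := ⟨ofFun α 1⟩

lemma one_def : (1 : TwistedAlg α) = ofFun α 1 := rfl

variable [Finite G]

instance : Mul (TwistedAlg α) :=
  ⟨fun a b => ⟨fun k t =>
    ∑ g, a.coeff g t * b.coeff (g⁻¹ * k) (g⁻¹ • t) * α.toFun g (g⁻¹ * k) t⟩⟩

lemma mul_coeff (a b : TwistedAlg α) (k : G) (t : T) : (a * b).coeff k t =
    ∑ g, a.coeff g t * b.coeff (g⁻¹ * k) (g⁻¹ • t) * α.toFun g (g⁻¹ * k) t := rfl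

lemma ofFun_mul_coeff (f : T → ℂ) (b : TwistedAlg α) (k : G) (t : T) :
    (ofFun α f * b).coeff k t = f t * b.coeff k t := by
  rw [mul_coeff, Finset.sum_eq_single 1]
  · simp [ofFun, α.one_left k]
    field_simp
  · intro g _ hg
    simp [ofFun, hg]
  · simp

lemma mul_ofFun_coeff (f : T → ℂ) (a : TwistedAlg α) (k : G) (t : T) :
    (a * ofFun α f).coeff k t = a.coeff k t * f (k⁻¹ • t) := by
  rw [mul_coeff, Finset.sum_eq_single k]
  · simp [ofFun, α.one_right k]
    field_simp
  · intro g _ hg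
    have : g⁻¹ * k ≠ 1 := fun h => hg (inv_mul_eq_one.mp h)
    simp [ofFun, this]
  · simp

lemma assoc' (a b c : TwistedAlg α) : a * b * c = a * (b * c) := by
  ext k t
  simp only [mul_coeff, Finset.sum_mul, Finset.mul_sum]
  rw [Finset.sum_comm]
  refine Finset.sum_congr rfl fun g _ => ?_
  refine Fintype.sum_equiv (Equiv.mulLeft g⁻¹) _ _ fun m => ?_
  have := congrArg (Units.val) (α.cocycle g (g⁻¹ * m) (m⁻¹ * k) t)
  simp only [Units.val_mul, mul_assoc, mul_inv_cancel_left] at this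
  simp only [Equiv.coe_mulLeft, mul_inv_rev, inv_inv, mul_assoc, mul_inv_cancel_left, mul_smul,
    smul_inv_smul]
  linear_combination (-1 : ℂ) * a.coeff g t * b.coeff (g⁻¹ * m) (g⁻¹ • t) *
    c.coeff (m⁻¹ * k) (m⁻¹ • t) * this

instance : Ring (TwistedAlg α) where
  __ := (inferInstance : AddCommGroup (TwistedAlg α))
  mul := (· * ·)
  one := 1
  left_distrib a b c := by ext; simp [mul_coeff, mul_add, add_mul, Finset.sum_add_distrib]
  right_distrib a b c := by ext; simp [mul_coeff, add_mul, Finset.sum_add_distrib]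
  zero_mul a := by ext; simp [mul_coeff]
  mul_zero a := by ext; simp [mul_coeff]
  mul_assoc := assoc'
  one_mul a := by ext; exact (ofFun_mul_coeff _ _ _ _).trans (by simp)
  mul_one a := by ext; exact (mul_ofFun_coeff _ _ _ _).trans (by simp)

instance : Algebra ℂ (TwistedAlg α) :=
  Algebra.ofModule
    (fun c a b => by ext; simp [mul_coeff, Finset.mul_sum, mul_assoc])
    (fun c a b => by
      ext
      simp only [mul_coeff, smul_coeff, Finset.mul_sum]
      exact Finset.sum_congr rfl fun _ _ => by ring)

/-- `u_g δ_s = δ_{gs} u_g`. -/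
lemma u_mul_delta (g : G) (s : T) : u α g * delta α s = delta α (g • s) * u α g := by
  ext k t
  rw [delta, delta, mul_ofFun_coeff, ofFun_mul_coeff]
  by_cases h : k = g
  · subst h
    by_cases h : t = k • s
    · simp [u, h]
    · simp [u, h, inv_smul_eq_iff]
  · simp [u, h]

end TwistedAlg

end TwistedAlgebra

section TwistedGroupAlgebra

attribute [local instance] Fintype.ofFinite

variable {H : Type*} [Group H]

/-- The twisted group algebra `ℂ^α[H]`, with basis `H` and product `g · h = α(g, h) gh`. -/
@[ext]
structure TwistedGroupAlg (α : ScalarCocycle H) where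
  coeff : H → ℂ

namespace TwistedGroupAlg

variable {α : ScalarCocycle H}

lemma coeff_injective : Function.Injective (coeff (α := α)) := fun _ _ h => TwistedGroupAlg.ext h

instance : Zero (TwistedGroupAlg α) := ⟨⟨0⟩⟩
instance : Add (TwistedGroupAlg α) := ⟨fun a b => ⟨a.coeff + b.coeff⟩⟩
instance : Neg (TwistedGroupAlg α) := ⟨fun a => ⟨-a.coeff⟩⟩
instance : Sub (TwistedGroupAlg α) := ⟨fun a b => ⟨a.coeff - b.coeff⟩⟩
instance : SMul ℕ (TwistedGroupAlg α) := ⟨fun n a => ⟨n • a.coeff⟩⟩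
instance : SMul ℤ (TwistedGroupAlg α) := ⟨fun n a => ⟨n • a.coeff⟩⟩
instance : SMul ℂ (TwistedGroupAlg α) := ⟨fun c a => ⟨c • a.coeff⟩⟩

instance : AddCommGroup (TwistedGroupAlg α) :=
  coeff_injective.addCommGroup _ rfl (fun _ _ => rfl) (fun _ => rfl) (fun _ _ => rfl)
    (fun _ _ => rfl) (fun _ _ => rfl)

instance : Module ℂ (TwistedGroupAlg α) :=
  coeff_injective.module ℂ
    ({ toFun := coeff, map_zero' := rfl, map_add' := fun _ _ => rfl } :
      TwistedGroupAlg α →+ (H → ℂ)) (fun _ _ => rfl)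

@[simp] lemma add_coeff (a b : TwistedGroupAlg α) (g : H) :
    (a + b).coeff g = a.coeff g + b.coeff g := rfl
@[simp] lemma zero_coeff (g : H) : (0 : TwistedGroupAlg α).coeff g = 0 := rfl
@[simp] lemma smul_coeff (c : ℂ) (a : TwistedGroupAlg α) (g : H) :
    (c • a).coeff g = c * a.coeff g := rfl

open scoped Classical in
/-- The unit `α(1,1)⁻¹ · 1`. -/
instance : One (TwistedGroupAlg α) :=
  ⟨⟨fun k => if k = 1 then ((α.toFun 1 1)⁻¹ : ℂˣ) else 0⟩⟩

open scoped Classical in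
lemma one_coeff (k : H) :
    (1 : TwistedGroupAlg α).coeff k = if k = 1 then (((α.toFun 1 1)⁻¹ : ℂˣ) : ℂ) else 0 := rfl

variable [Finite H]

instance : Mul (TwistedGroupAlg α) :=
  ⟨fun a b => ⟨fun k => ∑ g, a.coeff g * b.coeff (g⁻¹ * k) * α.toFun g (g⁻¹ * k)⟩⟩

lemma mul_coeff (a b : TwistedGroupAlg α) (k : H) :
    (a * b).coeff k = ∑ g, a.coeff g * b.coeff (g⁻¹ * k) * α.toFun g (g⁻¹ * k) := rfl

lemma assoc' (a b c : TwistedGroupAlg α) : a * b * c = a * (b * c) := by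
  ext k
  simp only [mul_coeff, Finset.sum_mul, Finset.mul_sum]
  rw [Finset.sum_comm]
  refine Finset.sum_congr rfl fun g _ => ?_
  refine Fintype.sum_equiv (Equiv.mulLeft g⁻¹) _ _ fun m => ?_
  have := congrArg (Units.val) (α.cocycle g (g⁻¹ * m) (m⁻¹ * k))
  simp only [Units.val_mul, mul_assoc, mul_inv_cancel_left] at this
  simp only [Equiv.coe_mulLeft, mul_inv_rev, inv_inv, mul_assoc, mul_inv_cancel_left]
  linear_combination (-1 : ℂ) * a.coeff g * b.coeff (g⁻¹ * m) * c.coeff (m⁻¹ * k) * this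

lemma one_mul' (a : TwistedGroupAlg α) : 1 * a = a := by
  ext k
  rw [mul_coeff, Finset.sum_eq_single 1]
  · simp [one_coeff, α.one_left k]
    field_simp
  · intro g _ hg
    simp [one_coeff, hg]
  · simp

lemma mul_one' (a : TwistedGroupAlg α) : a * 1 = a := by
  ext k
  rw [mul_coeff, Finset.sum_eq_single k]
  · simp [one_coeff, α.one_right k]
  · intro g _ hg
    have : g⁻¹ * k ≠ 1 := fun h => hg (inv_mul_eq_one.mp h)
    simp [one_coeff, this]
  · simp

instance : Ring (TwistedGroupAlg α) where
  __ := (inferInstance : AddCommGroup (TwistedGroupAlg α))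
  mul := (· * ·)
  one := 1
  left_distrib a b c := by ext; simp [mul_coeff, mul_add, add_mul, Finset.sum_add_distrib]
  right_distrib a b c := by ext; simp [mul_coeff, add_mul, Finset.sum_add_distrib]
  zero_mul a := by ext; simp [mul_coeff]
  mul_zero a := by ext; simp [mul_coeff]
  mul_assoc := assoc'
  one_mul := one_mul'
  mul_one := mul_one'

instance : Algebra ℂ (TwistedGroupAlg α) :=
  Algebra.ofModule
    (fun c a b => by ext; simp [mul_coeff, Finset.mul_sum, mul_assoc])
    (fun c a b => by
      ext
      simp only [mul_coeff, smul_coeff, Finset.mul_sum]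
      exact Finset.sum_congr rfl fun _ _ => by ring)

end TwistedGroupAlg

end TwistedGroupAlgebra

/-! ### Direct sums of categories of representations -/

section DirectSum

instance {ι : Type*} {D : ι → Type*} [∀ i, Category (D i)] [∀ i, Preadditive (D i)] :
    Preadditive (∀ i, D i) where
  homGroup X Y := inferInstanceAs (AddCommGroup (∀ i, X i ⟶ Y i))
  add_comp _ _ _ _ _ _ := funext fun _ => Preadditive.add_comp _ _ _ _ _ _
  comp_add _ _ _ _ _ _ := funext fun _ => Preadditive.comp_add _ _ _ _ _ _

instance {ι : Type*} {D : ι → Type*} [∀ i, Category (D i)] [∀ i, Preadditive (D i)]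
    [∀ i, Linear ℂ (D i)] : Linear ℂ (∀ i, D i) where
  homModule X Y := inferInstanceAs (Module ℂ (∀ i, X i ⟶ Y i))
  smul_comp _ _ _ _ _ _ := funext fun _ => Linear.smul_comp _ _ _ _ _ _
  comp_smul _ _ _ _ _ _ := funext fun _ => Linear.comp_smul _ _ _ _ _ _

open scoped ModuleCat in
/-- Families of finite dimensional representations, all but finitely many of which are zero. -/
def isDirectSum {ι : Type*} (R : ι → Type*) [∀ i, Ring (R i)] [∀ i, Algebra ℂ (R i)] :
    ObjectProperty (∀ i, ModuleCat.{w} (R i)) :=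
  fun V => (∀ i, FiniteDimensional ℂ (V i)) ∧ {i | Nontrivial (V i)}.Finite

/-- The direct sum `⨁_i Rep R_i` of the categories of finite dimensional representations of the
algebras `R i`. -/
abbrev RepSum {ι : Type*} (R : ι → Type*) [∀ i, Ring (R i)] [∀ i, Algebra ℂ (R i)] :=
  (isDirectSum.{w} R).FullSubcategory

end DirectSum

/-! ### Projective action on the simple modules -/

section Functors

attribute [local instance] Fintype.ofFinite

variable {C : Type u} [Category.{v} C] [MonoidalCategory C] [Preadditive C]
  [MonoidalPreadditive C] {G : Type w} [Group G] {A : Mon C}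

/-- A choice of a representative `X_s` of every isomorphism class `s ∈ S` of simple `A`-modules,
and of isomorphisms of `A`-modules `φ_s(g) : X_s^{g⁻¹} ≅ X_{gs}`. -/
structure Choice (π : G →* Aut A) where
  X : SimpleClass π → Mod C A.X
  mk_X : ∀ s, Quotient.mk (isIsomorphicSetoid (Mod C A.X)) (X s) = s.1
  φ : ∀ (g : G) (s : SimpleClass π), (piFun π g).obj (X s) ≅ X (g • s)

namespace Choice

lemma nonempty (π : G →* Aut A) : Nonempty (Choice π) := by
  refine ⟨⟨fun s => s.1.out, fun s => s.1.out_eq, fun g s => Classical.choice ?_⟩⟩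
  apply Quotient.exact (s := isIsomorphicSetoid (Mod C A.X))
  rw [Quotient.out_eq]
  change piClass π g (Quotient.mk _ s.1.out) = (g • s).1
  rw [Quotient.out_eq]
  rfl

variable {π : G →* Aut A} (c : Choice π)

/-- `φ_s(g)`, with target `X_t` for any `t` equal to `gs`. -/
def iso (g : G) {s t : SimpleClass π} (h : g • s = t) : (piFun π g).obj (c.X s) ≅ c.X t :=
  c.φ g s ≪≫ eqToIso (congrArg c.X h)

/-- The `C`-morphism underlying `φ_s(g)`. -/
def f (g : G) {s t : SimpleClass π} (h : g • s = t) : (c.X s).X ⟶ (c.X t).X :=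
  (c.iso g h).hom.hom

/-- The inverse of `c.f`. -/
def finv (g : G) {s t : SimpleClass π} (h : g • s = t) : (c.X t).X ⟶ (c.X s).X :=
  (c.iso g h).inv.hom

lemma f_finv (g : G) {s t : SimpleClass π} (h : g • s = t) : c.f g h ≫ c.finv g h = 𝟙 _ :=
  congrArg Mod.Hom.hom (c.iso g h).hom_inv_id

lemma finv_f (g : G) {s t : SimpleClass π} (h : g • s = t) : c.finv g h ≫ c.f g h = 𝟙 _ :=
  congrArg Mod.Hom.hom (c.iso g h).inv_hom_id

lemma f_cancel (g : G) {s t : SimpleClass π} (h : g • s = t) {Z : C} {a b : (c.X t).X ⟶ Z}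
    (hab : c.f g h ≫ a = c.f g h ≫ b) : a = b := by
  have := congrArg (c.finv g h ≫ ·) hab
  simpa only [← Category.assoc, finv_f, Category.id_comp] using this

lemma orbit_smul {o : MulAction.orbitRel.Quotient G (SimpleClass π)} {g : G} {s t : o.orbit}
    (h : g • s = t) : g • (s : SimpleClass π) = (t : SimpleClass π) :=
  congrArg Subtype.val h

lemma stab_smul {s : SimpleClass π} (g : MulAction.stabilizer G s) : (g : G) • s = s := g.2

variable [Linear ℂ C] [MonoidalLinear ℂ C]

/-- `α` is the 2-cocycle of the projective action: `φ(g) φ(h) = α(g, h) φ(gh)`, where the function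
`α(g, h) ∈ F*[S]` acts on `X_u` by its value at `u`. -/
def IsCocycle (α : Cocycle G (SimpleClass π)) : Prop :=
  ∀ (g h : G) (s t r : SimpleClass π) (hst : h • s = t) (htr : g • t = r),
    c.f h hst ≫ c.f g htr =
      ((α.toFun g h r : ℂˣ) : ℂ) • c.f (g * h) (by rw [mul_smul, hst, htr] : (g * h) • s = r)

/-- For an object `Y` of `D`, the map `Hom_A(X_s, Y) → Hom_A(X_{gs}, Y)`,
`a ↦ φ_Y(g) ∘ a ∘ φ_s(g)⁻¹`. -/
def conj (Y : EquivMod π) (g : G) {s t : SimpleClass π} (h : g • s = t) :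
    (c.X s ⟶ Y.M) →ₗ[ℂ] (c.X t ⟶ Y.M) where
  toFun a := (c.iso g h).inv ≫ (piFun π g).map a ≫ Y.φHom g
  map_add' a b := by
    ext
    change c.finv g h ≫ (a.hom + b.hom) ≫ Y.φ g =
      c.finv g h ≫ a.hom ≫ Y.φ g + c.finv g h ≫ b.hom ≫ Y.φ g
    simp
  map_smul' z a := by
    ext
    change c.finv g h ≫ (z • a.hom) ≫ Y.φ g = z • (c.finv g h ≫ a.hom ≫ Y.φ g)
    simp

lemma conj_hom (Y : EquivMod π) (g : G) {s t : SimpleClass π} (h : g • s = t)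
    (a : c.X s ⟶ Y.M) : (c.conj Y g h a).hom = c.finv g h ≫ a.hom ≫ Y.φ g := rfl

lemma f_conj (Y : EquivMod π) (g : G) {s t : SimpleClass π} (h : g • s = t)
    (a : c.X s ⟶ Y.M) : c.f g h ≫ (c.conj Y g h a).hom = a.hom ≫ Y.φ g := by
  rw [conj_hom, ← Category.assoc, f_finv, Category.id_comp]

lemma conj_comp {Y Z : EquivMod π} (m : Y ⟶ Z) (g : G) {s t : SimpleClass π} (h : g • s = t)
    (a : c.X s ⟶ Y.M) : c.conj Y g h a ≫ m.hom = c.conj Z g h (a ≫ m.hom) := by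
  ext
  simp only [Mod.comp_hom', conj_hom, Category.assoc, m.comm]

variable {c} {α : Cocycle G (SimpleClass π)}

lemma IsCocycle.conj_conj (hα : c.IsCocycle α) (Y : EquivMod π) (g h : G)
    {s t r : SimpleClass π} (hst : h • s = t) (htr : g • t = r) (a : c.X s ⟶ Y.M) :
    c.conj Y g htr (c.conj Y h hst a) =
      (((α.toFun g h r)⁻¹ : ℂˣ) : ℂ) •
        c.conj Y (g * h) (by rw [mul_smul, hst, htr] : (g * h) • s = r) a := by
  ext
  have hr : (g * h) • s = r := by rw [mul_smul, hst, htr]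
  have h1 := hα g h s t r hst htr
  have h2 : c.f h hst ≫ c.f g htr ≫ (c.conj Y g htr (c.conj Y h hst a)).hom =
      c.f (g * h) hr ≫ (c.conj Y (g * h) hr a).hom := by
    rw [f_conj, f_conj, ← Category.assoc, f_conj, Category.assoc, Y.φ_mul]
  rw [← Category.assoc, h1, Linear.smul_comp] at h2
  apply c.f_cancel (g * h) hr
  rw [Orbifold.smul_hom, Linear.comp_smul, ← h2, smul_smul]
  simp

lemma IsCocycle.conj_one (hα : c.IsCocycle α) (Y : EquivMod π) {s : SimpleClass π}
    (h : (1 : G) • s = s) (a : c.X s ⟶ Y.M) :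
    c.conj Y 1 h a = (((α.toFun 1 1 s)⁻¹ : ℂˣ) : ℂ) • a := by
  have h1 := hα 1 1 s s s h h
  simp only [mul_one] at h1
  have h2 : c.f 1 h = ((α.toFun 1 1 s : ℂˣ) : ℂ) • 𝟙 _ := by
    apply c.f_cancel 1 h
    rw [h1, Linear.comp_smul, Category.comp_id]
  ext
  apply c.f_cancel 1 h
  rw [f_conj, Y.φ_one, Category.comp_id, h2, Orbifold.smul_hom, Linear.comp_smul,
    Linear.smul_comp, smul_smul]
  simp

/-- The algebra `A_{α⁻¹}(G, O)` of an orbit `O`. -/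
abbrev OrbitAlg (α : Cocycle G (SimpleClass π))
    (o : MulAction.orbitRel.Quotient G (SimpleClass π)) : Type _ :=
  TwistedAlg (α.inv.onOrbit o)

/-- The twisted group algebra `ℂ^{α_s⁻¹}[G_s]` of the stabilizer of `s`. -/
abbrev StabAlg (α : Cocycle G (SimpleClass π)) (s : SimpleClass π) : Type _ :=
  TwistedGroupAlg (α.inv.atPoint s)

variable (c)

/-- `conj` on families indexed by an orbit: `a ↦ φ_Y(g) ∘ a_{g⁻¹t} ∘ φ_{g⁻¹t}(g)⁻¹`. -/
def conjAt {o : MulAction.orbitRel.Quotient G (SimpleClass π)} (Y : EquivMod π) (g : G)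
    (a : ∀ s : o.orbit, c.X s ⟶ Y.M) (t : o.orbit) : c.X t ⟶ Y.M :=
  c.conj Y g (orbit_smul (smul_inv_smul g t)) (a (g⁻¹ • t))

lemma conjAt_eq {o : MulAction.orbitRel.Quotient G (SimpleClass π)} (Y : EquivMod π) (g : G)
    (a : ∀ s : o.orbit, c.X s ⟶ Y.M) (s t : o.orbit) (h : g • s = t) :
    c.conjAt Y g a t = c.conj Y g (orbit_smul h) (a s) := by
  obtain rfl : s = g⁻¹ • t := by rw [← h, inv_smul_smul]
  rfl

lemma conjAt_zero {o : MulAction.orbitRel.Quotient G (SimpleClass π)} (Y : EquivMod π) (g : G)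
    (t : o.orbit) : c.conjAt Y g 0 t = 0 :=
  map_zero (c.conj Y g _)

lemma conjAt_add {o : MulAction.orbitRel.Quotient G (SimpleClass π)} (Y : EquivMod π) (g : G)
    (a b : ∀ s : o.orbit, c.X s ⟶ Y.M) (t : o.orbit) :
    c.conjAt Y g (a + b) t = c.conjAt Y g a t + c.conjAt Y g b t :=
  map_add (c.conj Y g _) _ _

lemma conjAt_comp {o : MulAction.orbitRel.Quotient G (SimpleClass π)} {Y Z : EquivMod π}
    (m : Y ⟶ Z) (g : G) (a : ∀ s : o.orbit, c.X s ⟶ Y.M) (t : o.orbit) :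
    c.conjAt Y g a t ≫ m.hom = c.conjAt Z g (fun s => a s ≫ m.hom) t :=
  c.conj_comp m g _ _

variable [Finite G]

lemma sum_conjAt_comp {o : MulAction.orbitRel.Quotient G (SimpleClass π)} {Y Z : EquivMod π}
    (m : Y ⟶ Z) (x : OrbitAlg α o) (a : ∀ s : o.orbit, c.X s ⟶ Y.M) (t : o.orbit) :
    (∑ g, x.coeff g t • c.conjAt Y g a t) ≫ m.hom =
      ∑ g, x.coeff g t • c.conjAt Z g (fun s => a s ≫ m.hom) t := by
  simp only [Preadditive.sum_comp, Linear.smul_comp, conjAt_comp]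

lemma sum_conj_comp {s : SimpleClass π} {Y Z : EquivMod π}
    (m : Y ⟶ Z) (x : StabAlg α s) (a : c.X s ⟶ Y.M) :
    (∑ g, x.coeff g • c.conj Y g (stab_smul g) a) ≫ m.hom =
      ∑ g, x.coeff g • c.conj Z g (stab_smul g) (a ≫ m.hom) := by
  simp only [Preadditive.sum_comp, Linear.smul_comp, conj_comp]

variable {c}

/-- The action of `A_{α⁻¹}(G, O)` on `⨁_{s ∈ O} Hom_A(X_s, Y)` (the orbit `O` is finite, so that
this is the product): functions on `O` act by multiplication on the components and `g` maps
`a : X_s ⟶ Y` to `φ_Y(g) ∘ a ∘ φ_s(g)⁻¹ : X_{gs} ⟶ Y`. -/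
@[reducible]
def IsCocycle.orbitModule (hα : c.IsCocycle α)
    (o : MulAction.orbitRel.Quotient G (SimpleClass π)) (Y : EquivMod π) :
    Module (OrbitAlg α o) (∀ s : o.orbit, c.X s ⟶ Y.M) where
  smul x a := fun t => ∑ g, x.coeff g t • c.conjAt Y g a t
  one_smul a := by
    funext t
    change ∑ g, (1 : OrbitAlg α o).coeff g t • c.conjAt Y g a t = a t
    rw [Finset.sum_eq_single 1]
    · rw [c.conjAt_eq Y 1 a t t (one_smul _ _), hα.conj_one, smul_smul]
      simp [TwistedAlg.one_def, TwistedAlg.ofFun, Cocycle.onOrbit, Cocycle.inv]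
    · intro g _ hg
      simp [TwistedAlg.one_def, TwistedAlg.ofFun, hg]
    · simp
  mul_smul x y a := by
    funext t
    change ∑ m, (x * y).coeff m t • c.conjAt Y m a t =
      ∑ g, x.coeff g t • c.conj Y g _ (∑ h, y.coeff h (g⁻¹ • t) • c.conjAt Y h a (g⁻¹ • t))
    simp only [TwistedAlg.mul_coeff, Finset.sum_smul, map_sum, map_smul, Finset.smul_sum]
    rw [Finset.sum_comm]
    refine Finset.sum_congr rfl fun g _ => ?_
    refine Fintype.sum_equiv (Equiv.mulLeft g⁻¹) _ _ fun m => ?_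
    have e1 : (g⁻¹ * m) • (m⁻¹ • t) = g⁻¹ • t := by rw [mul_smul, smul_inv_smul]
    have e2 : m • (m⁻¹ • t) = t := smul_inv_smul m t
    rw [Equiv.coe_mulLeft, c.conjAt_eq Y (g⁻¹ * m) a _ _ e1, c.conjAt_eq Y m a _ _ e2,
      hα.conj_conj, smul_smul, smul_smul]
    simp only [mul_inv_cancel_left]
    rfl
  smul_zero x := by
    funext t
    change ∑ g, x.coeff g t • c.conjAt Y g 0 t = 0
    simp only [conjAt_zero, smul_zero, Finset.sum_const_zero]
  smul_add x a b := by
    funext t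
    change ∑ g, x.coeff g t • c.conjAt Y g (a + b) t =
      ∑ g, x.coeff g t • c.conjAt Y g a t + ∑ g, x.coeff g t • c.conjAt Y g b t
    simp only [conjAt_add, smul_add, Finset.sum_add_distrib]
  add_smul x y a := by
    funext t
    change ∑ g, (x + y).coeff g t • c.conjAt Y g a t =
      ∑ g, x.coeff g t • c.conjAt Y g a t + ∑ g, y.coeff g t • c.conjAt Y g a t
    simp [add_smul, Finset.sum_add_distrib]
  zero_smul a := by
    funext t
    change ∑ g, (0 : OrbitAlg α o).coeff g t • c.conjAt Y g a t = 0
    simp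

/-- The `A_{α⁻¹}(G, O)`-module `⨁_{s ∈ O} Hom_A(X_s, Y)`. -/
def IsCocycle.orbitObj (hα : c.IsCocycle α)
    (o : MulAction.orbitRel.Quotient G (SimpleClass π)) (Y : EquivMod π) :
    ModuleCat.{max u v} (OrbitAlg α o) :=
  letI := hα.orbitModule o Y
  ModuleCat.of (OrbitAlg α o) (∀ s : o.orbit, c.X s ⟶ Y.M)

/-- Composition with a morphism of `D`, as a map of `A_{α⁻¹}(G, O)`-modules. -/
def IsCocycle.orbitMap (hα : c.IsCocycle α)
    (o : MulAction.orbitRel.Quotient G (SimpleClass π)) {Y Z : EquivMod π} (m : Y ⟶ Z) :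
    hα.orbitObj o Y →ₗ[OrbitAlg α o] hα.orbitObj o Z where
  toFun := fun (a : ∀ s : o.orbit, c.X s ⟶ Y.M) s => a s ≫ m.hom
  map_add' := fun _ _ => funext fun _ => Preadditive.add_comp _ _ _ _ _ _
  map_smul' := fun x a => funext fun t => c.sum_conjAt_comp m x a t

/-- The functor `Y ↦ ⨁_{s ∈ O} Hom_A(X_s, Y)` from `D` to modules over `A_{α⁻¹}(G, O)`. -/
def IsCocycle.orbitFunctor (hα : c.IsCocycle α)
    (o : MulAction.orbitRel.Quotient G (SimpleClass π)) :
    EquivMod π ⥤ ModuleCat.{max u v} (OrbitAlg α o) where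
  obj Y := hα.orbitObj o Y
  map m := (ModuleCat.ofHom (hα.orbitMap o m) :)
  map_id Y := ModuleCat.hom_ext (LinearMap.ext fun a =>
    funext fun s => Category.comp_id (a s : c.X s ⟶ Y.M))
  map_comp {X _ _} m n := ModuleCat.hom_ext (LinearMap.ext fun a =>
    funext fun s => (Category.assoc (a s : c.X s ⟶ X.M) m.hom n.hom).symm)

/-- The functor `Y ↦ (⨁_{s ∈ O} Hom_A(X_s, Y))_O`, where `O` runs over the orbits of `G` in `S`. -/
def IsCocycle.homFunctor (hα : c.IsCocycle α) :
    EquivMod π ⥤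
      ∀ o : MulAction.orbitRel.Quotient G (SimpleClass π), ModuleCat.{max u v} (OrbitAlg α o) :=
  Functor.pi' hα.orbitFunctor

/-- The action of `ℂ^{α_s⁻¹}[G_s]` on `Hom_A(X_s, Y)`: `g` acts by
`a ↦ φ_Y(g) ∘ a ∘ φ_s(g)⁻¹`. -/
@[reducible]
def IsCocycle.stabModule (hα : c.IsCocycle α) (s : SimpleClass π) (Y : EquivMod π) :
    Module (StabAlg α s) (c.X s ⟶ Y.M) where
  smul x a := ∑ g, x.coeff g • c.conj Y g (stab_smul g) a
  one_smul a := by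
    change ∑ g, (1 : StabAlg α s).coeff g • c.conj Y g (stab_smul g) a = a
    rw [Finset.sum_eq_single 1]
    · have := hα.conj_one Y (one_smul G s) a
      simp only [Subgroup.coe_one]
      rw [this, smul_smul]
      simp [TwistedGroupAlg.one_coeff, Cocycle.atPoint, Cocycle.inv]
    · intro g _ hg
      simp [TwistedGroupAlg.one_coeff, hg]
    · simp
  mul_smul x y a := by
    change ∑ m, (x * y).coeff m • c.conj Y m (stab_smul m) a =
      ∑ g, x.coeff g • c.conj Y g (stab_smul g) (∑ h, y.coeff h • c.conj Y h (stab_smul h) a)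
    simp only [TwistedGroupAlg.mul_coeff, Finset.sum_smul, map_sum, map_smul, Finset.smul_sum]
    rw [Finset.sum_comm]
    refine Finset.sum_congr rfl fun g _ => ?_
    refine Fintype.sum_equiv (Equiv.mulLeft g⁻¹) _ _ fun m => ?_
    dsimp only [Equiv.coe_mulLeft]
    rw [hα.conj_conj, smul_smul, smul_smul]
    simp only [Subgroup.coe_mul, Subgroup.coe_inv, mul_inv_cancel_left]
    rfl
  smul_zero x := by
    change ∑ g, x.coeff g • c.conj Y g (stab_smul g) 0 = 0
    simp
  smul_add x a b := by
    change ∑ g, x.coeff g • c.conj Y g (stab_smul g) (a + b) =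
      ∑ g, x.coeff g • c.conj Y g (stab_smul g) a + ∑ g, x.coeff g • c.conj Y g (stab_smul g) b
    simp [Finset.sum_add_distrib]
  add_smul x y a := by
    change ∑ g, (x + y).coeff g • c.conj Y g (stab_smul g) a =
      ∑ g, x.coeff g • c.conj Y g (stab_smul g) a + ∑ g, y.coeff g • c.conj Y g (stab_smul g) a
    simp [add_smul, Finset.sum_add_distrib]
  zero_smul a := by
    change ∑ g, (0 : StabAlg α s).coeff g • c.conj Y g (stab_smul g) a = 0
    simp

/-- The `ℂ^{α_s⁻¹}[G_s]`-module `Hom_A(X_s, Y)`. -/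
def IsCocycle.stabObj (hα : c.IsCocycle α) (s : SimpleClass π) (Y : EquivMod π) :
    ModuleCat.{v} (StabAlg α s) :=
  letI := hα.stabModule s Y
  ModuleCat.of (StabAlg α s) (c.X s ⟶ Y.M)

/-- Composition with a morphism of `D`, as a map of `ℂ^{α_s⁻¹}[G_s]`-modules. -/
def IsCocycle.stabMap (hα : c.IsCocycle α) (s : SimpleClass π) {Y Z : EquivMod π} (m : Y ⟶ Z) :
    hα.stabObj s Y →ₗ[StabAlg α s] hα.stabObj s Z where
  toFun := fun (a : c.X s ⟶ Y.M) => a ≫ m.hom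
  map_add' := fun _ _ => Preadditive.add_comp _ _ _ _ _ _
  map_smul' := fun x a => c.sum_conj_comp m x a

/-- The functor `Y ↦ Hom_A(X_s, Y)` from `D` to modules over `ℂ^{α_s⁻¹}[G_s]`. -/
def IsCocycle.stabFunctor (hα : c.IsCocycle α) (s : SimpleClass π) :
    EquivMod π ⥤ ModuleCat.{v} (StabAlg α s) where
  obj Y := hα.stabObj s Y
  map m := (ModuleCat.ofHom (hα.stabMap s m) :)
  map_id Y := ModuleCat.hom_ext (LinearMap.ext fun a => Category.comp_id (a : c.X s ⟶ Y.M))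
  map_comp {X _ _} m n := ModuleCat.hom_ext (LinearMap.ext fun a =>
    (Category.assoc (a : c.X s ⟶ X.M) m.hom n.hom).symm)

/-- The functor `Y ↦ (Hom_A(X_s, Y))_s`, where `s = r o` runs over given representatives of the
orbits of `G` in `S`. -/
def IsCocycle.stabHomFunctor (hα : c.IsCocycle α)
    (r : MulAction.orbitRel.Quotient G (SimpleClass π) → SimpleClass π) :
    EquivMod π ⥤
      ∀ o : MulAction.orbitRel.Quotient G (SimpleClass π), ModuleCat.{v} (StabAlg α (r o)) :=
  Functor.pi' fun o => hα.stabFunctor (r o)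

end Choice

end Functors

/-! ### The components `V_s` of a representation of `A_α(G, O)` and the sums `⨁ V_s ⊠ X_s` -/

section Components

variable {G : Type*} {T : Type*} [Group G] [MulAction G T] [Finite G] {α : Cocycle G T}

open scoped ModuleCat

/-- The component `V_s = δ_s V` of a module over `A_α(G, T)`. -/
def component (V : ModuleCat.{w} (TwistedAlg α)) (s : T) : Submodule ℂ V where
  carrier := {x | TwistedAlg.delta α s • x = x}
  add_mem' {x y} hx hy := by
    change _ • (x + y) = x + y
    rw [smul_add, hx, hy]
  zero_mem' := smul_zero _
  smul_mem' z x hx := by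
    change _ • (z • x) = z • x
    rw [smul_comm, hx]

/-- The map `V_s → V_t`, `t = gs`, given by the action of `g` on `V`. -/
def componentAct (V : ModuleCat.{w} (TwistedAlg α)) (g : G) {s t : T} (h : g • s = t) :
    component V s →ₗ[ℂ] component V t where
  toFun x := ⟨TwistedAlg.u α g • (x : V), by
    subst h
    change _ • (_ • (x : V)) = _
    rw [← mul_smul, ← TwistedAlg.u_mul_delta, mul_smul, x.2]⟩
  map_add' x y := Subtype.ext (smul_add _ _ _)
  map_smul' z x := Subtype.ext (smul_comm _ _ _)

/-- The map `V_s → W_s` induced by a morphism of representations. -/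
def componentMap {V W : ModuleCat.{w} (TwistedAlg α)} (m : V ⟶ W) (s : T) :
    component V s →ₗ[ℂ] component W s where
  toFun x := ⟨m.hom (x : V), by
    change _ • m.hom (x : V) = _
    rw [← map_smul, x.2]⟩
  map_add' x y := Subtype.ext (map_add _ _ _)
  map_smul' z x := Subtype.ext ((m.hom.restrictScalars ℂ).map_smul z (x : V))

end Components

section SumTensor

variable {C : Type u} [Category.{v} C] [MonoidalCategory C] [Preadditive C]
  [MonoidalPreadditive C] [Linear ℂ C] [MonoidalLinear ℂ C] {G : Type w} [Group G] [Finite G]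
  {A : Mon C} {π : G →* Aut A}

/-- The object `Y` of `D`, with the linear maps `i_s : V_s → Hom_A(X_s, Y)`, is
`⨁_O V_O ⊠_{F[O]} X_O = ⨁_s V_s ⊠ X_s` with `φ_Y(g) = ⨁_s φ_{V_s}(g) ⊗ φ_s(g)`. Here `V ⊠ X`, for
a vector space `V`, is the object with `Hom(V ⊠ X, Z) = Hom_ℂ(V, Hom(X, Z))`. -/
structure IsSumTensor (c : Choice π) (α : Cocycle G (SimpleClass π))
    (V : ∀ o : MulAction.orbitRel.Quotient G (SimpleClass π),
      ModuleCat.{max u v} (Choice.OrbitAlg α o)) (Y : EquivMod π)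
    (i : ∀ (o : MulAction.orbitRel.Quotient G (SimpleClass π)) (s : o.orbit),
      component (V o) s →ₗ[ℂ] (c.X s ⟶ Y.M)) : Prop where
  universal : ∀ (Z : Mod C A.X)
    (j : ∀ (o : MulAction.orbitRel.Quotient G (SimpleClass π)) (s : o.orbit),
      component (V o) s →ₗ[ℂ] (c.X s ⟶ Z)),
    ∃! m : Y.M ⟶ Z, ∀ o s x, i o s x ≫ m = j o s x
  equivariant : ∀ (g : G) (o : MulAction.orbitRel.Quotient G (SimpleClass π)) (s t : o.orbit)
    (h : g • s = t) (x : component (V o) s),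
    (i o s x).hom ≫ Y.φ g =
      c.f g (Choice.orbit_smul h) ≫ (i o t (componentAct (V o) g h x)).hom

end SumTensor

/-- A preadditive category is abelian. -/
def IsAbelian (D : Type u) [Category.{v} D] [inst : Preadditive D] : Prop :=
  ∃ a : Abelian D, a.toPreadditive = inst

end Orbifold
end

open Orbifold

/-!
The coevaluation of the pairing on `A` is a Casimir element whose product is `dim A • 1 ≠ 0`.
Averaging over it turns quasi-inverses in `C` (morphisms `g` with `f g f = f`) into quasi-inverses
in `Rep A`, and averaging over `G` does the same for `D`. A preadditive category with finite
biproducts and split idempotents in which every morphism has a quasi-inverse is abelian.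

By semisimplicity of `Rep A`, an object `Y` of `D` is determined by the spaces `Hom_A(X_s, Y)`
together with the conjugation maps between them, which compose up to `α⁻¹`. A module over
`A_{α⁻¹}(G, O)` is the same data, read off from the components `δ_s V`. Over an orbit such a family
is recovered from its member at a representative by transport along chosen elements of `G`, which
leaves a representation of the twisted group algebra of the stabilizer.
-/

noncomputable section

namespace Orbifold

/-! ### Regular morphisms -/

/-- Every morphism is von Neumann regular: `f` has a quasi-inverse `g`, `f ≫ g ≫ f = f`. For
preadditive categories with split idempotents this is the form of semisimplicity which passes from
`C` to `Rep A` and to `D` by averaging quasi-inverses. -/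
def AllRegular (D : Type*) [Category* D] : Prop :=
  ∀ ⦃X Y : D⦄ (f : X ⟶ Y), ∃ g : Y ⟶ X, f ≫ g ≫ f = f

lemma AllRegular.splitMonoCategory {D : Type*} [Category* D] (h : AllRegular D) :
    SplitMonoCategory D where
  isSplitMono_of_mono f _ := by
    obtain ⟨g, hg⟩ := h f
    exact ⟨⟨g, by rw [← cancel_mono f, Category.assoc, hg, Category.id_comp]⟩⟩

lemma AllRegular.splitEpiCategory {D : Type*} [Category* D] (h : AllRegular D) :
    SplitEpiCategory D where
  isSplitEpi_of_epi f _ := by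
    obtain ⟨g, hg⟩ := h f
    exact ⟨⟨g, by rw [← cancel_epi f, hg, Category.comp_id]⟩⟩

section Preadditive

variable {D : Type u} [Category.{v} D] [Preadditive D]

lemma isNormalMonoCategory_of_splitMonoCategory [SplitMonoCategory D] :
    IsNormalMonoCategory D where
  normalMonoOfMono f _ := by
    have := isSplitMono_of_mono f
    let R := RegularMono.ofIsSplitMono f
    exact ⟨⟨R.Z, R.left - R.right, by rw [Preadditive.comp_sub, R.w, sub_self],
      Preadditive.isLimitKernelForkOfFork R.isLimit⟩⟩

lemma isNormalEpiCategory_of_splitEpiCategory [SplitEpiCategory D] :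
    IsNormalEpiCategory D where
  normalEpiOfEpi f _ := by
    have := isSplitEpi_of_epi f
    let R := RegularEpi.ofSplitEpi f
    exact ⟨⟨R.W, R.left - R.right, by rw [Preadditive.sub_comp, R.w, sub_self],
      Preadditive.isColimitCokernelCoforkOfCofork R.isColimit⟩⟩

lemma AllRegular.hasKernels [IsIdempotentComplete D] (h : AllRegular D) : HasKernels D where
  has_limit {X Y} f := by
    obtain ⟨g, hg⟩ := h f
    have : HasKernel (f ≫ g) :=
      (Idempotents.isIdempotentComplete_iff_idempotents_have_kernels D).mp ‹_› X (f ≫ g)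
        (by rw [Category.assoc, reassoc_of% hg])
    have hf : kernel.ι (f ≫ g) ≫ f = 0 := by
      calc kernel.ι (f ≫ g) ≫ f = (kernel.ι (f ≫ g) ≫ f ≫ g) ≫ f := by
            simp only [Category.assoc, hg]
        _ = 0 := by rw [kernel.condition, zero_comp]
    exact ⟨⟨⟨_, KernelFork.IsLimit.ofι (kernel.ι (f ≫ g)) hf
      (fun x hx => kernel.lift _ x (by rw [reassoc_of% hx, zero_comp])) (fun _ _ => by simp)
      (fun _ _ _ hm => by simp [← cancel_mono (kernel.ι (f ≫ g)), hm])⟩⟩⟩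

lemma AllRegular.hasCokernels [IsIdempotentComplete D] (h : AllRegular D) : HasCokernels D where
  has_colimit {X Y} f := by
    obtain ⟨g, hg⟩ := h f
    obtain ⟨K, i, e, hie, hei⟩ := IsIdempotentComplete.idempotents_split Y (𝟙 Y - g ≫ f)
      (Idempotents.idem_of_id_sub_idem (g ≫ f) (by rw [Category.assoc, hg]))
    have hfe : f ≫ e = 0 := by
      calc f ≫ e = (f ≫ e ≫ i) ≫ e := by simp [hie]
        _ = 0 := by rw [hei, Preadditive.comp_sub, Category.comp_id, hg, sub_self, zero_comp]
    exact ⟨⟨⟨_, CokernelCofork.IsColimit.ofπ e hfe (fun x _ => i ≫ x)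
      (fun x hx => by simp [reassoc_of% hei, hx]) (fun x _ m hm => by rw [← hm, reassoc_of% hie])⟩⟩⟩

lemma AllRegular.isAbelian [IsIdempotentComplete D] [HasFiniteBiproducts D] (h : AllRegular D) :
    IsAbelian D := by
  have := h.hasKernels
  have := h.hasCokernels
  have := h.splitMonoCategory
  have := h.splitEpiCategory
  exact ⟨{
    toPreadditive := inferInstance
    toIsNormalMonoCategory := isNormalMonoCategory_of_splitMonoCategory
    toIsNormalEpiCategory := isNormalEpiCategory_of_splitEpiCategory }, rfl⟩

lemma hasFiniteBiproducts_of_total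
    (h : ∀ (n : ℕ) (f : Fin n → D), ∃ b : Bicone f, ∑ j, b.π j ≫ b.ι j = 𝟙 b.pt) :
    HasFiniteBiproducts D where
  out n := ⟨fun F =>
    let ⟨b, hb⟩ := h n F
    hasBiproduct_of_total b hb⟩

/-- A finite sum of simple objects, encoded by a decomposition of the identity into morphisms
through simple objects. -/
def SumOfSimples (M : D) : Prop :=
  ∃ (ι : Type) (_ : Fintype ι) (S : ι → D) (p : ∀ k, M ⟶ S k) (i : ∀ k, S k ⟶ M),
    (∀ k, Simple (S k)) ∧ ∑ k, p k ≫ i k = 𝟙 M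

lemma SumOfSimples.of_add {M N K : D} (hN : SumOfSimples N) (hK : SumOfSimples K)
    (r : M ⟶ N) (i : N ⟶ M) (s : M ⟶ K) (j : K ⟶ M) (h : r ≫ i + s ≫ j = 𝟙 M) :
    SumOfSimples M := by
  obtain ⟨ι₁, _, S₁, p₁, i₁, hS₁, h₁⟩ := hN
  obtain ⟨ι₂, _, S₂, p₂, i₂, hS₂, h₂⟩ := hK
  refine ⟨ι₁ ⊕ ι₂, inferInstance, Sum.elim S₁ S₂, Sum.rec (fun k => r ≫ p₁ k) (fun k => s ≫ p₂ k),
    Sum.rec (fun k => i₁ k ≫ i) (fun k => i₂ k ≫ j), Sum.rec hS₁ hS₂, ?_⟩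
  calc _ = r ≫ (∑ k, p₁ k ≫ i₁ k) ≫ i + s ≫ (∑ k, p₂ k ≫ i₂ k) ≫ j := by
        simp [Preadditive.comp_sum, Preadditive.sum_comp]
    _ = 𝟙 M := by rw [h₁, h₂, Category.id_comp, Category.id_comp, h]

lemma AllRegular.exists_idempotent_of_not_simple (h : AllRegular D) {M : D} (h0 : 𝟙 M ≠ 0)
    (hM : ¬ Simple M) : ∃ p : M ⟶ M, p ≫ p = p ∧ p ≠ 0 ∧ p ≠ 𝟙 M := by
  obtain ⟨N, f, _, hf0, hf⟩ : ∃ (N : D) (f : N ⟶ M), Mono f ∧ f ≠ 0 ∧ ¬ IsIso f := by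
    by_contra! hcon
    refine hM ⟨fun f _ => ⟨fun _ hf => h0 ?_, hcon _ f ‹_›⟩⟩
    simpa [hf] using (IsIso.inv_hom_id f).symm
  obtain ⟨g, hg⟩ := h f
  have hfg : f ≫ g = 𝟙 N := by rw [← cancel_mono f, Category.assoc, hg, Category.id_comp]
  refine ⟨g ≫ f, by rw [Category.assoc, hg], fun hgf => hf0 ?_, fun hgf => hf ⟨g, hfg, hgf⟩⟩
  rw [← hg, hgf, comp_zero]

variable [Linear ℂ D]

lemma finrank_end_lt_of_retract {N M : D} [FiniteDimensional ℂ (M ⟶ M)] (i : N ⟶ M)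
    (r : M ⟶ N) (hir : i ≫ r = 𝟙 N) (q : M ⟶ M) (hq : q ≠ 0) (hiq : i ≫ q = 0) :
    Module.finrank ℂ (N ⟶ N) < Module.finrank ℂ (M ⟶ M) := by
  let L : (N ⟶ N) →ₗ[ℂ] (M ⟶ M) := Linear.leftComp ℂ M r ∘ₗ Linear.rightComp ℂ N i
  have hL (x : N ⟶ N) : i ≫ L x ≫ r = x := by simp [L, hir, reassoc_of% hir]
  have hinj : Function.Injective L := fun x y hxy => by rw [← hL x, hxy, hL]
  rw [← LinearMap.finrank_range_of_inj hinj]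
  refine Submodule.finrank_lt fun htop => hq ?_
  obtain ⟨x, rfl⟩ : q ∈ LinearMap.range L := htop ▸ Submodule.mem_top
  rw [← hL x, reassoc_of% hiq, zero_comp, map_zero]

lemma AllRegular.sumOfSimples [IsIdempotentComplete D] [∀ X Y : D, FiniteDimensional ℂ (X ⟶ Y)]
    (h : AllRegular D) (M : D) : SumOfSimples M := by
  induction hn : Module.finrank ℂ (M ⟶ M) using Nat.strong_induction_on generalizing M with
  | _ n ih =>
  subst hn
  by_cases h0 : 𝟙 M = 0
  · exact ⟨Empty, inferInstance, Empty.elim, (·.elim), (·.elim), (·.elim), by simp [h0]⟩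
  by_cases hM : Simple M
  · exact ⟨Unit, inferInstance, fun _ => M, fun _ => 𝟙 M, fun _ => 𝟙 M, fun _ => hM, by simp⟩
  obtain ⟨p, hp, hp0, hp1⟩ := h.exists_idempotent_of_not_simple h0 hM
  obtain ⟨N, i, r, hir, hri⟩ := IsIdempotentComplete.idempotents_split M p hp
  obtain ⟨K, j, s, hjs, hsj⟩ := IsIdempotentComplete.idempotents_split M (𝟙 M - p)
    (Idempotents.idem_of_id_sub_idem p hp)
  have hip : i ≫ (𝟙 M - p) = 0 := by simp [← hri, reassoc_of% hir]
  have hjp : j ≫ p = 0 := by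
    rw [← sub_sub_cancel (𝟙 M) p, ← hsj]
    simp [reassoc_of% hjs]
  exact .of_add
    (ih _ (finrank_end_lt_of_retract i r hir (𝟙 M - p) (sub_ne_zero.mpr hp1.symm) hip) N rfl)
    (ih _ (finrank_end_lt_of_retract j s hjs p hp0 hjp) K rfl)
    r i s j (by rw [hri, hsj, add_sub_cancel])

end Preadditive

section Abelian

variable {C : Type*} [Category* C] [Abelian C]

lemma allRegular_of_splitMonoCategory [SplitMonoCategory C] : AllRegular C := by
  intro X Y f
  let e := Abelian.factorThruImage f
  have := isSplitMono_of_mono (Abelian.image.ι f)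
  have := isSplitMono_of_mono (kernel.ι e)
  let σ : (ShortComplex.mk (kernel.ι e) e (kernel.condition e)).Splitting :=
    .ofExactOfRetraction _ (ShortComplex.exact_of_f_is_kernel _ (kernelIsKernel e))
      (retraction (kernel.ι e)) (IsSplitMono.id _) (inferInstanceAs (Epi e))
  have hσ : σ.s ≫ e = 𝟙 (Abelian.image f) := σ.s_g
  refine ⟨retraction (Abelian.image.ι f) ≫ σ.s, ?_⟩
  calc f ≫ (retraction (Abelian.image.ι f) ≫ σ.s) ≫ f
      = (e ≫ Abelian.image.ι f) ≫ (retraction (Abelian.image.ι f) ≫ σ.s) ≫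
          e ≫ Abelian.image.ι f := by rw [Abelian.image.fac]
    _ = f := by
        simp only [Category.assoc]
        rw [IsSplitMono.id_assoc, reassoc_of% hσ, Abelian.image.fac]

lemma exists_comp_eq_of_kernel_ι_comp_eq_zero {N M S : C} [Simple S] (q : N ⟶ S) (f : N ⟶ M)
    (hf : kernel.ι q ≫ f = 0) : ∃ k : S ⟶ M, q ≫ k = f := by
  by_cases hq : q = 0
  · have : IsIso (kernel.ι q) := by
      rw [hq]
      infer_instance
    exact ⟨0, by rw [comp_zero, ← cancel_epi (kernel.ι q), hf, comp_zero]⟩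
  · have := epi_of_nonzero_to_simple hq
    exact ⟨Abelian.epiDesc q f hf, Abelian.comp_epiDesc q f hf⟩

lemma exists_sum_eq_id_of_jointly_mono {n : ℕ} {N : C} (S : Fin n → C) [∀ i, Simple (S i)]
    (q : ∀ i, N ⟶ S i) (hq : ∀ (Z : C) (x : Z ⟶ N), (∀ i, x ≫ q i = 0) → x = 0) :
    ∃ h : ∀ i, S i ⟶ N, ∑ i, q i ≫ h i = 𝟙 N := by
  induction n generalizing N with
  | zero => exact ⟨(·.elim0), (hq N (𝟙 N) (·.elim0)).symm⟩
  | succ n ih =>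
    let κ := kernel.ι (q 0)
    obtain ⟨h, hh⟩ := ih (fun i => S i.succ) (fun i => κ ≫ q i.succ) fun Z x hx => by
      rw [← cancel_mono κ, zero_comp]
      exact hq _ _ (Fin.cases (by simp [κ]) fun i => by simpa using hx i)
    let r := ∑ i : Fin n, q i.succ ≫ h i
    have hr : κ ≫ (𝟙 N - r ≫ κ) = 0 := by
      have : κ ≫ r = 𝟙 _ := by simpa [r, Preadditive.comp_sum] using hh
      simp [reassoc_of% this]
    obtain ⟨k, hk⟩ := exists_comp_eq_of_kernel_ι_comp_eq_zero (q 0) _ hr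
    refine ⟨Fin.cases k fun i => h i ≫ κ, ?_⟩
    simp [Fin.sum_univ_succ, hk, r, Preadditive.sum_comp]

attribute [local instance] Abelian.hasFiniteBiproducts in
lemma IsSemisimpleCat.splitMonoCategory [Linear ℂ C] (hC : IsSemisimpleCat C) :
    SplitMonoCategory C where
  isSplitMono_of_mono {X Y} f _ := by
    obtain ⟨n, S, hS, ⟨e⟩⟩ := hC.exists_iso_sum Y
    obtain ⟨h, hh⟩ := exists_sum_eq_id_of_jointly_mono S (fun i => f ≫ e.hom ≫ biproduct.π S i)
      fun Z x hx => by
        rw [← cancel_mono (f ≫ e.hom), zero_comp]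
        exact biproduct.hom_ext _ _ fun i => by simpa using hx i
    exact ⟨⟨∑ i, (e.hom ≫ biproduct.π S i) ≫ h i, by simpa [Preadditive.comp_sum] using hh⟩⟩

lemma IsSemisimpleCat.allRegular [Linear ℂ C] (hC : IsSemisimpleCat C) : AllRegular C :=
  have := hC.splitMonoCategory
  allRegular_of_splitMonoCategory

end Abelian

/-! ### Modules over an algebra -/

section Mod

variable {C : Type u} [Category.{v} C] [MonoidalCategory C] {A : C} [MonObj A]

lemma one_act (M : Mod C A) : (MonObj.one : 𝟙_ C ⟶ A) ▷ M.X ≫ act M = (λ_ M.X).hom :=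
  ModObj.one_smul (M := A) M.X

lemma mul_act (M : Mod C A) :
    (MonObj.mul : A ⊗ A ⟶ A) ▷ M.X ≫ act M = (α_ A A M.X).hom ≫ A ◁ act M ≫ act M :=
  ModObj.mul_smul (M := A) M.X

section LiftMod

variable {J : Type*} (K : C) (a : A ⊗ K ⟶ K) (M : J → Mod C A) (k : ∀ j, K ⟶ (M j).X)
    (hk : ∀ ⦃Z : C⦄ (x y : Z ⟶ K), (∀ j, x ≫ k j = y ≫ k j) → x = y)
    (ha : ∀ j, a ≫ k j = A ◁ k j ≫ act (M j))

/-- The module structure given by `a` on an object `K` with a jointly monic family of morphisms to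
modules which commute with `a`; the module axioms for `a` are inherited from the family. -/
def liftMod : Mod C A :=
  letI : ModObj A K :=
    { smul := a
      one_smul := hk _ _ fun j => by
        change (MonObj.one ▷ K ≫ a) ≫ k j = (λ_ K).hom ≫ k j
        rw [Category.assoc, ha, ← whisker_exchange_assoc, one_act, id_whiskerLeft]
        simp only [Category.assoc, Iso.inv_hom_id, Category.comp_id]
      mul_smul := hk _ _ fun j => by
        change (MonObj.mul ▷ K ≫ a) ≫ k j = ((α_ A A K).hom ≫ A ◁ a ≫ a) ≫ k j
        simp only [Category.assoc]
        rw [ha, ← whisker_exchange_assoc, mul_act, ← whiskerLeft_comp_assoc, ha]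
        simp }
  ⟨K⟩

/-- The members of the jointly monic family defining `liftMod`, as morphisms of modules. -/
def liftMod.proj (j : J) : liftMod K a M k hk ha ⟶ M j := mkHom (k j) (ha j)

/-- A morphism to `liftMod` is a morphism of modules as soon as its components are. -/
def liftMod.lift (N : Mod C A) (f : N.X ⟶ K) (p : ∀ j, N ⟶ M j) (hf : ∀ j, f ≫ k j = (p j).hom) :
    N ⟶ liftMod K a M k hk ha :=
  mkHom f (hk _ _ fun j => by
    change (act N ≫ f) ≫ k j = (A ◁ f ≫ a) ≫ k j
    rw [Category.assoc, hf, Category.assoc, ha, ← whiskerLeft_comp_assoc, hf, act_hom])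

end LiftMod

variable [Preadditive C] [MonoidalPreadditive C]

lemma sum_hom {M N : Mod C A} {J : Type*} (s : Finset J) (f : J → (M ⟶ N)) :
    (∑ j ∈ s, f j).hom = ∑ j ∈ s, (f j).hom :=
  map_sum (homAddHom M N) f s

instance [IsIdempotentComplete C] : IsIdempotentComplete (Mod C A) where
  idempotents_split M p hp := by
    obtain ⟨K, i, e, hie, hei⟩ := IsIdempotentComplete.idempotents_split M.X p.hom
      (congrArg Mod.Hom.hom hp)
    have hip : i ≫ p.hom = i := by rw [← hei, reassoc_of% hie]
    have hi : ∀ ⦃Z : C⦄ (x y : Z ⟶ K), (∀ _ : Unit, x ≫ i = y ≫ i) → x = y := fun Z x y h => by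
      simpa [hie] using congrArg (· ≫ e) (h ())
    have ha : ∀ _ : Unit, (A ◁ i ≫ act M ≫ e) ≫ i = A ◁ i ≫ act M := fun _ => by
      simp only [Category.assoc]
      rw [hei, act_hom, ← whiskerLeft_comp_assoc, hip]
    exact ⟨_, liftMod.proj K _ (fun _ : Unit => M) (fun _ => i) hi ha (),
      liftMod.lift K _ _ _ hi ha M e (fun _ => p) (fun _ => hei),
      hom_injective hie, hom_injective hei⟩

section Biproducts

variable [HasFiniteBiproducts C] {J : Type} [Fintype J] (f : J → Mod C A)

open scoped Classical in
/-- The biproduct of finitely many modules, carried by the chosen biproduct of the underlying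
objects. -/
def modBicone : Bicone f :=
  let k (j : J) : (⨁ fun j => (f j).X) ⟶ (f j).X := biproduct.π _ j
  let a : A ⊗ (⨁ fun j => (f j).X) ⟶ ⨁ fun j => (f j).X :=
    biproduct.lift fun j => A ◁ k j ≫ act (f j)
  have hk : ∀ ⦃Z : C⦄ (x y : Z ⟶ ⨁ fun j => (f j).X), (∀ j, x ≫ k j = y ≫ k j) → x = y :=
    fun _ x y => biproduct.hom_ext x y
  have ha (j : J) : a ≫ k j = A ◁ k j ≫ act (f j) := biproduct.lift_π _ _
  let d (i j : J) : f i ⟶ f j := if h : i = j then eqToHom (congrArg f h) else 0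
  have hι (i j : J) : biproduct.ι (fun j => (f j).X) i ≫ k j = (d i j).hom := by
    rcases eq_or_ne i j with rfl | h
    · simp [k, d]
    · simp [k, d, h, biproduct.ι_π_ne _ h]
  { pt := liftMod _ a f k hk ha
    π := liftMod.proj _ a f k hk ha
    ι i := liftMod.lift _ a f k hk ha (f i) (biproduct.ι (fun j => (f j).X) i) (d i) (hι i)
    ι_π i j := hom_injective (hι i j) }

lemma modBicone_total : ∑ j, (modBicone f).π j ≫ (modBicone f).ι j = 𝟙 (modBicone f).pt :=
  hom_injective ((sum_hom _ _).trans (biproduct.total (f := fun j => (f j).X)))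

instance : HasFiniteBiproducts (Mod C A) :=
  hasFiniteBiproducts_of_total fun _ f => ⟨modBicone f, modBicone_total f⟩

end Biproducts

end Mod

/-! ### Averaging over a Casimir element -/

section Casimir

variable {C : Type u} [Category.{v} C] [MonoidalCategory C] {A : C} [MonObj A]

/-- A Casimir element of `A`, that is, an element `i = ∑ i₁ ⊗ i₂` of `A ⊗ A` with
`∑ a i₁ ⊗ i₂ = ∑ i₁ ⊗ i₂ a` for all `a`. -/
def IsCasimir (i : 𝟙_ C ⟶ A ⊗ A) : Prop :=
  (ρ_ A).inv ≫ A ◁ i ≫ (α_ A A A).inv ≫ MonObj.mul ▷ A =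
    (λ_ A).inv ≫ i ▷ A ≫ (α_ A A A).hom ≫ A ◁ MonObj.mul

lemma IsCasimir.of_exactPairing (p : ExactPairing A A) (e : A ⟶ 𝟙_ C)
    (he : p.evaluation' = MonObj.mul ≫ e) : IsCasimir p.coevaluation' := by
  suffices mul_eq : ((λ_ A).inv ≫ p.coevaluation' ▷ A ≫ (α_ A A A).hom ≫ A ◁ MonObj.mul) ▷ A ≫
      (α_ A A A).hom ≫ A ◁ p.evaluation' ≫ (ρ_ A).hom = MonObj.mul from
    ((tensorRightHomEquiv A A A A).eq_symm_apply (y := MonObj.mul)).mp mul_eq.symm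
  have h := p.evaluation_coevaluation'
  rw [he] at h ⊢
  calc _ = (λ_ A).inv ▷ A ≫ p.coevaluation' ▷ A ▷ A ≫ (α_ A A A).hom ▷ A ≫ (α_ A _ A).hom ≫
        A ◁ ((MonObj.mul ▷ A ≫ MonObj.mul) ≫ e) ≫ (ρ_ A).hom := by monoidal
    _ = (λ_ (A ⊗ A)).inv ≫ p.coevaluation' ▷ (A ⊗ A) ≫ (A ⊗ A) ◁ MonObj.mul ≫
        (α_ A A A).hom ≫ A ◁ (MonObj.mul ≫ e) ≫ (ρ_ A).hom := by
      rw [MonObj.mul_assoc]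
      monoidal
    _ = MonObj.mul := by
      rw [← whisker_exchange_assoc, reassoc_of% h]
      simp

/-- The map `x ↦ ∑ i₁ ⊗ i₂ x` given by an element `i = ∑ i₁ ⊗ i₂` of `A ⊗ A`. -/
def casimirMap (i : 𝟙_ C ⟶ A ⊗ A) (M : Mod C A) : M.X ⟶ A ⊗ M.X :=
  (λ_ M.X).inv ≫ i ▷ M.X ≫ (α_ A A M.X).hom ≫ A ◁ act M

lemma casimirMap_naturality (i : 𝟙_ C ⟶ A ⊗ A) {M N : Mod C A} (f : M ⟶ N) :
    f.hom ≫ casimirMap i N = casimirMap i M ≫ A ◁ f.hom := by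
  simp only [casimirMap, Category.assoc]
  rw [← whiskerLeft_comp, act_hom, leftUnitor_inv_naturality_assoc, whisker_exchange_assoc]
  simp

lemma IsCasimir.act_casimirMap {i : 𝟙_ C ⟶ A ⊗ A} (hi : IsCasimir i) (M : Mod C A) :
    act M ≫ casimirMap i M =
      A ◁ casimirMap i M ≫ (α_ A A M.X).inv ≫ MonObj.mul ▷ M.X := by
  calc act M ≫ casimirMap i M = (λ_ (A ⊗ M.X)).inv ≫ (𝟙_ C) ◁ act M ≫ i ▷ M.X ≫
        (α_ A A M.X).hom ≫ A ◁ act M := by simp [casimirMap]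
    _ = (λ_ (A ⊗ M.X)).inv ≫ i ▷ (A ⊗ M.X) ≫ (α_ A A (A ⊗ M.X)).hom ≫
        A ◁ ((α_ A A M.X).inv ≫ (α_ A A M.X).hom ≫ A ◁ act M ≫ act M) := by
      rw [whisker_exchange_assoc]
      simp
    _ = ((λ_ A).inv ≫ i ▷ A ≫ (α_ A A A).hom ≫ A ◁ MonObj.mul) ▷ M.X ≫
        (α_ A A M.X).hom ≫ A ◁ act M := by
      rw [← mul_act]
      monoidal
    _ = ((ρ_ A).inv ≫ A ◁ i ≫ (α_ A A A).inv ≫ MonObj.mul ▷ A) ▷ M.X ≫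
        (α_ A A M.X).hom ≫ A ◁ act M := by rw [hi]
    _ = _ := by
      simp only [comp_whiskerRight, Category.assoc, casimirMap, MonoidalCategory.whiskerLeft_comp]
      rw [associator_naturality_left_assoc, ← whisker_exchange]
      monoidal

variable [Preadditive C] [MonoidalPreadditive C] [Linear ℂ C] [MonoidalLinear ℂ C]

lemma casimirMap_act {i : 𝟙_ C ⟶ A ⊗ A} {z : ℂ} (hz : i ≫ MonObj.mul = z • MonObj.one)
    (M : Mod C A) : casimirMap i M ≫ act M = z • 𝟙 M.X := by
  simp only [casimirMap, Category.assoc]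
  rw [← mul_act, ← comp_whiskerRight_assoc, hz, MonoidalLinear.smul_whiskerRight,
    Linear.smul_comp, one_act, Linear.comp_smul, Iso.inv_hom_id]

/-- The average `x ↦ ∑ i₁ s (i₂ x)` of a morphism `s` over a Casimir element `∑ i₁ ⊗ i₂`. -/
def IsCasimir.average {i : 𝟙_ C ⟶ A ⊗ A} (hi : IsCasimir i) {M N : Mod C A} (s : M.X ⟶ N.X) :
    M ⟶ N :=
  mkHom (casimirMap i M ≫ A ◁ s ≫ act N) (by
    rw [← Category.assoc, hi.act_casimirMap]
    simp only [Category.assoc, MonoidalCategory.whiskerLeft_comp]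
    rw [← whisker_exchange_assoc, mul_act, associator_naturality_right_assoc,
      Iso.inv_hom_id_assoc])

lemma IsCasimir.comp_average_comp {i : 𝟙_ C ⟶ A ⊗ A} (hi : IsCasimir i) {z : ℂ}
    (hz : i ≫ MonObj.mul = z • MonObj.one) {M N : Mod C A} (f : M ⟶ N) (g : N.X ⟶ M.X)
    (hg : f.hom ≫ g ≫ f.hom = f.hom) : f ≫ hi.average g ≫ f = z • f := by
  ext
  calc f.hom ≫ (casimirMap i N ≫ A ◁ g ≫ act M) ≫ f.hom
      = casimirMap i M ≫ A ◁ (f.hom ≫ g ≫ f.hom) ≫ act N := by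
        simp only [Category.assoc, MonoidalCategory.whiskerLeft_comp]
        rw [act_hom, reassoc_of% (casimirMap_naturality i f)]
    _ = casimirMap i M ≫ act M ≫ f.hom := by rw [hg, act_hom]
    _ = z • f.hom := by rw [reassoc_of% (casimirMap_act hz M), Linear.smul_comp, Category.id_comp]

lemma IsCasimir.allRegular_mod {i : 𝟙_ C ⟶ A ⊗ A} (hi : IsCasimir i) {z : ℂ} (hz0 : z ≠ 0)
    (hz : i ≫ MonObj.mul = z • MonObj.one) (hC : AllRegular C) : AllRegular (Mod C A) := by
  intro M N f
  obtain ⟨g, hg⟩ := hC f.hom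
  refine ⟨z⁻¹ • hi.average g, ?_⟩
  rw [Linear.smul_comp, Linear.comp_smul, hi.comp_average_comp hz f g hg, inv_smul_smul₀ hz0]

end Casimir

section Rigid

variable {C : Type u} [Category.{v} C] [MonoidalCategory C] [BraidedCategory C]

lemma coevaluation_braiding_evaluation_eq {X Y Z : C} (p : ExactPairing X Y)
    (q : ExactPairing X Z) :
    p.coevaluation' ≫ (β_ X Y).hom ≫ p.evaluation' =
      q.coevaluation' ≫ (β_ X Z).hom ≫ q.evaluation' := by
  let f : Y ⟶ Z := @rightAdjointMate C _ _ X X ⟨Z⟩ ⟨Y⟩ (𝟙 X)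
  have hη : p.coevaluation' ≫ X ◁ f = q.coevaluation' := by
    refine (@coevaluation_comp_rightAdjointMate C _ _ X X ⟨Z⟩ ⟨Y⟩ (𝟙 X)).trans ?_
    rw [MonoidalCategory.id_whiskerRight, Category.comp_id]
    rfl
  have hε : f ▷ X ≫ q.evaluation' = p.evaluation' := by
    refine (@rightAdjointMate_comp_evaluation C _ _ X X ⟨Z⟩ ⟨Y⟩ (𝟙 X)).trans ?_
    rw [MonoidalCategory.whiskerLeft_id, Category.id_comp]
    rfl
  rw [← hη, ← hε, Category.assoc, BraidedCategory.braiding_naturality_right_assoc]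

lemma IsRigidAlgebra.exists_casimir {C : Type u} [Category.{v} C] [Abelian C] [Linear ℂ C]
    [MonoidalCategory C] [BraidedCategory C] [RigidCategory C] [BalancedRigid C] {A : Mon C}
    [IsCommMonObj A.X] (hA : IsRigidAlgebra A) (hθ : theta A.X = 𝟙 A.X) :
    ∃ (i : 𝟙_ C ⟶ A.X ⊗ A.X) (z : ℂ), IsCasimir i ∧ z ≠ 0 ∧
      i ≫ MonObj.mul = z • MonObj.one := by
  obtain ⟨e, he, p, hp⟩ := hA.nondegenerate
  have hq : qdim A.X = p.coevaluation' ≫ MonObj.mul ≫ e := by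
    calc qdim A.X = η_ A.X (A.Xᘁ) ≫ (β_ A.X (A.Xᘁ)).hom ≫ ε_ A.X (A.Xᘁ) := by
          rw [qdim, hθ, MonoidalCategory.id_whiskerRight, Category.id_comp]
      _ = p.coevaluation' ≫ (β_ A.X A.X).hom ≫ p.evaluation' :=
        coevaluation_braiding_evaluation_eq inferInstance p
      _ = p.coevaluation' ≫ MonObj.mul ≫ e := by
        rw [hp, ← Category.assoc (β_ A.X A.X).hom, IsCommMonObj.mul_comm]
  have hone : (MonObj.one : 𝟙_ C ⟶ A.X) ≠ 0 := fun h0 => hA.qdim_ne_zero <| by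
    rw [← Category.id_comp (qdim A.X), ← he, h0, zero_comp, zero_comp]
  obtain ⟨z, hz⟩ := (finrank_eq_one_iff_of_nonzero' _ hone).mp hA.finrank_unit
    (p.coevaluation' ≫ MonObj.mul)
  refine ⟨p.coevaluation', z, .of_exactPairing p e hp, ?_, hz.symm⟩
  rintro rfl
  exact hA.qdim_ne_zero (by rw [hq, ← Category.assoc, ← hz, zero_smul, zero_comp])

end Rigid

/-! ### Simple modules -/

section SimpleModules

variable {C : Type u} [Category.{v} C] [MonoidalCategory C] [Preadditive C]
  [MonoidalPreadditive C]

section Semisimple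

variable [Linear ℂ C] [MonoidalLinear ℂ C]

instance {A : C} [MonObj A] [∀ X Y : C, FiniteDimensional ℂ (X ⟶ Y)] (M N : Mod C A) :
    FiniteDimensional ℂ (M ⟶ N) :=
  FiniteDimensional.of_injective (V₂ := M.X ⟶ N.X)
    { toFun := fun f : M ⟶ N => f.hom
      map_add' := fun _ _ => rfl
      map_smul' := fun _ _ => rfl } hom_injective

/-- Semisimplicity of `Rep A`, in the form of quasi-inverses, together with finiteness of its
spaces of morphisms. -/
structure IsSemisimpleAlg (A : Mon C) : Prop where
  finiteDimensional_hom : ∀ M N : Mod C A.X, FiniteDimensional ℂ (M ⟶ N)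
  allRegular : AllRegular (Mod C A.X)

end Semisimple

lemma IsRigidAlgebra.isSemisimpleAlg {C : Type u} [Category.{v} C] [Abelian C] [Linear ℂ C]
    [MonoidalCategory C] [MonoidalPreadditive C] [MonoidalLinear ℂ C] [BraidedCategory C]
    [RigidCategory C] [BalancedRigid C] (hC : IsSemisimpleCat C) {A : Mon C} [IsCommMonObj A.X]
    (hA : IsRigidAlgebra A) (hθ : theta A.X = 𝟙 A.X) : IsSemisimpleAlg A := by
  have := hC.finiteDimensional_hom
  obtain ⟨i, z, hi, hz0, hz⟩ := hA.exists_casimir hθ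
  exact ⟨inferInstance, hi.allRegular_mod hz0 hz hC.allRegular⟩

namespace Choice

variable {G : Type w} [Group G] {A : Mon C} {π : G →* Aut A} (c : Choice π)

lemma simple_X (s : SimpleClass π) : Simple (c.X s) := by
  obtain ⟨M, hM, h⟩ := s.2
  obtain ⟨e⟩ : Nonempty (c.X s ≅ M) :=
    Quotient.exact (s := isIsomorphicSetoid (Mod C A.X)) ((c.mk_X s).trans h.symm)
  exact Simple.of_iso e

lemma exists_iso_X (M : Mod C A.X) (hM : Simple M) :
    ∃ s : SimpleClass π, Nonempty (M ≅ c.X s) :=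
  let s : SimpleClass π := ⟨Quotient.mk (isIsomorphicSetoid (Mod C A.X)) M, M, hM, rfl⟩
  ⟨s, Quotient.exact (s := isIsomorphicSetoid (Mod C A.X)) (c.mk_X s).symm⟩

lemma eq_of_iso {s t : SimpleClass π} (e : c.X s ≅ c.X t) : s = t := by
  apply Subtype.ext
  rw [← c.mk_X s, ← c.mk_X t]
  exact Quotient.sound (s := isIsomorphicSetoid (Mod C A.X)) ⟨e⟩

lemma id_X_ne_zero (s : SimpleClass π) : 𝟙 (c.X s) ≠ 0 :=
  have := c.simple_X s
  id_nonzero _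

lemma id_X_hom_ne_zero (s : SimpleClass π) : 𝟙 (c.X s).X ≠ 0 := fun h =>
  c.id_X_ne_zero s (hom_injective h)

variable [Linear ℂ C] [MonoidalLinear ℂ C] [IsIdempotentComplete C] (hA : IsSemisimpleAlg A)
include hA

lemma hom_eq_zero {s t : SimpleClass π} (h : s ≠ t) (a : c.X s ⟶ c.X t) : a = 0 := by
  have := hA.allRegular.hasKernels
  have := c.simple_X s
  have := c.simple_X t
  by_contra h0
  have := isIso_of_hom_simple h0
  exact h (c.eq_of_iso (asIso a))

lemma exists_smul_id {s : SimpleClass π} (a : c.X s ⟶ c.X s) : ∃ z : ℂ, z • 𝟙 (c.X s) = a :=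
  have := hA.allRegular.hasKernels
  have := c.simple_X s
  have := hA.finiteDimensional_hom (c.X s) (c.X s)
  endomorphism_simple_eq_smul_id ℂ a

lemma exists_decomposition (M : Mod C A.X) : ∃ (ι : Type) (_ : Fintype ι) (s : ι → SimpleClass π)
    (p : ∀ k, M ⟶ c.X (s k)) (i : ∀ k, c.X (s k) ⟶ M), ∑ k, p k ≫ i k = 𝟙 M := by
  have := hA.finiteDimensional_hom
  obtain ⟨ι, _, S, p, i, hS, h⟩ := hA.allRegular.sumOfSimples M
  choose s e using fun k => c.exists_iso_X (S k) (hS k)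
  exact ⟨ι, inferInstance, s, fun k => p k ≫ (e k).some.hom, fun k => (e k).some.inv ≫ i k,
    by simpa using h⟩

lemma hom_ext_X {M : Mod C A.X} {Z : C} {x y : M.X ⟶ Z}
    (h : ∀ s (a : c.X s ⟶ M), a.hom ≫ x = a.hom ≫ y) : x = y := by
  obtain ⟨ι, _, s, p, i, hpi⟩ := c.exists_decomposition hA M
  have hM : ∑ k, (p k).hom ≫ (i k).hom = 𝟙 M.X :=
    (sum_hom _ _).symm.trans (congrArg Mod.Hom.hom hpi)
  rw [← Category.id_comp x, ← Category.id_comp y, ← hM]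
  simp only [Preadditive.sum_comp, Category.assoc, h]

lemma comp_apply {M N : Mod C A.X} (T : ∀ s, (c.X s ⟶ M) →ₗ[ℂ] (c.X s ⟶ N))
    {s t : SimpleClass π} (b : c.X s ⟶ c.X t) (a : c.X t ⟶ M) : b ≫ T t a = T s (b ≫ a) := by
  rcases eq_or_ne s t with rfl | h
  · obtain ⟨z, rfl⟩ := c.exists_smul_id hA b
    simp only [Linear.smul_comp, Category.id_comp, map_smul]
  · rw [c.hom_eq_zero hA h b, zero_comp, zero_comp, map_zero]

lemma existsUnique_hom {M N : Mod C A.X} (T : ∀ s, (c.X s ⟶ M) →ₗ[ℂ] (c.X s ⟶ N)) :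
    ∃! m : M ⟶ N, ∀ s a, a ≫ m = T s a := by
  obtain ⟨ι, _, s, p, i, hpi⟩ := c.exists_decomposition hA M
  refine ⟨∑ k, p k ≫ T _ (i k), fun t a => ?_, fun m hm => ?_⟩
  · calc a ≫ ∑ k, p k ≫ T _ (i k) = T t (∑ k, (a ≫ p k) ≫ i k) := by
          simp only [Preadditive.comp_sum, ← Category.assoc a, c.comp_apply hA T, map_sum]
      _ = T t a := by
          simp only [Category.assoc, ← Preadditive.comp_sum, hpi, Category.comp_id]
  · rw [← Category.id_comp m, ← hpi, Preadditive.sum_comp]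
    simp only [Category.assoc, hm]

end Choice

end SimpleModules

/-! ### The category `D` is abelian -/

namespace EquivMod

variable {C : Type u} [Category.{v} C] [MonoidalCategory C] {G : Type w} [Group G] {A : Mon C}
  {π : G →* Aut A}

lemma φ_comp_φ_inv (Y : EquivMod π) (g : G) : Y.φ g ≫ Y.φ g⁻¹ = 𝟙 _ := by
  rw [← Y.φ_mul, inv_mul_cancel, Y.φ_one]

/-- The object of `D` given by endomorphisms `φ g` of a module `K` with a jointly monic family of
morphisms to objects of `D` which commute with `φ`. -/
def lift {J : Type*} (K : Mod C A.X) (φ : G → (K.X ⟶ K.X)) (Y : J → EquivMod π)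
    (k : ∀ j, K ⟶ (Y j).M)
    (hk : ∀ ⦃Z : C⦄ (x y : Z ⟶ K.X), (∀ j, x ≫ (k j).hom = y ≫ (k j).hom) → x = y)
    (hφ : ∀ g j, φ g ≫ (k j).hom = (k j).hom ≫ (Y j).φ g) : EquivMod π where
  M := K
  φ := φ
  act_φ g := hk _ _ fun j => by
    simp only [Category.assoc]
    rw [hφ, act_hom, reassoc_of% (act_hom (k j)), (Y j).act_φ, ← id_tensorHom,
      tensorHom_comp_tensorHom_assoc, tensorHom_comp_tensorHom_assoc, hφ, Category.id_comp,
      Category.comp_id]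
  φ_mul g h := hk _ _ fun j => by
    simp only [Category.assoc]
    rw [hφ, hφ, reassoc_of% (hφ h j), (Y j).φ_mul]
  φ_one := hk _ _ fun j => by
    rw [hφ, (Y j).φ_one, Category.comp_id, Category.id_comp]

section Preadditive

variable [Preadditive C] [MonoidalPreadditive C]

lemma sum_hom {Y Z : EquivMod π} {J : Type*} (s : Finset J) (f : J → (Y ⟶ Z)) :
    (∑ j ∈ s, f j).hom = ∑ j ∈ s, (f j).hom :=
  map_sum (homAddHom Y Z) f s

instance [IsIdempotentComplete C] : IsIdempotentComplete (EquivMod π) where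
  idempotents_split Y p hp := by
    obtain ⟨K, i, e, hie, hei⟩ := IsIdempotentComplete.idempotents_split Y.M p.hom
      (congrArg Hom.hom hp)
    have hei' : e.hom ≫ i.hom = p.hom.hom := congrArg Mod.Hom.hom hei
    have hie' : i.hom ≫ e.hom = 𝟙 K.X := congrArg Mod.Hom.hom hie
    have hip : i.hom ≫ p.hom.hom = i.hom := by rw [← hei', reassoc_of% hie']
    have hpe : p.hom.hom ≫ e.hom = e.hom := by rw [← hei', Category.assoc, hie', Category.comp_id]
    have hi (g : G) : (i.hom ≫ Y.φ g ≫ e.hom) ≫ i.hom = i.hom ≫ Y.φ g := by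
      simp only [Category.assoc]
      rw [hei', p.comm, reassoc_of% hip]
    have he (g : G) : Y.φ g ≫ e.hom = e.hom ≫ i.hom ≫ Y.φ g ≫ e.hom := by
      rw [reassoc_of% hei', ← reassoc_of% (p.comm g), hpe]
    exact ⟨lift K (fun g => i.hom ≫ Y.φ g ≫ e.hom) (fun _ : Unit => Y) (fun _ => i)
      (fun _ x y h => by simpa [hie'] using congrArg (· ≫ e.hom) (h ())) (fun g _ => hi g),
      ⟨i, hi⟩, ⟨e, he⟩, hom_ext _ _ hie, hom_ext _ _ hei⟩

section Biproducts

variable [HasFiniteBiproducts C] {J : Type} [Fintype J] (f : J → EquivMod π)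

/-- The biproduct of finitely many objects of `D`, carried by `modBicone`. -/
def bicone : Bicone f :=
  let b : Bicone fun j => (f j).M := modBicone fun j => (f j).M
  let φ (g : G) : b.pt.X ⟶ b.pt.X := biproduct.map fun j => (f j).φ g
  have hπ (g : G) (j : J) : φ g ≫ (b.π j).hom = (b.π j).hom ≫ (f j).φ g := biproduct.map_π _ _
  have hι (g : G) (j : J) : (f j).φ g ≫ (b.ι j).hom = (b.ι j).hom ≫ φ g :=
    (biproduct.ι_map (fun j => (f j).φ g) j).symm
  { pt := lift b.pt φ f b.π (fun _ x y => biproduct.hom_ext x y) hπ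
    π j := ⟨b.π j, fun g => hπ g j⟩
    ι j := ⟨b.ι j, fun g => hι g j⟩
    ι_π i j := hom_ext _ _ <| (b.ι_π i j).trans <| by
      split_ifs with h
      · subst h
        rfl
      · rfl }

lemma bicone_total : ∑ j, (bicone f).π j ≫ (bicone f).ι j = 𝟙 (bicone f).pt :=
  hom_ext _ _ ((sum_hom _ _).trans (modBicone_total _))

instance : HasFiniteBiproducts (EquivMod π) :=
  hasFiniteBiproducts_of_total fun _ f => ⟨bicone f, bicone_total f⟩

end Biproducts

end Preadditive

/-- The conjugate `φ_Z(g)⁻¹ ∘ m ∘ φ_Y(g)` of a morphism of modules. -/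
def conjHom {Y Z : EquivMod π} (m : Y.M ⟶ Z.M) (g : G) : Y.M ⟶ Z.M :=
  mkHom (Y.φ g ≫ m.hom ≫ Z.φ g⁻¹) (by
    rw [reassoc_of% (Y.act_φ g), reassoc_of% (act_hom m), Z.act_φ, ← id_tensorHom,
      ← id_tensorHom, tensorHom_comp_tensorHom_assoc, tensorHom_comp_tensorHom_assoc,
      Category.comp_id, ← aut_mul_hom, inv_mul_cancel, aut_one_hom, Category.assoc])

lemma conjHom_hom {Y Z : EquivMod π} (m : Y.M ⟶ Z.M) (g : G) :
    (conjHom m g).hom = Y.φ g ≫ m.hom ≫ Z.φ g⁻¹ := rfl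

section Average

attribute [local instance] Fintype.ofFinite

variable [Preadditive C] [MonoidalPreadditive C] [Finite G]

/-- The sum of all conjugates of a morphism of modules, a morphism of `D`. -/
def sumConj {Y Z : EquivMod π} (m : Y.M ⟶ Z.M) : Y ⟶ Z where
  hom := ∑ g, conjHom m g
  comm h := by
    simp only [Orbifold.sum_hom, Preadditive.comp_sum, Preadditive.sum_comp, conjHom_hom]
    refine Fintype.sum_equiv (Equiv.mulRight h) _ _ fun g => ?_
    simp only [Equiv.coe_mulRight, Category.assoc, Y.φ_mul, mul_inv_rev, Z.φ_mul]
    rw [← Z.φ_mul h h⁻¹, mul_inv_cancel, Z.φ_one, Category.comp_id]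

lemma comp_sumConj_comp {Y Z : EquivMod π} (f : Y ⟶ Z) (m : Z.M ⟶ Y.M)
    (h : f.hom ≫ m ≫ f.hom = f.hom) : f ≫ sumConj m ≫ f = Nat.card G • f := by
  have h' : f.hom.hom ≫ m.hom ≫ f.hom.hom = f.hom.hom := congrArg Mod.Hom.hom h
  ext1
  change f.hom ≫ (∑ g, conjHom m g) ≫ f.hom = Nat.card G • f.hom
  rw [Preadditive.sum_comp, Preadditive.comp_sum, Nat.card_eq_fintype_card]
  refine Finset.sum_eq_card_nsmul fun g _ => Orbifold.hom_injective ?_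
  simp only [Mod.comp_hom', conjHom_hom, Category.assoc]
  rw [f.comm, ← reassoc_of% (f.comm g), reassoc_of% h', ← f.comm,
    reassoc_of% (φ_comp_φ_inv Y g)]

lemma allRegular [Linear ℂ C] [MonoidalLinear ℂ C] (h : AllRegular (Mod C A.X)) :
    AllRegular (EquivMod π) := fun Y Z f => by
  obtain ⟨m, hm⟩ := h f.hom
  refine ⟨(Nat.card G : ℂ)⁻¹ • sumConj m, ?_⟩
  rw [Linear.smul_comp, Linear.comp_smul, comp_sumConj_comp f m hm, ← Nat.cast_smul_eq_nsmul ℂ,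
    inv_smul_smul₀ (Nat.cast_ne_zero.mpr Nat.card_pos.ne')]

end Average

end EquivMod

/-! ### The cocycle of the projective action -/

namespace Choice

variable {C : Type u} [Category.{v} C] [MonoidalCategory C] [Preadditive C]
  [MonoidalPreadditive C] {G : Type w} [Group G] {A : Mon C} {π : G →* Aut A} {c : Choice π}

lemma act_f (g : G) {s t : SimpleClass π} (h : g • s = t) :
    act (c.X s) ≫ c.f g h = ((π g).hom.hom ⊗ₘ c.f g h) ≫ act (c.X t) := by
  have : ((π g⁻¹).hom.hom ▷ (c.X s).X ≫ act (c.X s)) ≫ c.f g h = A.X ◁ c.f g h ≫ act (c.X t) :=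
    act_hom (c.iso g h).hom
  rw [MonoidalCategory.tensorHom_def, Category.assoc, ← this, Category.assoc,
    ← comp_whiskerRight_assoc, ← aut_mul_hom, inv_mul_cancel, aut_one_hom, id_whiskerRight,
    Category.id_comp]

lemma act_finv (g : G) {s t : SimpleClass π} (h : g • s = t) :
    act (c.X t) ≫ c.finv g h = ((π g⁻¹).hom.hom ⊗ₘ c.finv g h) ≫ act (c.X s) := by
  rw [MonoidalCategory.tensorHom_def', Category.assoc]
  exact act_hom (c.iso g h).inv

lemma f_ne_zero (g : G) {s t : SimpleClass π} (h : g • s = t) : c.f g h ≠ 0 := fun h0 =>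
  c.id_X_hom_ne_zero s (by rw [← c.f_finv g h, h0, zero_comp])

lemma f_congr {g g' : G} (hg : g = g') {s t : SimpleClass π} (h : g • s = t)
    (h' : g' • s = t) : c.f g h = c.f g' h' := by
  subst hg
  rfl

variable [Linear ℂ C]

lemma smul_f_injective {g : G} {s t : SimpleClass π} {h : g • s = t} {a b : ℂˣ}
    (hab : (a : ℂ) • c.f g h = (b : ℂ) • c.f g h) : a = b :=
  Units.ext (smul_left_injective ℂ (c.f_ne_zero g h) hab)

lemma IsCocycle.unique {α α' : Cocycle G (SimpleClass π)} (h : c.IsCocycle α)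
    (h' : c.IsCocycle α') : α' = α := by
  ext g k r : 4
  have hs := smul_inv_smul k (g⁻¹ • r)
  have hr := smul_inv_smul g r
  exact smul_f_injective ((h' g k _ _ r hs hr).symm.trans (h g k _ _ r hs hr))

lemma IsCocycle.f_one {α : Cocycle G (SimpleClass π)} (hα : c.IsCocycle α)
    {s : SimpleClass π} (h : (1 : G) • s = s) :
    c.f 1 h = ((α.toFun 1 1 s : ℂˣ) : ℂ) • 𝟙 _ := by
  apply c.f_cancel 1 h
  have f_comp_f_one := hα 1 1 s s s h h
  simp only [mul_one] at f_comp_f_one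
  rw [f_comp_f_one, Linear.comp_smul, Category.comp_id]

variable [MonoidalLinear ℂ C] [IsIdempotentComplete C] (hA : IsSemisimpleAlg A)
include hA

lemma exists_eq_smul_f {g : G} {s t : SimpleClass π} (h : g • s = t) (a : (c.X s).X ⟶ (c.X t).X)
    (ha : act (c.X s) ≫ a = ((π g).hom.hom ⊗ₘ a) ≫ act (c.X t)) :
    ∃ z : ℂ, a = z • c.f g h := by
  obtain ⟨z, hz⟩ := c.exists_smul_id hA (mkHom (M := c.X s) (N := c.X s) (a ≫ c.finv g h) (by
    rw [reassoc_of% ha, c.act_finv, tensorHom_comp_tensorHom_assoc, ← aut_mul_hom, inv_mul_cancel,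
      aut_one_hom, id_tensorHom]))
  have hz' : z • 𝟙 (c.X s).X = a ≫ c.finv g h := congrArg Mod.Hom.hom hz
  refine ⟨z, ?_⟩
  rw [← Category.id_comp (c.f g h), ← Linear.smul_comp, hz', Category.assoc, c.finv_f,
    Category.comp_id]

lemma exists_unit (g h : G) {s t r : SimpleClass π} (hst : h • s = t) (htr : g • t = r) :
    ∃ z : ℂˣ, c.f h hst ≫ c.f g htr =
      (z : ℂ) • c.f (g * h) (by rw [mul_smul, hst, htr] : (g * h) • s = r) := by
  obtain ⟨z, hz⟩ := exists_eq_smul_f hA (by rw [mul_smul, hst, htr] : (g * h) • s = r)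
    (c.f h hst ≫ c.f g htr) (by
      rw [reassoc_of% (c.act_f h hst), c.act_f g htr, tensorHom_comp_tensorHom_assoc,
        ← aut_mul_hom])
  have hz0 : z ≠ 0 := fun h0 => c.f_ne_zero g htr (c.f_cancel h hst (by
    rw [hz, h0, zero_smul, comp_zero]))
  exact ⟨Units.mk0 z hz0, hz⟩

lemma exists_cocycle (c : Choice π) : ∃ α : Cocycle G (SimpleClass π), c.IsCocycle α := by
  choose α hα using fun (g h : G) (r : SimpleClass π) =>
    exists_unit (c := c) hA g h (smul_inv_smul h (g⁻¹ • r)) (smul_inv_smul g r)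
  have f_comp_f (g h : G) (s t r : SimpleClass π) (hst : h • s = t) (htr : g • t = r) :
      c.f h hst ≫ c.f g htr =
        ((α g h r : ℂˣ) : ℂ) • c.f (g * h) (by rw [mul_smul, hst, htr] : (g * h) • s = r) := by
    obtain rfl : t = g⁻¹ • r := by rw [← htr, inv_smul_smul]
    obtain rfl : s = h⁻¹ • g⁻¹ • r := by rw [← hst, inv_smul_smul]
    exact hα g h r
  refine ⟨⟨α, fun g h k r => ?_⟩, f_comp_f⟩
  have g_smul : g • g⁻¹ • r = r := smul_inv_smul _ _
  have h_smul : h • h⁻¹ • g⁻¹ • r = g⁻¹ • r := smul_inv_smul _ _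
  have k_smul : k • k⁻¹ • h⁻¹ • g⁻¹ • r = h⁻¹ • g⁻¹ • r := smul_inv_smul _ _
  have ghk_smul : (g * (h * k)) • k⁻¹ • h⁻¹ • g⁻¹ • r = r := by simp only [mul_smul, smul_inv_smul]
  have assoc := f_comp_f h k _ _ _ k_smul h_smul =≫ c.f g g_smul
  rw [Category.assoc, f_comp_f g h, Linear.comp_smul, f_comp_f, Linear.smul_comp, f_comp_f,
    smul_smul (_ : ℂ), smul_smul (_ : ℂ), c.f_congr (mul_assoc g h k) _ ghk_smul, ← Units.val_mul,
    ← Units.val_mul] at assoc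
  exact (smul_f_injective assoc).symm

end Choice

/-! ### Realization of projective families -/

open MulAction in
lemma finite_orbit {G T : Type*} [Group G] [Finite G] [MulAction G T]
    (o : orbitRel.Quotient G T) : Finite o.orbit := by
  induction o using Quotient.inductionOn' with
  | h a => exact Set.finite_range _

lemma finrank_hom_biproduct {k D J : Type*} [Field k] [Category* D] [Preadditive D] [Linear k D]
    [Fintype J] (X : D) (Y : J → D) [HasBiproduct Y] [∀ j, FiniteDimensional k (X ⟶ Y j)] :
    Module.finrank k (X ⟶ ⨁ Y) = ∑ j, Module.finrank k (X ⟶ Y j) := by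
  let e : (X ⟶ ⨁ Y) ≃ₗ[k] (∀ j, X ⟶ Y j) :=
    { toFun a j := a ≫ biproduct.π Y j
      invFun b := biproduct.lift b
      left_inv a := biproduct.hom_ext _ _ fun j => biproduct.lift_π _ _
      right_inv b := funext fun j => biproduct.lift_π _ _
      map_add' a b := funext fun j => Preadditive.add_comp _ _ _ _ _ _
      map_smul' z a := funext fun j => Linear.smul_comp _ _ _ _ _ _ }
  rw [e.finrank_eq, Module.finrank_pi_fintype]

/-- A projective action on a family of vector spaces indexed by the elements of the orbits of a
`G`-set: maps `V_s → V_{gs}` that compose up to the inverse of the cocycle `α`. -/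
structure ProjectiveFamily {G : Type*} {T : Type*} [Group G] [MulAction G T] (α : Cocycle G T)
    (V : ∀ o : MulAction.orbitRel.Quotient G T, o.orbit → Type*) [∀ o s, AddCommGroup (V o s)]
    [∀ o s, Module ℂ (V o s)] where
  ψ : ∀ o (g : G) {s t : o.orbit} (_ : g • s = t), V o s →ₗ[ℂ] V o t
  ψ_mul : ∀ o (g h : G) {s t r : o.orbit} (hst : h • s = t) (htr : g • t = r) (x : V o s),
    ψ o g htr (ψ o h hst x) = (((α.toFun g h r)⁻¹ : ℂˣ) : ℂ) •
      ψ o (g * h) (by rw [mul_smul, hst, htr] : (g * h) • s = r) x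
  ψ_one : ∀ o {s : o.orbit} (h : (1 : G) • s = s) (x : V o s),
    ψ o 1 h x = (((α.toFun 1 1 s)⁻¹ : ℂˣ) : ℂ) • x

section Realization

variable {C : Type u} [Category.{v} C] [MonoidalCategory C] {G : Type w} [Group G] {A : Mon C}
  {π : G →* Aut A}

/-- The object of `D` given by morphisms `φ g : M ⟶ M^g` of modules. -/
def EquivMod.ofTwistBy (M : Mod C A.X) (φ : ∀ g, M ⟶ (twistBy π g).obj M)
    (φ_mul : ∀ g h, (φ (g * h)).hom = (φ h).hom ≫ (φ g).hom) (φ_one : (φ 1).hom = 𝟙 M.X) :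
    EquivMod π where
  M := M
  φ g := (φ g).hom
  act_φ g := (act_hom (φ g)).trans
    (MonoidalCategory.tensorHom_def'_assoc (π g).hom.hom (Y₂ := M.X) (φ g).hom (act M)).symm
  φ_mul := φ_mul
  φ_one := φ_one

namespace Choice

variable [Preadditive C] [MonoidalPreadditive C] {c : Choice π} [Linear ℂ C] [MonoidalLinear ℂ C]

/-- The morphism `X_s ⟶ M^g` given by `φ_s(g)` and a morphism `X_{gs} ⟶ M`. -/
def twistHom (c : Choice π) (g : G) {s t : SimpleClass π} (h : g • s = t) (M : Mod C A.X) :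
    (c.X t ⟶ M) →ₗ[ℂ] (c.X s ⟶ (twistBy π g).obj M) where
  toFun b := mkHom (M := c.X s) (N := (twistBy π g).obj M) (c.f g h ≫ b.hom) (by
    change act (c.X s) ≫ c.f g h ≫ b.hom =
      A.X ◁ (c.f g h ≫ b.hom) ≫ (π g).hom.hom ▷ M.X ≫ act M
    rw [reassoc_of% (c.act_f g h), act_hom, ← id_tensorHom, ← id_tensorHom, ← tensorHom_id,
      tensorHom_comp_tensorHom_assoc, tensorHom_comp_tensorHom_assoc, Category.comp_id,
      Category.comp_id, Category.id_comp])
  map_add' b b' := by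
    ext
    exact Preadditive.comp_add _ _ _ _ _ _
  map_smul' z b := by
    ext
    exact Linear.comp_smul _ _ _ _ _ _

variable [IsIdempotentComplete C] (hA : IsSemisimpleAlg A)
include hA

open scoped Classical in
lemma finrank_hom_X (s t : SimpleClass π) :
    Module.finrank ℂ (c.X s ⟶ c.X t) = if s = t then 1 else 0 := by
  split_ifs with h
  · subst h
    have := c.simple_X s
    have := hA.allRegular.hasKernels
    have := hA.finiteDimensional_hom (c.X s) (c.X s)
    exact finrank_endomorphism_simple_eq_one ℂ (c.X s)
  · have : Subsingleton (c.X s ⟶ c.X t) :=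
      ⟨fun a b => by rw [c.hom_eq_zero hA h a, c.hom_eq_zero hA h b]⟩
    exact Module.finrank_zero_of_subsingleton

lemma exists_finrank_hom_eq [HasFiniteBiproducts C] (c : Choice π) (d : SimpleClass π →₀ ℕ) :
    ∃ M : Mod C A.X, ∀ s, Module.finrank ℂ (c.X s ⟶ M) = d s := by
  classical
  have := hA.finiteDimensional_hom
  refine ⟨⨁ fun k : Σ s : d.support, Fin (d s) => c.X k.1, fun s => ?_⟩
  calc Module.finrank ℂ (c.X s ⟶ ⨁ fun k : Σ s : d.support, Fin (d s) => c.X k.1)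
      = ∑ t ∈ d.support, if s = t then d t else 0 := by
        rw [finrank_hom_biproduct, Fintype.sum_sigma,
          ← Finset.sum_coe_sort d.support fun t => if s = t then d t else 0]
        simp only [finrank_hom_X hA, Finset.sum_const, Finset.card_univ, Fintype.card_fin,
          smul_eq_mul, mul_ite, mul_one, mul_zero]
    _ = d s := by
        rw [Finset.sum_ite_eq, Finsupp.if_mem_support]

open MulAction

lemma existsUnique_hom_orbit (c : Choice π) (M N : Mod C A.X)
    (T : ∀ (o : orbitRel.Quotient G (SimpleClass π)) (s : o.orbit),
      (c.X s ⟶ M) →ₗ[ℂ] (c.X s ⟶ N)) :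
    ∃! m : M ⟶ N, ∀ o (s : o.orbit) (a : c.X s ⟶ M), a ≫ m = T o s a := by
  obtain ⟨m, hm, hu⟩ := c.existsUnique_hom hA fun s =>
    T (Quotient.mk'' s) ⟨s, orbitRel.Quotient.mem_orbit.mpr rfl⟩
  refine ⟨m, ?_, fun m' hm' => hu m' fun s a => hm' _ ⟨s, _⟩ a⟩
  rintro o ⟨s, hs⟩ a
  obtain rfl := orbitRel.Quotient.mem_orbit.mp hs
  exact hm s a

lemma hom_ext_X_orbit (c : Choice π) {M : Mod C A.X} {Z : C} {x y : M.X ⟶ Z}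
    (h : ∀ (o : orbitRel.Quotient G (SimpleClass π)) (s : o.orbit) (a : c.X s ⟶ M),
      a.hom ≫ x = a.hom ≫ y) : x = y :=
  c.hom_ext_X hA fun s a => h (Quotient.mk'' s) ⟨s, orbitRel.Quotient.mem_orbit.mpr rfl⟩ a

section Families

variable {V : ∀ o : orbitRel.Quotient G (SimpleClass π), o.orbit → Type*}
  [∀ o s, AddCommGroup (V o s)] [∀ o s, Module ℂ (V o s)]

lemma exists_module_linearEquiv_orbit [HasFiniteBiproducts C] [Finite G] (c : Choice π)
    [∀ o s, FiniteDimensional ℂ (V o s)] (hV : {o | ∃ s, Nontrivial (V o s)}.Finite) :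
    ∃ M : Mod C A.X, ∀ o (s : o.orbit), Nonempty (V o s ≃ₗ[ℂ] (c.X s ⟶ M)) := by
  have := hA.finiteDimensional_hom
  let d (s : SimpleClass π) : ℕ :=
    Module.finrank ℂ (V (Quotient.mk'' s) ⟨s, orbitRel.Quotient.mem_orbit.mpr rfl⟩)
  have hd : (Function.support d).Finite := by
    refine (hV.biUnion fun o _ => @Set.toFinite _ o.orbit (finite_orbit o)).subset fun s hs => ?_
    exact Set.mem_biUnion (x := Quotient.mk'' s)
      ⟨_, Module.nontrivial_of_finrank_pos (Nat.pos_of_ne_zero hs)⟩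
      (orbitRel.Quotient.mem_orbit.mpr rfl)
  obtain ⟨M, hM⟩ := exists_finrank_hom_eq hA c (Finsupp.ofSupportFinite d hd)
  refine ⟨M, fun o ⟨s, hs⟩ => ?_⟩
  obtain rfl := orbitRel.Quotient.mem_orbit.mp hs
  exact ⟨LinearEquiv.ofFinrankEq _ _ (hM s).symm⟩

variable {α : Cocycle G (SimpleClass π)}

lemma exists_hom_twistBy (c : Choice π) {M : Mod C A.X}
    (i : ∀ (o : orbitRel.Quotient G (SimpleClass π)) (s : o.orbit), V o s ≃ₗ[ℂ] (c.X s ⟶ M))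
    (P : ProjectiveFamily α V) (g : G) :
    ∃ m : M ⟶ (twistBy π g).obj M, ∀ o (s t : o.orbit) (h : g • s = t) (x : V o s),
      (i o s x).hom ≫ m.hom = c.f g (orbit_smul h) ≫ (i o t (P.ψ o g h x)).hom := by
  obtain ⟨m, hm, -⟩ := existsUnique_hom_orbit hA c M ((twistBy π g).obj M) fun o s =>
    c.twistHom g (orbit_smul (rfl : g • s = g • s)) M ∘ₗ (i o (g • s)).toLinearMap ∘ₗ
      P.ψ o g rfl ∘ₗ (i o s).symm.toLinearMap
  refine ⟨m, ?_⟩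
  rintro o s _ rfl x
  refine (congrArg Mod.Hom.hom (hm o s (i o s x))).trans ?_
  simp only [LinearMap.comp_apply, LinearEquiv.coe_coe, LinearEquiv.symm_apply_apply]
  rfl

variable [HasFiniteBiproducts C] [Finite G]

lemma IsCocycle.realize (hα : c.IsCocycle α) [∀ o s, FiniteDimensional ℂ (V o s)]
    (hV : {o | ∃ s, Nontrivial (V o s)}.Finite) (P : ProjectiveFamily α V) :
    ∃ (Y : EquivMod π) (i : ∀ (o : orbitRel.Quotient G (SimpleClass π)) (s : o.orbit),
        V o s ≃ₗ[ℂ] (c.X s ⟶ Y.M)),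
      ∀ o (g : G) (s t : o.orbit) (h : g • s = t) (x : V o s),
        i o t (P.ψ o g h x) = c.conj Y g (orbit_smul h) (i o s x) := by
  obtain ⟨M, hM⟩ := exists_module_linearEquiv_orbit hA c hV
  let i o s := (hM o s).some
  choose m hm using exists_hom_twistBy hA c i P
  let φ (g : G) : M.X ⟶ M.X := (m g).hom
  have hφ {o} (g : G) {s t : o.orbit} (h : g • s = t) (x : V o s) :
      (i o s x).hom ≫ φ g = c.f g (orbit_smul h) ≫ (i o t (P.ψ o g h x)).hom := hm g o s t h x
  have ext {x y : M.X ⟶ M.X} (h : ∀ o s (a : V o s), (i o s a).hom ≫ x = (i o s a).hom ≫ y) :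
      x = y := hom_ext_X_orbit hA c fun o s a => by
    simpa only [LinearEquiv.apply_symm_apply] using h o s ((i o s).symm a)
  have φ_mul (g h : G) : φ (g * h) = φ h ≫ φ g := ext fun o s x => by
    have hgh : (g * h) • s = g • h • s := mul_smul g h s
    rw [hφ _ hgh, reassoc_of% (hφ h rfl x), hφ g rfl, P.ψ_mul, map_smul, Orbifold.smul_hom,
      Linear.comp_smul, Linear.comp_smul, ← Category.assoc,
      hα g h s _ _ (orbit_smul rfl) (orbit_smul rfl), Linear.smul_comp, smul_smul (_ : ℂ),
      Units.inv_mul, one_smul]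
  have φ_one : φ 1 = 𝟙 M.X := ext fun o s x => by
    rw [hφ 1 (one_smul _ _), P.ψ_one, map_smul, hα.f_one, Orbifold.smul_hom, Linear.comp_smul,
      Linear.smul_comp, smul_smul (_ : ℂ), Units.inv_mul, one_smul, Category.id_comp,
      Category.comp_id]
  refine ⟨.ofTwistBy M m φ_mul φ_one, i, fun o g s t h x => ?_⟩
  ext
  apply c.f_cancel g (orbit_smul h)
  rw [f_conj]
  exact (hφ g h x).symm

end Families

end Choice

end Realization

/-! ### Modules over twisted algebras -/

namespace TwistedAlg

attribute [local instance] Fintype.ofFinite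

variable {G T : Type*} [Group G] [MulAction G T] {α : Cocycle G T}

lemma sum_coeff {J : Type*} (F : Finset J) (x : J → TwistedAlg α) (k : G) (t : T) :
    (∑ j ∈ F, x j).coeff k t = ∑ j ∈ F, (x j).coeff k t :=
  map_sum (G := TwistedAlg α →+ ℂ)
    { toFun := fun y => y.coeff k t
      map_zero' := rfl
      map_add' := fun _ _ => rfl } x F

lemma sum_delta [Fintype T] : ∑ t, delta α t = 1 := by
  classical
  ext k r
  rw [sum_coeff, one_def]
  by_cases hk : k = 1
  · simp [delta, ofFun, hk]
  · simp [delta, ofFun, hk]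

variable [Finite G]

lemma u_one_mul_delta (s : T) :
    u α 1 * delta α s = ((α.toFun 1 1 s : ℂˣ) : ℂ) • delta α s := by
  have u_one : u α 1 = ofFun α fun t => ((α.toFun 1 1 t : ℂˣ) : ℂ) := by
    ext k t
    by_cases hk : k = 1 <;> simp [u, ofFun, hk]
  ext k t
  rw [u_one, ofFun_mul_coeff, smul_coeff]
  by_cases ht : t = s
  · rw [ht]
  · simp [delta, ofFun, ht]

lemma u_mul_u_coeff (g h k : G) (t : T) [Decidable (k = g * h)] :
    (u α g * u α h).coeff k t = if k = g * h then ((α.toFun g h t : ℂˣ) : ℂ) else 0 := by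
  rw [mul_coeff, Finset.sum_eq_single g]
  · by_cases hk : k = g * h
    · subst hk
      simp [u]
    · have : g⁻¹ * k ≠ h := fun e => hk (by rw [← e, mul_inv_cancel_left])
      simp [u, hk, this]
  · intro k' _ hk'
    simp [u, hk']
  · simp

lemma u_mul_u_mul_delta (g h : G) (s : T) :
    u α g * u α h * delta α s =
      ((α.toFun g h ((g * h) • s) : ℂˣ) : ℂ) • (u α (g * h) * delta α s) := by
  classical
  ext k t
  rw [smul_coeff, delta, mul_ofFun_coeff, mul_ofFun_coeff, u_mul_u_coeff]
  by_cases hk : k = g * h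
  · subst hk
    by_cases ht : (g * h)⁻¹ • t = s
    · obtain rfl : t = (g * h) • s := by rw [← ht, smul_inv_smul]
      simp [u]
    · rw [if_neg ht, mul_zero, mul_zero, mul_zero]
  · simp [u, hk]

open scoped Classical in
lemma delta_mul_delta (s t : T) : delta α s * delta α t = if s = t then delta α t else 0 := by
  ext k r
  rw [delta, ofFun_mul_coeff]
  by_cases hst : s = t
  · subst hst
    by_cases hr : r = s <;> simp [delta, ofFun, hr]
  · by_cases hr : r = s <;> simp [delta, ofFun, hst, hr]

lemma eq_sum [Fintype T] (x : TwistedAlg α) :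
    x = ∑ g, ∑ t, x.coeff g t • (delta α t * u α g) := by
  classical
  ext k r
  have coeff_term (g : G) (t : T) : (x.coeff g t • (delta α t * u α g)).coeff k r =
      x.coeff g t * ((if r = t then 1 else 0) * (if k = g then 1 else 0)) := by
    rw [smul_coeff, delta, ofFun_mul_coeff]
    simp only [u]
  simp only [sum_coeff, coeff_term]
  rw [Finset.sum_eq_single k, Finset.sum_eq_single r]
  · simp
  · intro t _ ht
    simp [ht.symm]
  · simp
  · intro g _ hg
    simp [hg.symm]
  · simp

end TwistedAlg

section Components

open scoped ModuleCat
open TwistedAlg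

variable {G T : Type*} [Group G] [MulAction G T] [Finite G] {α : Cocycle G T}
  {V W : ModuleCat.{w} (TwistedAlg α)}

lemma mem_component {s : T} {x : V} : x ∈ component V s ↔ delta α s • x = x := Iff.rfl

lemma componentAct_componentAct (V : ModuleCat.{w} (TwistedAlg α)) (g h : G) {s t r : T}
    (hst : h • s = t) (htr : g • t = r) (x : component V s) :
    componentAct V g htr (componentAct V h hst x) = ((α.toFun g h r : ℂˣ) : ℂ) •
      componentAct V (g * h) (by rw [mul_smul, hst, htr] : (g * h) • s = r) x := by
  have hr : (g * h) • s = r := by rw [mul_smul, hst, htr]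
  apply Subtype.ext
  change u α g • u α h • (x : V) = _ • u α (g * h) • (x : V)
  rw [← mem_component.mp x.2, ← mul_smul, ← mul_smul, ← mul_smul, u_mul_u_mul_delta, hr,
    smul_assoc]

lemma componentAct_one (V : ModuleCat.{w} (TwistedAlg α)) {s : T} (h : (1 : G) • s = s)
    (x : component V s) : componentAct V 1 h x = ((α.toFun 1 1 s : ℂˣ) : ℂ) • x := by
  have hx : delta α s • (x : V) = x := x.2
  apply Subtype.ext
  change u α 1 • (x : V) = _ • (x : V)
  conv_lhs => rw [← hx]
  rw [← mul_smul, u_one_mul_delta, smul_assoc, hx]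

/-- The projection of `V` onto its component `V_s`. -/
def componentProj (V : ModuleCat.{w} (TwistedAlg α)) (s : T) : V →ₗ[ℂ] component V s where
  toFun x := ⟨delta α s • x, by
    classical
    rw [mem_component, ← mul_smul, delta_mul_delta, if_pos rfl]⟩
  map_add' x y := Subtype.ext (smul_add _ _ _)
  map_smul' z x := Subtype.ext (smul_comm _ _ _)

lemma coe_componentProj (s : T) (x : V) : (componentProj V s x : V) = delta α s • x := rfl

lemma componentProj_u_smul (g : G) {s t : T} (h : g • s = t) (x : V) :
    componentProj V t (u α g • x) = componentAct V g h (componentProj V s x) := by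
  apply Subtype.ext
  change delta α t • u α g • x = u α g • delta α s • x
  rw [← mul_smul, ← mul_smul, u_mul_delta, h]

open scoped Classical in
lemma componentProj_delta_smul (s t : T) (x : V) :
    componentProj V t (delta α s • x) = if t = s then componentProj V t x else 0 := by
  apply Subtype.ext
  rw [coe_componentProj, ← mul_smul, delta_mul_delta]
  split_ifs with h
  · subst h
    rfl
  · rw [zero_smul, ZeroMemClass.coe_zero]

lemma componentProj_coe (s : T) (x : component V s) : componentProj V s x = x :=
  Subtype.ext x.2

lemma componentProj_coe_of_ne {s t : T} (h : t ≠ s) (x : component V s) :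
    componentProj V t x = 0 := by
  classical
  rw [← mem_component.mp x.2, componentProj_delta_smul, if_neg h]

lemma sum_componentProj [Fintype T] (x : V) : ∑ s, (componentProj V s x : V) = x := by
  simp only [coe_componentProj]
  rw [← Finset.sum_smul, sum_delta, one_smul]

lemma componentProj_ext [Finite T] {x y : V}
    (h : ∀ s, componentProj V s x = componentProj V s y) : x = y := by
  have := Fintype.ofFinite T
  rw [← sum_componentProj x, ← sum_componentProj y]
  simp only [h]

lemma componentMap_componentProj (m : V ⟶ W) (s : T) (x : V) :
    componentMap m s (componentProj V s x) = componentProj W s (m.hom x) :=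
  Subtype.ext (m.hom.map_smul _ _)

lemma componentMap_componentAct (m : V ⟶ W) (g : G) {s t : T} (h : g • s = t)
    (x : component V s) :
    componentMap m t (componentAct V g h x) = componentAct W g h (componentMap m s x) :=
  Subtype.ext (m.hom.map_smul _ _)

lemma componentMap_comp {U : ModuleCat.{w} (TwistedAlg α)} (m : U ⟶ V) (n : V ⟶ W) (s : T)
    (x : component U s) : componentMap (m ≫ n) s x = componentMap n s (componentMap m s x) := rfl

lemma componentMap_id (s : T) (x : component V s) : componentMap (𝟙 V) s x = x := rfl

/-- An isomorphism of representations induces isomorphisms of their components. -/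
def componentIso (e : V ≅ W) (s : T) : component V s ≃ₗ[ℂ] component W s :=
  LinearEquiv.ofLinearMap (componentMap e.hom s) (componentMap e.inv s)
    (LinearMap.ext fun x => by
      change componentMap (e.inv ≫ e.hom) s x = x
      rw [e.inv_hom_id, componentMap_id])
    (LinearMap.ext fun x => by
      change componentMap (e.hom ≫ e.inv) s x = x
      rw [e.hom_inv_id, componentMap_id])

variable [Finite T]

lemma hom_ext_component {m m' : V ⟶ W} (h : ∀ s x, componentMap m s x = componentMap m' s x) :
    m = m' := by
  ext x
  refine componentProj_ext fun s => ?_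
  rw [← componentMap_componentProj, ← componentMap_componentProj, h]

lemma map_smul_of_generators (L : V →ₗ[ℂ] W) (hu : ∀ g x, L (u α g • x) = u α g • L x)
    (hd : ∀ s x, L (delta α s • x) = delta α s • L x) (a : TwistedAlg α) (x : V) :
    L (a • x) = a • L x := by
  have := Fintype.ofFinite G
  have := Fintype.ofFinite T
  rw [a.eq_sum]
  simp only [Finset.sum_smul, map_sum, smul_assoc, map_smul, mul_smul, hu, hd]

lemma exists_hom_of_component (L : ∀ s, component V s →ₗ[ℂ] component W s)
    (hL : ∀ (g : G) (s t : T) (h : g • s = t) (x : component V s),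
      L t (componentAct V g h x) = componentAct W g h (L s x)) :
    ∃ m : V ⟶ W, ∀ s, componentMap m s = L s := by
  classical
  have := Fintype.ofFinite T
  let M : V →ₗ[ℂ] W := ∑ s, (component W s).subtype ∘ₗ L s ∘ₗ componentProj V s
  have hM (x : V) (s : T) : componentProj W s (M x) = L s (componentProj V s x) := by
    simp only [M, LinearMap.sum_apply, LinearMap.comp_apply, Submodule.subtype_apply, map_sum]
    rw [Finset.sum_eq_single s, componentProj_coe]
    · exact fun t _ ht => componentProj_coe_of_ne ht.symm _
    · exact fun h => absurd (Finset.mem_univ s) h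
  have M_u (g : G) (x : V) : M (u α g • x) = u α g • M x := componentProj_ext fun t => by
    have ht := smul_inv_smul g t
    rw [hM, componentProj_u_smul g ht, componentProj_u_smul g ht, hM, hL]
  have M_delta (s : T) (x : V) : M (delta α s • x) = delta α s • M x :=
    componentProj_ext fun t => by
      rw [hM, componentProj_delta_smul, componentProj_delta_smul]
      split_ifs
      · rw [hM]
      · rw [map_zero]
  refine ⟨ModuleCat.ofHom
    { toFun := M
      map_add' := M.map_add
      map_smul' := map_smul_of_generators M M_u M_delta }, fun s => LinearMap.ext fun x => ?_⟩
  rw [← componentProj_coe s x, componentMap_componentProj]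
  exact hM _ s

lemma nonempty_iso_of_component (e : ∀ s, component V s ≃ₗ[ℂ] component W s)
    (he : ∀ (g : G) (s t : T) (h : g • s = t) (x : component V s),
      e t (componentAct V g h x) = componentAct W g h (e s x)) : Nonempty (V ≅ W) := by
  obtain ⟨m, hm⟩ := exists_hom_of_component (fun s => (e s).toLinearMap) he
  obtain ⟨n, hn⟩ := exists_hom_of_component (fun s => (e s).symm.toLinearMap) fun g s t h x => by
    simp only [LinearEquiv.coe_coe]
    rw [LinearEquiv.symm_apply_eq, he, LinearEquiv.apply_symm_apply]
  refine ⟨⟨m, n, hom_ext_component fun s x => ?_, hom_ext_component fun s x => ?_⟩⟩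
  · rw [componentMap_comp, hm, hn, componentMap_id]
    exact (e s).symm_apply_apply x
  · rw [componentMap_comp, hm, hn, componentMap_id]
    exact (e s).apply_symm_apply x

end Components

/-! ### The functor to representations of the algebras of the orbits -/

namespace Choice

open MulAction
open scoped ModuleCat

attribute [local instance] Fintype.ofFinite

variable {C : Type u} [Category.{v} C] [MonoidalCategory C] [Preadditive C]
  [MonoidalPreadditive C] {G : Type w} [Group G] {A : Mon C} {π : G →* Aut A} {c : Choice π}
  [Linear ℂ C] [MonoidalLinear ℂ C]

section OrbitComponents

variable [Finite G] {α : Cocycle G (SimpleClass π)} (hα : c.IsCocycle α)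

lemma IsCocycle.orbitObj_smul {o : orbitRel.Quotient G (SimpleClass π)} {Y : EquivMod π}
    (x : OrbitAlg α o) (a : hα.orbitObj o Y) (t : o.orbit) :
    (x • a : hα.orbitObj o Y) t = ∑ g, x.coeff g t • c.conjAt Y g a t := rfl

lemma IsCocycle.orbitObj_ofFun_smul {o : orbitRel.Quotient G (SimpleClass π)} {Y : EquivMod π}
    (f : o.orbit → ℂ) (a : hα.orbitObj o Y) (t : o.orbit) :
    (TwistedAlg.ofFun (α.inv.onOrbit o) f • a : hα.orbitObj o Y) t =
      f t • (show c.X t ⟶ Y.M from a t) := by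
  rw [hα.orbitObj_smul, Finset.sum_eq_single 1]
  · rw [c.conjAt_eq Y 1 a t t (one_smul _ _), hα.conj_one, smul_smul (_ : ℂ)]
    simp [TwistedAlg.ofFun, Cocycle.onOrbit, Cocycle.inv]
  · intro g _ hg
    simp [TwistedAlg.ofFun, hg]
  · simp

/-- The identification of `orbitObj` with `⨁_s Hom_A(X_s, Y)`, which is linear over `ℂ`. -/
def IsCocycle.orbitEquiv (o : orbitRel.Quotient G (SimpleClass π)) (Y : EquivMod π) :
    hα.orbitObj o Y ≃ₗ[ℂ] (∀ s : o.orbit, c.X s ⟶ Y.M) where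
  toFun a := a
  invFun a := a
  map_add' _ _ := rfl
  map_smul' z a := by
    funext t
    have scalar_eq : algebraMap ℂ (OrbitAlg α o) z = TwistedAlg.ofFun _ fun _ => z := by
      rw [Algebra.algebraMap_eq_smul_one]
      ext k t
      rw [TwistedAlg.smul_coeff, TwistedAlg.one_def]
      by_cases hk : k = 1 <;> simp [TwistedAlg.ofFun, hk]
    change ((algebraMap ℂ (OrbitAlg α o) z) • a : hα.orbitObj o Y) t = _
    rw [scalar_eq, hα.orbitObj_ofFun_smul]
    rfl

open scoped Classical in
lemma IsCocycle.orbitEquiv_delta (o : orbitRel.Quotient G (SimpleClass π)) (Y : EquivMod π)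
    (s : o.orbit) (a : hα.orbitObj o Y) (t : o.orbit) :
    hα.orbitEquiv o Y (TwistedAlg.delta (α.inv.onOrbit o) s • a) t =
      if t = s then hα.orbitEquiv o Y a t else 0 := by
  refine (hα.orbitObj_ofFun_smul _ a t).trans ?_
  split_ifs with h
  · exact one_smul _ _
  · exact zero_smul _ _

lemma IsCocycle.orbitEquiv_u (o : orbitRel.Quotient G (SimpleClass π)) (Y : EquivMod π) (g : G)
    (a : hα.orbitObj o Y) {s t : o.orbit} (h : g • s = t) :
    hα.orbitEquiv o Y (TwistedAlg.u (α.inv.onOrbit o) g • a) t =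
      c.conj Y g (orbit_smul h) (hα.orbitEquiv o Y a s) := by
  refine (hα.orbitObj_smul _ a t).trans ?_
  rw [Finset.sum_eq_single g]
  · rw [c.conjAt_eq Y g a s t h]
    simp only [TwistedAlg.u, if_true]
    exact one_smul _ _
  · intro k _ hk
    simp [TwistedAlg.u, hk]
  · simp

open scoped Classical in
/-- The identification of the component at `s` of `orbitObj` with `Hom_A(X_s, Y)`. -/
def IsCocycle.componentEquiv (o : orbitRel.Quotient G (SimpleClass π)) (Y : EquivMod π)
    (s : o.orbit) : component (hα.orbitObj o Y) s ≃ₗ[ℂ] (c.X s ⟶ Y.M) where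
  toFun a := hα.orbitEquiv o Y a s
  map_add' _ _ := rfl
  map_smul' z a := congrFun ((hα.orbitEquiv o Y).map_smul z a) s
  invFun b := ⟨(hα.orbitEquiv o Y).symm (Pi.single s b), by
    refine mem_component.mpr ((hα.orbitEquiv o Y).injective (funext fun t => ?_))
    rw [hα.orbitEquiv_delta, LinearEquiv.apply_symm_apply]
    split_ifs with h
    · rfl
    · exact (Pi.single_eq_of_ne (M := fun s : o.orbit => c.X s ⟶ Y.M) h b).symm⟩
  left_inv a := by
    refine Subtype.ext ((hα.orbitEquiv o Y).injective (funext fun t => ?_))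
    have ha := hα.orbitEquiv_delta o Y s a t
    rw [mem_component.mp a.2] at ha
    rw [LinearEquiv.apply_symm_apply, ha]
    split_ifs with h
    · subst h
      exact Pi.single_eq_same _ _
    · exact Pi.single_eq_of_ne h _
  right_inv b := by simp

lemma IsCocycle.componentEquiv_componentAct (o : orbitRel.Quotient G (SimpleClass π))
    (Y : EquivMod π) (g : G) {s t : o.orbit} (h : g • s = t)
    (x : component (hα.orbitObj o Y) s) :
    hα.componentEquiv o Y t (componentAct (hα.orbitObj o Y) g h x) =
      c.conj Y g (orbit_smul h) (hα.componentEquiv o Y s x) :=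
  hα.orbitEquiv_u o Y g (x : hα.orbitObj o Y) h

lemma IsCocycle.componentAct_componentEquiv_symm (o : orbitRel.Quotient G (SimpleClass π))
    (Y : EquivMod π) (g : G) {s t : o.orbit} (h : g • s = t) (a : c.X s ⟶ Y.M) :
    componentAct (hα.orbitObj o Y) g h ((hα.componentEquiv o Y s).symm a) =
      (hα.componentEquiv o Y t).symm (c.conj Y g (orbit_smul h) a) := by
  rw [LinearEquiv.eq_symm_apply, hα.componentEquiv_componentAct, LinearEquiv.apply_symm_apply]

lemma IsCocycle.componentEquiv_componentMap (o : orbitRel.Quotient G (SimpleClass π))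
    {Y Z : EquivMod π} (m : Y ⟶ Z) (s : o.orbit) (x : component (hα.orbitObj o Y) s) :
    hα.componentEquiv o Z s (componentMap ((hα.orbitFunctor o).map m) s x) =
      hα.componentEquiv o Y s x ≫ m.hom := rfl

end OrbitComponents

section OrbitFunctor

variable [IsIdempotentComplete C] (hA : IsSemisimpleAlg A)
include hA

lemma finite_setOf_nontrivial_hom (c : Choice π) (M : Mod C A.X) :
    {s | Nontrivial (c.X s ⟶ M)}.Finite := by
  obtain ⟨ι, _, s, p, i, hpi⟩ := c.exists_decomposition hA M
  refine (Set.finite_range s).subset fun t ht => ?_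
  by_contra hts
  refine not_subsingleton_iff_nontrivial.mpr ht (subsingleton_of_forall_eq 0 fun a => ?_)
  rw [← Category.comp_id a, ← hpi, Preadditive.comp_sum]
  refine Finset.sum_eq_zero fun k _ => ?_
  rw [← Category.assoc, c.hom_eq_zero hA (fun h => hts ⟨k, h.symm⟩) (a ≫ p k), zero_comp]

lemma exists_hom_of_conj (c : Choice π) (Y Z : EquivMod π)
    (T : ∀ (o : orbitRel.Quotient G (SimpleClass π)) (s : o.orbit),
      (c.X s ⟶ Y.M) →ₗ[ℂ] (c.X s ⟶ Z.M))
    (hT : ∀ o (g : G) (s t : o.orbit) (h : g • s = t) (a : c.X s ⟶ Y.M),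
      T o t (c.conj Y g (orbit_smul h) a) = c.conj Z g (orbit_smul h) (T o s a)) :
    ∃ m : Y ⟶ Z, ∀ o (s : o.orbit) (a : c.X s ⟶ Y.M), a ≫ m.hom = T o s a := by
  obtain ⟨m, hm, -⟩ := existsUnique_hom_orbit hA c Y.M Z.M T
  have hm_hom {o : orbitRel.Quotient G (SimpleClass π)} (s : o.orbit) (a : c.X s ⟶ Y.M) :
      a.hom ≫ m.hom = (T o s a).hom :=
    (Mod.comp_hom' _ _).symm.trans (congrArg Mod.Hom.hom (hm o s a))
  refine ⟨⟨m, fun g => hom_ext_X_orbit hA c fun o s a => ?_⟩, hm⟩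
  rw [reassoc_of% (hm_hom s a), ← Category.assoc,
    ← c.f_conj Y g (orbit_smul (rfl : g • s = g • s)), Category.assoc, hm_hom (g • s),
    hT o g s _ rfl, c.f_conj]

variable [Finite G] {α : Cocycle G (SimpleClass π)} (hα : c.IsCocycle α)

lemma IsCocycle.homFunctor_isDirectSum (Y : EquivMod π) :
    isDirectSum.{max u v} (OrbitAlg α) (hα.homFunctor.obj Y) := by
  have := hA.finiteDimensional_hom
  refine ⟨fun o => ?_, ?_⟩
  · have := finite_orbit o
    exact (hα.orbitEquiv o Y).symm.finiteDimensional
  · let orbitOf : SimpleClass π → orbitRel.Quotient G (SimpleClass π) := Quotient.mk''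
    refine ((finite_setOf_nontrivial_hom hA c Y.M).image orbitOf).subset fun o ho => ?_
    have : Nontrivial (∀ s : o.orbit, c.X s ⟶ Y.M) :=
      (hα.orbitEquiv o Y).toEquiv.nontrivial_congr.mp ho
    obtain ⟨a, ha⟩ := exists_ne (0 : ∀ s : o.orbit, c.X s ⟶ Y.M)
    obtain ⟨s, hs⟩ := Function.ne_iff.mp ha
    exact ⟨s, ⟨_, _, hs⟩, orbitRel.Quotient.mem_orbit.mp s.2⟩

lemma IsCocycle.homFunctor_faithful : hα.homFunctor.Faithful where
  map_injective {Y Z m m'} h := by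
    ext1
    ext1
    refine hom_ext_X_orbit hA c fun o s a => ?_
    obtain ⟨x, rfl⟩ := (hα.componentEquiv o Y s).surjective a
    rw [← Mod.comp_hom', ← Mod.comp_hom', ← hα.componentEquiv_componentMap,
      ← hα.componentEquiv_componentMap]
    exact congrArg (fun f => (hα.componentEquiv o Z s (componentMap f s x)).hom) (congrFun h o)

lemma IsCocycle.exists_orbitFunctor_map_eq {Y Z : EquivMod π}
    (F : ∀ o, hα.orbitObj o Y ⟶ hα.orbitObj o Z) :
    ∃ m : Y ⟶ Z, ∀ o, (hα.orbitFunctor o).map m = F o := by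
  obtain ⟨m, hm⟩ := exists_hom_of_conj hA c Y Z
    (fun o s => (hα.componentEquiv o Z s).toLinearMap ∘ₗ componentMap (F o) s ∘ₗ
      (hα.componentEquiv o Y s).symm.toLinearMap) fun o g s t h a => by
    simp only [LinearMap.comp_apply, LinearEquiv.coe_coe]
    rw [← hα.componentAct_componentEquiv_symm o Y g h, componentMap_componentAct,
      hα.componentEquiv_componentAct]
  refine ⟨m, fun o => ?_⟩
  have := finite_orbit o
  refine hom_ext_component fun s x => (hα.componentEquiv o Z s).injective ?_
  refine (hα.componentEquiv_componentMap o m s x).trans ((hm o s _).trans ?_)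
  exact congrArg (fun y => hα.componentEquiv o Z s (componentMap (F o) s y))
    ((hα.componentEquiv o Y s).symm_apply_apply x)

lemma IsCocycle.homFunctor_full : hα.homFunctor.Full where
  map_surjective F := by
    obtain ⟨m, hm⟩ := hα.exists_orbitFunctor_map_eq hA F
    exact ⟨m, funext hm⟩

lemma IsCocycle.exists_homFunctor_iso [HasFiniteBiproducts C]
    (V : RepSum.{max u v} (OrbitAlg α)) :
    ∃ Y : EquivMod π, ∀ o, Nonempty (hα.orbitObj o Y ≅ V.obj o) := by
  have := V.property.1
  have finite_support : {o | ∃ s : o.orbit, Nontrivial (component (V.obj o) s)}.Finite :=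
    V.property.2.subset fun o ⟨s, _⟩ => (component (V.obj o) s).subtype_injective.nontrivial
  obtain ⟨Y, i, hi⟩ := hα.realize hA finite_support
    { ψ := fun o g _ _ h => componentAct (V.obj o) g h
      ψ_mul := fun o g h _ _ _ hst htr x => componentAct_componentAct (V.obj o) g h hst htr x
      ψ_one := fun o _ h x => componentAct_one (V.obj o) h x }
  refine ⟨Y, fun o => ?_⟩
  have := finite_orbit o
  refine nonempty_iso_of_component (fun s => hα.componentEquiv o Y s ≪≫ₗ (i o s).symm)
    fun g s t h x => ?_
  rw [LinearEquiv.trans_apply, LinearEquiv.trans_apply]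
  rw [hα.componentEquiv_componentAct, LinearEquiv.symm_apply_eq, hi, LinearEquiv.apply_symm_apply]

end OrbitFunctor

end Choice

/-! ### The equivalence with representations of the algebras of the orbits -/

section RepSum

universe v₁ u₁

variable {D : Type u₁} [Category.{v₁} D] {ι : Type*} {R : ι → Type*} [∀ i, Ring (R i)]
  [∀ i, Algebra ℂ (R i)]

/-- The equivalence onto a direct sum of categories of representations given by a full and faithful
functor `F` such that every object of the direct sum is, componentwise, isomorphic to a value
of `F`. -/
def repSumEquivalence (F : D ⥤ ∀ i, ModuleCat.{w} (R i))
    (hF : ∀ Y, isDirectSum.{w} R (F.obj Y)) (full : F.Full) (faithful : F.Faithful)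
    (exists_iso : ∀ V : RepSum.{w} R, ∃ Y, ∀ i, Nonempty (F.obj Y i ≅ V.obj i)) :
    D ≌ RepSum.{w} R :=
  have : ((isDirectSum.{w} R).lift F hF).IsEquivalence :=
    { essSurj := ⟨fun V => by
        obtain ⟨Y, hY⟩ := exists_iso V
        exact ⟨Y, ⟨(isDirectSum.{w} R).isoMk (Pi.isoMk fun i => (hY i).some)⟩⟩⟩ }
  ((isDirectSum.{w} R).lift F hF).asEquivalence

variable [Preadditive D] {F : D ⥤ ∀ i, ModuleCat.{w} (R i)}
  {hF : ∀ Y, isDirectSum.{w} R (F.obj Y)} {full : F.Full} {faithful : F.Faithful}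
  {exists_iso : ∀ V : RepSum.{w} R, ∃ Y, ∀ i, Nonempty (F.obj Y i ≅ V.obj i)}

lemma repSumEquivalence_additive [F.Additive] :
    (repSumEquivalence F hF full faithful exists_iso).functor.Additive :=
  inferInstanceAs ((isDirectSum.{w} R).lift F hF).Additive

open scoped ModuleCat in
lemma repSumEquivalence_linear [Linear ℂ D] [F.Linear ℂ] :
    (repSumEquivalence F hF full faithful exists_iso).functor.Linear ℂ where
  map_smul f z := ObjectProperty.hom_ext _ (F.map_smul z f)

end RepSum

namespace Choice

open MulAction
open scoped ModuleCat

attribute [local instance] Fintype.ofFinite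

variable {C : Type u} [Category.{v} C] [MonoidalCategory C] [Preadditive C]
  [MonoidalPreadditive C] {G : Type w} [Group G] [Finite G] {A : Mon C} {π : G →* Aut A}
  {c : Choice π} [Linear ℂ C] [MonoidalLinear ℂ C] {α : Cocycle G (SimpleClass π)}
  (hα : c.IsCocycle α)

instance : hα.homFunctor.Additive where
  map_add {_ _ f g} := funext fun o => ModuleCat.hom_ext (LinearMap.ext fun a =>
    funext fun s => by exact Preadditive.comp_add _ _ _ (a s) f.hom g.hom)

instance : hα.homFunctor.Linear ℂ where
  map_smul {Y Z} f z := funext fun o => ModuleCat.hom_ext (LinearMap.ext fun a => by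
    apply (hα.orbitEquiv o Z).injective
    refine Eq.trans ?_ ((hα.orbitEquiv o Z).map_smul z (hα.orbitMap o f a)).symm
    funext s
    exact Linear.comp_smul _ _ _ (hα.orbitEquiv o Y a s) z f.hom)

variable [IsIdempotentComplete C] [HasFiniteBiproducts C] (hA : IsSemisimpleAlg A)

/-- The equivalence of `D` with `⨁_O Rep A_{α⁻¹}(G, O)` given by `homFunctor`. -/
def IsCocycle.homEquivalence : EquivMod π ≌ RepSum.{max u v} (OrbitAlg α) :=
  repSumEquivalence hα.homFunctor (hα.homFunctor_isDirectSum hA) (hα.homFunctor_full hA)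
    (hα.homFunctor_faithful hA) (hα.exists_homFunctor_iso hA)

/-- The counit isomorphisms of `homEquivalence`, componentwise. -/
def IsCocycle.homEquivalenceIso (V : RepSum.{max u v} (OrbitAlg α))
    (o : orbitRel.Quotient G (SimpleClass π)) :
    V.obj o ≅ hα.orbitObj o ((hα.homEquivalence hA).inverse.obj V) :=
  (Pi.eval _ o).mapIso ((isDirectSum _).ι.mapIso ((hα.homEquivalence hA).counitIso.symm.app V))

/-- The isomorphisms `V_s ≅ Hom_A(X_s, Y)` for the object `Y` of `D` corresponding to a family of
representations `V`. -/
def IsCocycle.sumTensorEquiv (V : RepSum.{max u v} (OrbitAlg α))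
    (o : orbitRel.Quotient G (SimpleClass π)) (s : o.orbit) :
    component (V.obj o) s ≃ₗ[ℂ] (c.X s ⟶ ((hα.homEquivalence hA).inverse.obj V).M) :=
  componentIso (hα.homEquivalenceIso hA V o) s ≪≫ₗ hα.componentEquiv o _ s

lemma IsCocycle.sumTensorEquiv_apply (V : RepSum.{max u v} (OrbitAlg α))
    (o : orbitRel.Quotient G (SimpleClass π)) (s : o.orbit) (x : component (V.obj o) s) :
    hα.sumTensorEquiv hA V o s x =
      hα.componentEquiv o _ s (componentMap (hα.homEquivalenceIso hA V o).hom s x) := rfl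

lemma IsCocycle.sumTensorEquiv_componentAct (V : RepSum.{max u v} (OrbitAlg α))
    (o : orbitRel.Quotient G (SimpleClass π)) (g : G) {s t : o.orbit} (h : g • s = t)
    (x : component (V.obj o) s) :
    hα.sumTensorEquiv hA V o t (componentAct (V.obj o) g h x) =
      c.conj _ g (orbit_smul h) (hα.sumTensorEquiv hA V o s x) := by
  rw [sumTensorEquiv_apply, sumTensorEquiv_apply, componentMap_componentAct,
    hα.componentEquiv_componentAct]

lemma IsCocycle.isSumTensor (V : RepSum.{max u v} (OrbitAlg α)) :
    IsSumTensor c α V.obj ((hα.homEquivalence hA).inverse.obj V)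
      (fun o s => (hα.sumTensorEquiv hA V o s).toLinearMap) where
  universal Z j := by
    obtain ⟨m, hm, hu⟩ := existsUnique_hom_orbit hA c ((hα.homEquivalence hA).inverse.obj V).M Z
      fun o s => j o s ∘ₗ (hα.sumTensorEquiv hA V o s).symm.toLinearMap
    refine ⟨m, fun o s x => (hm o s _).trans ?_, fun m' hm' => hu m' fun o s a => ?_⟩
    · simp
    · simpa using hm' o s ((hα.sumTensorEquiv hA V o s).symm a)
  equivariant g o s t h x := by
    rw [LinearEquiv.coe_coe, LinearEquiv.coe_coe, sumTensorEquiv_componentAct, f_conj]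

lemma IsCocycle.homEquivalenceIso_naturality {V W : RepSum.{max u v} (OrbitAlg α)} (m : V ⟶ W)
    (o : orbitRel.Quotient G (SimpleClass π)) :
    m.hom o ≫ (hα.homEquivalenceIso hA W o).hom = (hα.homEquivalenceIso hA V o).hom ≫
      (hα.orbitFunctor o).map ((hα.homEquivalence hA).inverse.map m) :=
  congrArg (fun f => f.hom o) ((hα.homEquivalence hA).counitInv.naturality m)

lemma IsCocycle.sumTensorEquiv_naturality {V W : RepSum.{max u v} (OrbitAlg α)} (m : V ⟶ W)
    (o : orbitRel.Quotient G (SimpleClass π)) (s : o.orbit) (x : component (V.obj o) s) :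
    hα.sumTensorEquiv hA V o s x ≫ ((hα.homEquivalence hA).inverse.map m).hom =
      hα.sumTensorEquiv hA W o s (componentMap (m.hom o) s x) :=
  (congrArg (fun f => hα.componentEquiv o _ s (componentMap f s x))
    (hα.homEquivalenceIso_naturality hA m o)).symm

end Choice

/-! ### Transport along an orbit -/

section Transport

open MulAction

variable {G T : Type*} [Group G] [MulAction G T] {r : orbitRel.Quotient G T → T}
  (hr : ∀ o, (Quotient.mk'' (r o) : orbitRel.Quotient G T) = o)

/-- The chosen representative of an orbit, as an element of the orbit. -/
def orbitRep (o : orbitRel.Quotient G T) : o.orbit :=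
  ⟨r o, orbitRel.Quotient.mem_orbit.mpr (hr o)⟩

include hr in
lemma exists_smul_rep_eq {o : orbitRel.Quotient G T} (s : o.orbit) : ∃ g : G, g • r o = s :=
  orbitRel_apply.mp (Quotient.exact ((orbitRel.Quotient.mem_orbit.mp s.2).trans (hr o).symm))

open scoped Classical in
/-- A chosen element of `G` that moves the representative of an orbit to the element `s`. It is `1`
if `s` is the representative itself. -/
def transporter {o : orbitRel.Quotient G T} (s : o.orbit) : G :=
  if s = orbitRep hr o then 1 else (exists_smul_rep_eq hr s).choose

lemma transporter_smul {o : orbitRel.Quotient G T} (s : o.orbit) :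
    transporter hr s • r o = s := by
  unfold transporter
  split_ifs with hs
  · rw [hs, one_smul]
    rfl
  · exact (exists_smul_rep_eq hr s).choose_spec

lemma transporter_inv_smul {o : orbitRel.Quotient G T} (s : o.orbit) :
    (transporter hr s)⁻¹ • (s : T) = r o := by
  rw [← transporter_smul hr s, inv_smul_smul]

lemma transporter_orbitRep (o : orbitRel.Quotient G T) : transporter hr (orbitRep hr o) = 1 :=
  if_pos rfl

/-- The element `γ_t⁻¹ g γ_s` of the stabilizer of the representative, where `g s = t` and `γ` is
the `transporter`. -/
def transportStab (g : G) {o : orbitRel.Quotient G T} {s t : o.orbit} (h : g • s = t) :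
    stabilizer G (r o) :=
  ⟨(transporter hr t)⁻¹ * (g * transporter hr s), by
    rw [mem_stabilizer_iff, mul_smul, mul_smul, transporter_smul, inv_smul_eq_iff,
      transporter_smul, ← h]
    rfl⟩

lemma coe_transportStab (g : G) {o : orbitRel.Quotient G T} {s t : o.orbit} (h : g • s = t) :
    (transportStab hr g h : G) = (transporter hr t)⁻¹ * (g * transporter hr s) := rfl

lemma transporter_mul_transportStab (g : G) {o : orbitRel.Quotient G T} {s t : o.orbit}
    (h : g • s = t) : transporter hr t * transportStab hr g h = g * transporter hr s :=
  mul_inv_cancel_left _ _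

lemma transportStab_mul (g h : G) {o : orbitRel.Quotient G T} {s t p : o.orbit}
    (hst : h • s = t) (htp : g • t = p) :
    transportStab hr g htp * transportStab hr h hst =
      transportStab hr (g * h) (by rw [mul_smul, hst, htp] : (g * h) • s = p) := by
  apply Subtype.ext
  rw [Subgroup.coe_mul]
  simp only [coe_transportStab]
  group

lemma transportStab_one {o : orbitRel.Quotient G T} {s : o.orbit} (h : (1 : G) • s = s) :
    transportStab hr 1 h = 1 :=
  Subtype.ext (by rw [coe_transportStab, one_mul, inv_mul_cancel, Subgroup.coe_one])

lemma transportStab_orbitRep {o : orbitRel.Quotient G T} (g : stabilizer G (r o))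
    (h : (g : G) • orbitRep hr o = orbitRep hr o) : transportStab hr (g : G) h = g :=
  Subtype.ext (by rw [coe_transportStab, transporter_orbitRep, inv_one, one_mul, mul_one])

variable (α : Cocycle G T)

/-- The scalar by which the action of `g` on a projective family differs from that of
`transportStab` when the members of the family over an orbit are identified by transport. -/
def transportScalar (g : G) {o : orbitRel.Quotient G T} {s t : o.orbit} (h : g • s = t) : ℂˣ :=
  (α.toFun g (transporter hr s) t)⁻¹ * α.toFun (transporter hr t) (transportStab hr g h) t

lemma transportScalar_mul (g h : G) {o : orbitRel.Quotient G T} {s t p : o.orbit}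
    (hst : h • s = t) (htp : g • t = p) :
    transportScalar hr α g htp * transportScalar hr α h hst *
        (α.toFun (transportStab hr g htp) (transportStab hr h hst) (r o))⁻¹ =
      (α.toFun g h p)⁻¹ *
        transportScalar hr α (g * h) (by rw [mul_smul, hst, htp] : (g * h) • s = p) := by
  have hp : g⁻¹ • (p : T) = t := inv_smul_eq_iff.mpr (congrArg Subtype.val htp.symm)
  have cocycle_s := α.cocycle g h (transporter hr s) p
  have cocycle_t := α.cocycle g (transporter hr t) (transportStab hr h hst) p
  have cocycle_p := α.cocycle (transporter hr p) (transportStab hr g htp) (transportStab hr h hst) p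
  rw [hp] at cocycle_s
  rw [hp, transporter_mul_transportStab] at cocycle_t
  rw [transporter_inv_smul, ← Subgroup.coe_mul, transportStab_mul, transporter_mul_transportStab]
    at cocycle_p
  simp only [transportScalar, Units.ext_iff, Units.val_mul, Units.val_inv_eq_inv_val]
    at cocycle_s cocycle_t cocycle_p ⊢
  field_simp
  grind

lemma transportScalar_one {o : orbitRel.Quotient G T} {s : o.orbit} (h : (1 : G) • s = s) :
    transportScalar hr α 1 h = (α.toFun 1 1 s)⁻¹ * α.toFun 1 1 (r o) := by
  rw [transportScalar, transportStab_one, Subgroup.coe_one, α.one_left,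
    α.one_right (transporter hr s), transporter_inv_smul]

lemma transportScalar_orbitRep {o : orbitRel.Quotient G T} (g : stabilizer G (r o))
    (h : (g : G) • orbitRep hr o = orbitRep hr o) : transportScalar hr α (g : G) h = 1 := by
  have hg : (g : G)⁻¹ • (orbitRep hr o : T) = orbitRep hr o := (g⁻¹).2
  rw [transportScalar, transportStab_orbitRep, transporter_orbitRep, α.one_left, α.one_right, hg,
    inv_mul_cancel]

end Transport

/-! ### Representations of the twisted group algebras of the stabilizers -/

namespace TwistedGroupAlg

attribute [local instance] Fintype.ofFinite

variable {H : Type*} [Group H] {α : ScalarCocycle H}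

open scoped Classical in
/-- The basis element `g` of the twisted group algebra. -/
def u (α : ScalarCocycle H) (g : H) : TwistedGroupAlg α := ⟨fun k => if k = g then 1 else 0⟩

lemma u_one : u α 1 = ((α.toFun 1 1 : ℂˣ) : ℂ) • (1 : TwistedGroupAlg α) := by
  ext k
  by_cases hk : k = 1 <;> simp [u, one_coeff, hk]

lemma sum_coeff {J : Type*} (F : Finset J) (x : J → TwistedGroupAlg α) (k : H) :
    (∑ j ∈ F, x j).coeff k = ∑ j ∈ F, (x j).coeff k :=
  map_sum (G := TwistedGroupAlg α →+ ℂ)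
    { toFun := fun y => y.coeff k
      map_zero' := rfl
      map_add' := fun _ _ => rfl } x F

variable [Finite H]

lemma u_mul_u (g h : H) : u α g * u α h = ((α.toFun g h : ℂˣ) : ℂ) • u α (g * h) := by
  ext k
  rw [mul_coeff, Finset.sum_eq_single g, smul_coeff]
  · by_cases hk : k = g * h
    · subst hk
      simp [u]
    · have : g⁻¹ * k ≠ h := fun e => hk (by rw [← e, mul_inv_cancel_left])
      simp [u, hk, this]
  · intro k' _ hk'
    simp [u, hk']
  · simp

lemma eq_sum (x : TwistedGroupAlg α) : x = ∑ g, x.coeff g • u α g := by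
  ext k
  rw [sum_coeff, Finset.sum_eq_single k]
  · simp [u]
  · intro g _ hg
    simp [u, hg.symm]
  · simp

open scoped ModuleCat in
lemma map_smul_of_map_u_smul {V W : ModuleCat.{w} (TwistedGroupAlg α)} (L : V →ₗ[ℂ] W)
    (hL : ∀ g x, L (u α g • x) = u α g • L x) (a : TwistedGroupAlg α) (x : V) :
    L (a • x) = a • L x := by
  rw [a.eq_sum]
  simp only [Finset.sum_smul, map_sum, smul_assoc, map_smul, hL]

end TwistedGroupAlg

namespace Choice

open MulAction
open scoped ModuleCat

variable {C : Type u} [Category.{v} C] [MonoidalCategory C] [Preadditive C]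
  [MonoidalPreadditive C] {G : Type w} [Group G] {A : Mon C} {π : G →* Aut A} {c : Choice π}
  [Linear ℂ C] [MonoidalLinear ℂ C]
  {α : Cocycle G (SimpleClass π)} (hα : c.IsCocycle α)
include hα

lemma IsCocycle.conj_conj_of_mul_eq_one (Y : EquivMod π) {g h : G} (hgh : g * h = 1)
    {s t : SimpleClass π} (hst : h • s = t) (hts : g • t = s) (a : c.X s ⟶ Y.M) :
    c.conj Y g hts (c.conj Y h hst a) =
      (((α.toFun g h s)⁻¹ * (α.toFun 1 1 s)⁻¹ : ℂˣ) : ℂ) • a := by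
  have conj_mul : c.conj Y (g * h) (by rw [mul_smul, hst, hts]) a =
      c.conj Y 1 (one_smul G s) a := by
    congr 2
  rw [hα.conj_conj, conj_mul, hα.conj_one, smul_smul (_ : ℂ), Units.val_mul]

lemma IsCocycle.conj_bijective (Y : EquivMod π) (g : G) {s t : SimpleClass π} (h : g • s = t) :
    Function.Bijective (c.conj Y g h) := by
  have h' : g⁻¹ • t = s := inv_smul_eq_iff.mpr h.symm
  constructor
  · refine (injective_iff_map_eq_zero _).mpr fun a ha => ?_
    have conj_inv_conj := hα.conj_conj_of_mul_eq_one Y (inv_mul_cancel g) h h' a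
    rw [ha, map_zero] at conj_inv_conj
    exact (smul_eq_zero.mp conj_inv_conj.symm).resolve_left (Units.ne_zero _)
  · intro b
    refine ⟨(((α.toFun g g⁻¹ t)⁻¹ * (α.toFun 1 1 t)⁻¹ : ℂˣ) : ℂ)⁻¹ • c.conj Y g⁻¹ h' b, ?_⟩
    rw [map_smul, hα.conj_conj_of_mul_eq_one Y (mul_inv_cancel g) h' h b,
      inv_smul_smul₀ (Units.ne_zero _)]

/-- `conj` as a linear equivalence `Hom_A(X_s, Y) ≃ Hom_A(X_{gs}, Y)`. -/
def IsCocycle.conjEquiv (Y : EquivMod π) (g : G) {s t : SimpleClass π} (h : g • s = t) :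
    (c.X s ⟶ Y.M) ≃ₗ[ℂ] (c.X t ⟶ Y.M) :=
  LinearEquiv.ofBijective (c.conj Y g h) (hα.conj_bijective Y g h)

lemma IsCocycle.conjEquiv_apply (Y : EquivMod π) (g : G) {s t : SimpleClass π} (h : g • s = t)
    (a : c.X s ⟶ Y.M) : hα.conjEquiv Y g h a = c.conj Y g h a := rfl

section Transport

variable {r : orbitRel.Quotient G (SimpleClass π) → SimpleClass π}
  (hr : ∀ o, (Quotient.mk'' (r o) : orbitRel.Quotient G (SimpleClass π)) = o)

lemma IsCocycle.conj_conj_transporter (Y : EquivMod π) (g : G)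
    {o : orbitRel.Quotient G (SimpleClass π)} {s t : o.orbit} (h : g • s = t)
    (a : c.X (r o) ⟶ Y.M) :
    c.conj Y g (orbit_smul h) (c.conj Y (transporter hr s) (transporter_smul hr s) a) =
      ((transportScalar hr α g h : ℂˣ) : ℂ) •
        c.conj Y (transporter hr t) (transporter_smul hr t)
          (c.conj Y (transportStab hr g h) (stab_smul _) a) := by
  have conj_mul : c.conj Y (g * transporter hr s)
      (by rw [mul_smul, transporter_smul, orbit_smul h]) a =
      c.conj Y (transporter hr t * transportStab hr g h)
        (by rw [mul_smul, stab_smul, transporter_smul]) a := by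
    congr 2
    rw [transporter_mul_transportStab]
  rw [hα.conj_conj, hα.conj_conj, conj_mul, smul_smul (_ : ℂ), ← Units.val_mul, transportScalar,
    mul_inv_cancel_right]

include hr in
lemma IsCocycle.exists_hom_of_conj_rep [IsIdempotentComplete C] (hA : IsSemisimpleAlg A)
    (Y Z : EquivMod π) (T : ∀ o, (c.X (r o) ⟶ Y.M) →ₗ[ℂ] (c.X (r o) ⟶ Z.M))
    (hT : ∀ o (h : stabilizer G (r o)) (a : c.X (r o) ⟶ Y.M),
      T o (c.conj Y h (stab_smul h) a) = c.conj Z h (stab_smul h) (T o a)) :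
    ∃ m : Y ⟶ Z, ∀ o (a : c.X (r o) ⟶ Y.M), a ≫ m.hom = T o a := by
  let conjTo (W : EquivMod π) {o : orbitRel.Quotient G (SimpleClass π)} (s : o.orbit) :=
    hα.conjEquiv W (transporter hr s) (transporter_smul hr s)
  let T' (o : orbitRel.Quotient G (SimpleClass π)) (s : o.orbit) :
      (c.X s ⟶ Y.M) →ₗ[ℂ] (c.X s ⟶ Z.M) :=
    (conjTo Z s).toLinearMap ∘ₗ T o ∘ₗ (conjTo Y s).symm.toLinearMap
  have T'_conjTo {o} (s : o.orbit) (a) : T' o s (conjTo Y s a) = conjTo Z s (T o a) := by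
    simp [T']
  obtain ⟨m, hm⟩ := exists_hom_of_conj hA c Y Z T' fun o g s t h a => by
    obtain ⟨b, rfl⟩ := (conjTo Y s).surjective a
    rw [T'_conjTo]
    simp only [conjTo, conjEquiv_apply]
    rw [hα.conj_conj_transporter hr Y g h, hα.conj_conj_transporter hr Z g h, ← hT, map_smul]
    exact congrArg _ (T'_conjTo t _)
  refine ⟨m, fun o a => ?_⟩
  obtain ⟨b, rfl⟩ := (conjTo Y (orbitRep hr o)).surjective a
  refine (hm o (orbitRep hr o) _).trans ((T'_conjTo _ b).trans ?_)
  exact (hT o ⟨_, transporter_smul hr (orbitRep hr o)⟩ b).symm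

end Transport

end Choice

/-! ### The equivalence with representations of the twisted group algebras -/

section Induction

open MulAction
open scoped ModuleCat

variable {G T : Type*} [Group G] [MulAction G T] {r : orbitRel.Quotient G T → T}
  (hr : ∀ o, (Quotient.mk'' (r o) : orbitRel.Quotient G T) = o) [Finite G] {α : Cocycle G T}
  (W : ∀ o : orbitRel.Quotient G T, ModuleCat.{w} (TwistedGroupAlg (α.inv.atPoint (r o))))

/-- The action of `g` on the family over an orbit all of whose members are the representation of the
stabilizer of the representative; this is the induced representation with the member at `s`
identified with the member at the representative by `transporter`. -/
def inducedMap (g : G) {o : orbitRel.Quotient G T} {s t : o.orbit} (h : g • s = t) :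
    W o →ₗ[ℂ] W o :=
  ((transportScalar hr α g h : ℂˣ) : ℂ) •
    Algebra.lsmul ℂ ℂ (W o) (TwistedGroupAlg.u (α.inv.atPoint (r o)) (transportStab hr g h))

lemma inducedMap_apply (g : G) {o : orbitRel.Quotient G T} {s t : o.orbit} (h : g • s = t)
    (x : W o) : inducedMap hr W g h x = ((transportScalar hr α g h : ℂˣ) : ℂ) •
      TwistedGroupAlg.u (α.inv.atPoint (r o)) (transportStab hr g h) • x := rfl

/-- The projective family induced from representations of the twisted group algebras of the
stabilizers of representatives. -/
def inducedFamily : ProjectiveFamily α (fun o (_ : o.orbit) => W o) where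
  ψ _ g _ _ h := inducedMap hr W g h
  ψ_mul o g h s t p hst htp x := by
    have u_mul_u := TwistedGroupAlg.u_mul_u (α := α.inv.atPoint (r o)) (transportStab hr g htp)
      (transportStab hr h hst)
    simp only [inducedMap_apply]
    rw [smul_comm (TwistedGroupAlg.u _ _) (_ : ℂ), ← mul_smul (TwistedGroupAlg.u _ _), u_mul_u,
      transportStab_mul, smul_assoc, smul_smul (_ : ℂ), smul_smul (_ : ℂ), smul_smul (_ : ℂ),
      ← Units.val_mul, ← Units.val_mul, ← Units.val_mul, ← transportScalar_mul hr α g h hst htp]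
    rfl
  ψ_one o s h x := by
    rw [inducedMap_apply, transportStab_one, transportScalar_one, TwistedGroupAlg.u_one, smul_assoc,
      one_smul, smul_smul (_ : ℂ), ← Units.val_mul]
    exact congrArg (fun z : ℂˣ => (z : ℂ) • x) (mul_inv_cancel_right _ _)

lemma inducedFamily_ψ_orbitRep {o : orbitRel.Quotient G T} (g : stabilizer G (r o))
    (h : (g : G) • orbitRep hr o = orbitRep hr o) (x : W o) :
    (inducedFamily hr W).ψ o (g : G) h x = TwistedGroupAlg.u (α.inv.atPoint (r o)) g • x := by
  refine (inducedMap_apply hr W (g : G) h x).trans ?_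
  rw [transportScalar_orbitRep, transportStab_orbitRep, Units.val_one, one_smul]

end Induction

namespace Choice

open MulAction
open scoped ModuleCat

attribute [local instance] Fintype.ofFinite

variable {C : Type u} [Category.{v} C] [MonoidalCategory C] [Preadditive C]
  [MonoidalPreadditive C] {G : Type w} [Group G] [Finite G] {A : Mon C} {π : G →* Aut A}
  {c : Choice π} [Linear ℂ C] [MonoidalLinear ℂ C] {α : Cocycle G (SimpleClass π)}
  (hα : c.IsCocycle α)

lemma IsCocycle.stabObj_smul {s : SimpleClass π} {Y : EquivMod π} (x : StabAlg α s)
    (a : hα.stabObj s Y) :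
    (x • a : hα.stabObj s Y) = ∑ g, x.coeff g • c.conj Y g (stab_smul g) a := rfl

include hα in
lemma IsCocycle.sum_algebraMap_coeff_smul_conj {s : SimpleClass π} {Y : EquivMod π} (z : ℂ)
    (a : c.X s ⟶ Y.M) :
    ∑ g, (algebraMap ℂ (StabAlg α s) z).coeff g • c.conj Y g (stab_smul g) a = z • a := by
  rw [Finset.sum_eq_single 1, Algebra.algebraMap_eq_smul_one]
  · have conj_one := hα.conj_one Y (one_smul G s) a
    simp only [Subgroup.coe_one]
    rw [conj_one, smul_smul (_ : ℂ)]
    simp [TwistedGroupAlg.one_coeff, Cocycle.atPoint, Cocycle.inv]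
  · intro g _ hg
    simp [Algebra.algebraMap_eq_smul_one, TwistedGroupAlg.one_coeff, hg]
  · simp

/-- The identification of `stabObj` with `Hom_A(X_s, Y)`, which is linear over `ℂ`. -/
def IsCocycle.stabEquiv (s : SimpleClass π) (Y : EquivMod π) :
    hα.stabObj s Y ≃ₗ[ℂ] (c.X s ⟶ Y.M) where
  toFun a := a
  invFun a := a
  map_add' _ _ := rfl
  map_smul' z a := hα.sum_algebraMap_coeff_smul_conj z a

lemma IsCocycle.stabEquiv_u (s : SimpleClass π) (Y : EquivMod π) (g : stabilizer G s)
    (a : hα.stabObj s Y) :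
    hα.stabEquiv s Y (TwistedGroupAlg.u (α.inv.atPoint s) g • a) =
      c.conj Y g (stab_smul g) (hα.stabEquiv s Y a) := by
  refine (hα.stabObj_smul _ a).trans ?_
  rw [Finset.sum_eq_single g]
  · simp only [TwistedGroupAlg.u, if_true]
    exact one_smul ℂ (c.conj Y g (stab_smul g) a)
  · intro k _ hk
    simp [TwistedGroupAlg.u, hk]
  · simp

lemma IsCocycle.stabEquiv_symm_conj (s : SimpleClass π) (Y : EquivMod π) (g : stabilizer G s)
    (a : c.X s ⟶ Y.M) :
    (hα.stabEquiv s Y).symm (c.conj Y g (stab_smul g) a) =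
      TwistedGroupAlg.u (α.inv.atPoint s) g • (hα.stabEquiv s Y).symm a := by
  rw [LinearEquiv.symm_apply_eq, hα.stabEquiv_u, LinearEquiv.apply_symm_apply]

lemma IsCocycle.stabEquiv_map (s : SimpleClass π) {Y Z : EquivMod π} (m : Y ⟶ Z)
    (a : hα.stabObj s Y) :
    hα.stabEquiv s Z (((hα.stabFunctor s).map m).hom a) = hα.stabEquiv s Y a ≫ m.hom := rfl

variable {r : orbitRel.Quotient G (SimpleClass π) → SimpleClass π}

instance : (hα.stabHomFunctor r).Additive where
  map_add {_ _ f g} := funext fun o => ModuleCat.hom_ext (LinearMap.ext fun a => by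
    exact Preadditive.comp_add _ _ _ (a : c.X (r o) ⟶ _) f.hom g.hom)

instance : (hα.stabHomFunctor r).Linear ℂ where
  map_smul {Y Z} f z := funext fun o => ModuleCat.hom_ext (LinearMap.ext fun a => by
    apply (hα.stabEquiv (r o) Z).injective
    refine Eq.trans ?_ ((hα.stabEquiv (r o) Z).map_smul z _).symm
    exact Linear.comp_smul _ _ _ (hα.stabEquiv (r o) Y a) z f.hom)

variable (hr : ∀ o, (Quotient.mk'' (r o) : orbitRel.Quotient G (SimpleClass π)) = o)
  [IsIdempotentComplete C] (hA : IsSemisimpleAlg A)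
include hr hA

lemma IsCocycle.stabHomFunctor_isDirectSum (Y : EquivMod π) :
    isDirectSum.{v} (fun o => StabAlg α (r o)) ((hα.stabHomFunctor r).obj Y) := by
  have := hA.finiteDimensional_hom
  have finite_support : {o | Nontrivial (c.X (r o) ⟶ Y.M)}.Finite :=
    Set.Finite.preimage (f := r) (s := {s | Nontrivial (c.X s ⟶ Y.M)})
      (Function.LeftInverse.injective hr).injOn (finite_setOf_nontrivial_hom hA c Y.M)
  exact ⟨fun o => (hα.stabEquiv (r o) Y).symm.finiteDimensional, finite_support⟩

lemma IsCocycle.stabHomFunctor_faithful : (hα.stabHomFunctor r).Faithful where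
  map_injective {Y Z m m'} h := by
    ext1
    ext1
    refine hom_ext_X_orbit hA c fun o s a => ?_
    obtain ⟨b, rfl⟩ := (hα.conj_bijective Y _ (transporter_smul hr s)).2 a
    have comp_eq : b ≫ m.hom = b ≫ m'.hom :=
      congrArg (fun F => F.hom ((hα.stabEquiv (r o) Y).symm b)) (congrFun h o)
    rw [← Mod.comp_hom', ← Mod.comp_hom', conj_comp, conj_comp, comp_eq]

lemma IsCocycle.exists_stabFunctor_map_eq {Y Z : EquivMod π}
    (F : ∀ o, hα.stabObj (r o) Y ⟶ hα.stabObj (r o) Z) :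
    ∃ m : Y ⟶ Z, ∀ o, (hα.stabFunctor (r o)).map m = F o := by
  obtain ⟨m, hm⟩ := hα.exists_hom_of_conj_rep hr hA Y Z
    (fun o => (hα.stabEquiv (r o) Z).toLinearMap ∘ₗ (F o).hom.restrictScalars ℂ ∘ₗ
      (hα.stabEquiv (r o) Y).symm.toLinearMap) fun o h a => by
    simp only [LinearMap.comp_apply, LinearEquiv.coe_coe, LinearMap.restrictScalars_apply]
    rw [hα.stabEquiv_symm_conj, map_smul, hα.stabEquiv_u]
  refine ⟨m, fun o => ModuleCat.hom_ext (LinearMap.ext fun x => ?_)⟩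
  apply (hα.stabEquiv (r o) Z).injective
  refine (hα.stabEquiv_map (r o) m x).trans ((hm o _).trans ?_)
  exact congrArg (fun y => hα.stabEquiv (r o) Z ((F o).hom y))
    ((hα.stabEquiv (r o) Y).symm_apply_apply x)

lemma IsCocycle.stabHomFunctor_full : (hα.stabHomFunctor r).Full where
  map_surjective F := by
    obtain ⟨m, hm⟩ := hα.exists_stabFunctor_map_eq hr hA F
    exact ⟨m, funext hm⟩

lemma IsCocycle.exists_stabHomFunctor_iso [HasFiniteBiproducts C]
    (W : RepSum.{v} (fun o => StabAlg α (r o))) :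
    ∃ Y : EquivMod π, ∀ o, Nonempty (hα.stabObj (r o) Y ≅ W.obj o) := by
  have := W.property.1
  have finite_support : {o : orbitRel.Quotient G (SimpleClass π) |
      ∃ _ : o.orbit, Nontrivial (W.obj o)}.Finite :=
    W.property.2.subset fun o ⟨_, hs⟩ => hs
  obtain ⟨Y, i, hi⟩ := hα.realize hA finite_support (inducedFamily hr W.obj)
  refine ⟨Y, fun o => ?_⟩
  let j : W.obj o ≃ₗ[ℂ] (c.X (r o) ⟶ Y.M) := i o (orbitRep hr o)
  have j_u_smul (g : stabilizer G (r o)) (x : W.obj o) :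
      j (TwistedGroupAlg.u (α.inv.atPoint (r o)) g • x) = c.conj Y g (stab_smul g) (j x) := by
    have hg : (g : G) • orbitRep hr o = orbitRep hr o := Subtype.ext g.2
    rw [← inducedFamily_ψ_orbitRep hr W.obj g hg]
    exact hi o g _ _ hg x
  let L : W.obj o ≃ₗ[ℂ] hα.stabObj (r o) Y := j ≪≫ₗ (hα.stabEquiv (r o) Y).symm
  have L_smul := TwistedGroupAlg.map_smul_of_map_u_smul L.toLinearMap fun g x => by
    simp only [L, LinearEquiv.coe_coe, LinearEquiv.trans_apply]
    rw [j_u_smul, hα.stabEquiv_symm_conj]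
  exact ⟨(({ L with map_smul' := L_smul } :
    W.obj o ≃ₗ[StabAlg α (r o)] hα.stabObj (r o) Y).toModuleIso).symm⟩

/-- The equivalence of `D` with `⨁_{s ∈ R} Rep ℂ^{α_s⁻¹}[G_s]` given by `stabHomFunctor`. -/
def IsCocycle.stabHomEquivalence [HasFiniteBiproducts C] :
    EquivMod π ≌ RepSum.{v} (fun o => StabAlg α (r o)) :=
  repSumEquivalence (hα.stabHomFunctor r) (hα.stabHomFunctor_isDirectSum hr hA)
    (hα.stabHomFunctor_full hr hA) (hα.stabHomFunctor_faithful hr hA)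
    (hα.exists_stabHomFunctor_iso hr hA)

end Choice

end Orbifold

end

theorem mainTheorem7_general
    {C : Type u} [Category.{v} C] [Preadditive C] [HasFiniteBiproducts C]
    [IsIdempotentComplete C] [Linear ℂ C] [MonoidalCategory C] [MonoidalPreadditive C]
    [MonoidalLinear ℂ C] {G : Type w} [Group G] [Finite G] (A : Mon C) (hA : IsSemisimpleAlg A)
    (π : G →* Aut A) (c : Choice π) :
    IsAbelian (EquivMod π) ∧
    ∃ (α : Cocycle G (SimpleClass π)) (hα : c.IsCocycle α),
      (∀ α' : Cocycle G (SimpleClass π), c.IsCocycle α' → α' = α) ∧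
      (∃ (E : EquivMod π ≌ RepSum.{max u v} (Choice.OrbitAlg α))
        (i : ∀ (V : RepSum.{max u v} (Choice.OrbitAlg α))
          (o : MulAction.orbitRel.Quotient G (SimpleClass π)) (s : o.orbit),
          component (V.obj o) s →ₗ[ℂ] (c.X s ⟶ (E.inverse.obj V).M)),
        E.functor.Additive ∧ E.functor.Linear ℂ ∧
        Nonempty (E.functor ⋙ (isDirectSum.{max u v} (Choice.OrbitAlg α)).ι ≅ hα.homFunctor) ∧
        (∀ V, IsSumTensor c α V.obj (E.inverse.obj V) (i V)) ∧
        (∀ (V W : RepSum.{max u v} (Choice.OrbitAlg α)) (m : V ⟶ W)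
          (o : MulAction.orbitRel.Quotient G (SimpleClass π)) (s : o.orbit)
          (x : component (V.obj o) s),
          i V o s x ≫ (E.inverse.map m).hom = i W o s (componentMap (m.hom o) s x))) ∧
      (∀ r : MulAction.orbitRel.Quotient G (SimpleClass π) → SimpleClass π,
        (∀ o, (Quotient.mk'' (r o) : MulAction.orbitRel.Quotient G (SimpleClass π)) = o) →
        ∃ E : EquivMod π ≌ RepSum.{v} (fun o => Choice.StabAlg α (r o)),
          E.functor.Additive ∧ E.functor.Linear ℂ ∧
          Nonempty (E.functor ⋙ (isDirectSum.{v} (fun o => Choice.StabAlg α (r o))).ι ≅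
            hα.stabHomFunctor r)) := by
  obtain ⟨α, hα⟩ := c.exists_cocycle hA
  refine ⟨(EquivMod.allRegular hA.allRegular).isAbelian, α, hα,
    fun _ hα' => hα.unique hα', ?orbits, ?stabilizers⟩
  case orbits =>
    exact ⟨hα.homEquivalence hA, fun V o s => (hα.sumTensorEquiv hA V o s).toLinearMap,
      repSumEquivalence_additive, repSumEquivalence_linear, ⟨Iso.refl _⟩, hα.isSumTensor hA,
      fun _ _ m o s x => hα.sumTensorEquiv_naturality hA m o s x⟩
  case stabilizers =>
    exact fun _ hr => ⟨hα.stabHomEquivalence hr hA, repSumEquivalence_additive,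
      repSumEquivalence_linear, ⟨Iso.refl _⟩⟩

theorem mainTheorem7
    {C : Type u} [Category.{v} C] [Abelian C] [Linear ℂ C] [MonoidalCategory C]
    [MonoidalPreadditive C] [MonoidalLinear ℂ C] [BraidedCategory C] [RigidCategory C]
    [BalancedRigid C] (hC : IsSemisimpleCat C) (hone : Simple (𝟙_ C))
    {G : Type w} [Group G] [Finite G]
    (A : Mon C) [IsCommMonObj A.X] (hA : IsRigidAlgebra A) (hθ : theta A.X = 𝟙 A.X)
    (π : G →* Aut A) (hπ : Function.Injective π) (hinv : InvariantsEqUnit π)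
    (c : Choice π) :
    IsAbelian (EquivMod π) ∧
    ∃ (α : Cocycle G (SimpleClass π)) (hα : c.IsCocycle α),
      (∀ α' : Cocycle G (SimpleClass π), c.IsCocycle α' → α' = α) ∧
      (∃ (E : EquivMod π ≌ RepSum.{max u v} (Choice.OrbitAlg α))
        (i : ∀ (V : RepSum.{max u v} (Choice.OrbitAlg α))
          (o : MulAction.orbitRel.Quotient G (SimpleClass π)) (s : o.orbit),
          component (V.obj o) s →ₗ[ℂ] (c.X s ⟶ (E.inverse.obj V).M)),
        E.functor.Additive ∧ E.functor.Linear ℂ ∧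
        Nonempty (E.functor ⋙ (isDirectSum.{max u v} (Choice.OrbitAlg α)).ι ≅ hα.homFunctor) ∧
        (∀ V, IsSumTensor c α V.obj (E.inverse.obj V) (i V)) ∧
        (∀ (V W : RepSum.{max u v} (Choice.OrbitAlg α)) (m : V ⟶ W)
          (o : MulAction.orbitRel.Quotient G (SimpleClass π)) (s : o.orbit)
          (x : component (V.obj o) s),
          i V o s x ≫ (E.inverse.map m).hom = i W o s (componentMap (m.hom o) s x))) ∧
      (∀ r : MulAction.orbitRel.Quotient G (SimpleClass π) → SimpleClass π,
        (∀ o, (Quotient.mk'' (r o) : MulAction.orbitRel.Quotient G (SimpleClass π)) = o) →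
        ∃ E : EquivMod π ≌ RepSum.{v} (fun o => Choice.StabAlg α (r o)),
          E.functor.Additive ∧ E.functor.Linear ℂ ∧
          Nonempty (E.functor ⋙ (isDirectSum.{v} (fun o => Choice.StabAlg α (r o))).ι ≅
            hα.stabHomFunctor r)) := by
  have := Abelian.hasFiniteBiproducts (C := C)
  exact mainTheorem7_general A (hA.isSemisimpleAlg hC hθ) π c
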